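/- Throughout, $v,v_*\in\mathbb R^3$, $\sigma\in\mathbb S^2$, $v'=\frac{v+v_*}2+\frac{|v-v_*|}2\sigma$, $v'_*=\frac{v+v_*}2-\frac{|v-v_*|}2\sigma$, $\cos\theta=\big\langle\frac{v-v_*}{|v-v_*|},\sigma\big\rangle$, and $$Q(f,g)(v)=\int_{\mathbb R^3}\int_{\mathbb S^2}B\,\{f(v'_*)g(v')-f(v_*)g(v)\}\,d\sigma\,dv_*,\qquad B=(1+|v-v_*|^2)^{\gamma/2}\,b(\cos\theta),$$ where $\gamma\in\mathbb R$ and $b\ge0$ is measurable, vanishes for $\theta>\pi/2$, satisfies that $\sin\theta\, b(\cos\theta)$ is bounded above and below by positive multiples of $\theta^{-1-2s}$ as $\theta\to0^+$, and $\sin\theta\,b(\cos\theta)$ is integrable on $[\delta,\pi/2]$ for every $\delta>0$. Put $W_l(v)=(1+|v|^2)^{l/2}$, $\gamma^+=\max\{\gamma,0\}$, $\|f\|_{L^p_l}=\|W_lf\|_{L^p(\mathbb R^3)}$, $\|f\|_{H^m_l}=\|W_lf\|_{H^m(\mathbb R^3)}$. For $f,g,h$ (complex valued), the commutator product $$\mathcal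 C_l(f,g,h)=\Big(W_l\,Q(f,g)-Q(f,W_l\,g),\,h\Big)_{L^2(\mathbb R^3)}$$ is understood as $\lim_{\delta\to0^+}\big(W_lQ_\delta(f,g)-Q_\delta(f,W_lg),h\big)_{L^2}$, where $Q_\delta$ is $Q$ with the angular integral restricted to $\theta\ge\delta$. Let $l\in\mathbb N=\{0,1,2,\dots\}$. For all $f,g,h$ for which the norms on the right-hand side below are finite, the integrals defining $Q_\delta(f,g)(v)$ and $Q_\delta(f,W_lg)(v)$ (for almost every $v$) and their commutator product with $h$ converge absolutely for every $\delta>0$, the limit $\mathcal C_l(f,g,h)$ exists, and the following hold, with constants independent of $f,g,h$. (1) If $0<s<1/2$, there is $C>0$ such that $$|\mathcal C_l(f,g,h)|\le C\,\|f\|_{L^1_{l+\gamma^+}}\|g\|_{L^2_{l+\gamma^+}}\|h\|_{L^2}.$$ If moreover $l>\frac32+2s$ (in particular if $l\ge3$), there is $C>0$ such that $$|\mathcal C_l(f,g,h)|\le C\,\|f\|_{L^2_{l+\gamma^+}}\|g\|_{L^2_{l+\gamma^+}}\|h\|_{L^2}.$$ (2) If $1/2<s<1$, then for every $\varepsilon>0$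 there is $C_\varepsilon>0$ such that $$|\mathcal C_l(f,g,h)|\le C_\varepsilon\,\|f\|_{L^1_{l+2s-1+\gamma^+}}\|g\|_{H^{2s-1+\varepsilon}_{l+2s-1+\gamma^+}}\|h\|_{L^2}$$ and $$|\mathcal C_l(f,g,h)|\le C_\varepsilon\,\|f\|_{L^1_{l+2s-1+\gamma^+}}\|g\|_{L^2_{l+2s-1+\gamma^+}}\|h\|_{H^{2s-1+\varepsilon}_l}.$$ (3) If $s=1/2$, the two estimates of (2) hold with $2s-1$ replaced by any $\kappa>0$: for all $\kappa,\varepsilon>0$ there is $C_{\kappa,\varepsilon}>0$ such that $$|\mathcal C_l(f,g,h)|\le C_{\kappa,\varepsilon}\,\|f\|_{L^1_{l+\kappa+\gamma^+}}\|g\|_{H^{\kappa+\varepsilon}_{l+\kappa+\gamma^+}}\|h\|_{L^2},\qquad |\mathcal C_l(f,g,h)|\le C_{\kappa,\varepsilon}\,\|f\|_{L^1_{l+\kappa+\gamma^+}}\|g\|_{L^2_{l+\kappa+\gamma^+}}\|h\|_{H^{\kappa+\varepsilon}_l}.$$ -/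

import Mathlib

open MeasureTheory Filter Topology Asymptotics
open scoped ENNReal SchwartzMap ComplexConjugate

noncomputable section

namespace Boltzmann

/-- The velocity space `ℝ³` with its Euclidean norm. -/
abbrev V : Type := EuclideanSpace ℝ (Fin 3)

/-- The unit sphere `𝕊²` of directions `σ`. -/
abbrev S2 : Type := Metric.sphere (0 : V) 1

/-- The surface measure `dσ` on `𝕊²` (of total mass `4π`). -/
def sphereMeasure : Measure S2 := (volume : Measure V).toSphere

/-- The post-collisional velocity `v' = (v + v_*)/2 + |v - v_*| σ / 2`. -/
def postVel (v w : V) (σ : S2) : V :=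
  (1 / 2 : ℝ) • (v + w) + (‖v - w‖ / 2) • (σ : V)

/-- The post-collisional velocity `v'_* = (v + v_*)/2 - |v - v_*| σ / 2`. -/
def postVelStar (v w : V) (σ : S2) : V :=
  (1 / 2 : ℝ) • (v + w) - (‖v - w‖ / 2) • (σ : V)

/-- The deviation angle `θ ∈ [0, π]`, `cos θ = ⟨(v - v_*)/|v - v_*|, σ⟩`. -/
def deviation (v w : V) (σ : S2) : ℝ := InnerProductGeometry.angle (v - w) (σ : V)

/-- The weight `W_l(v) = (1 + |v|²)^{l/2}`. -/
def weight (l : ℝ) (v : V) : ℝ := (1 + ‖v‖ ^ 2) ^ (l / 2)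

/-- The assumptions on the angular factor `b` with singularity index `s`: it is non-negative,
`b(cos θ)` lives on `0 ≤ θ ≤ π/2`, and `θ = 0` is its only singularity, where `sin θ b(cos θ)` is
comparable, from above and from below, to `θ^{-1-2s}` (in particular this holds if
`sin θ b(cos θ) / θ^{-1-2s}` tends to some `K > 0`). -/
structure IsAngularFactor (s : ℝ) (b : ℝ → ℝ) : Prop where
  measurable : Measurable b
  nonneg : ∀ x, 0 ≤ b x
  eq_zero_of_neg : ∀ x, x < 0 → b x = 0
  singular : (fun θ : ℝ => Real.sin θ * b (Real.cos θ)) =Θ[𝓝[>] (0 : ℝ)]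
    (fun θ : ℝ => θ ^ (-1 - 2 * s))
  integrable_away : ∀ δ : ℝ, 0 < δ →
    IntegrableOn (fun θ : ℝ => Real.sin θ * b (Real.cos θ)) (Set.Icc δ (Real.pi / 2))

/-- The cross-section `B(v - v_*, σ) = Φ(|v - v_*|) b(cos θ)`, with the kinetic factor
`Φ(z) = (1 + z²)^{γ/2}`. -/
def crossSection (γ : ℝ) (b : ℝ → ℝ) (v w : V) (σ : S2) : ℝ :=
  (1 + ‖v - w‖ ^ 2) ^ (γ / 2) * b (Real.cos (deviation v w σ))

open Classical in
/-- The integrand in `(v_*, σ)` of the collision operator, `B {f(v'_*) g(v') - f(v_*) g(v)}`,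
with the grazing collisions `θ < δ` removed. -/
def collisionIntegrand (γ : ℝ) (b : ℝ → ℝ) (δ : ℝ) (f g : V → ℂ) (v : V) (p : V × S2) : ℂ :=
  if δ ≤ deviation v p.1 p.2 then
    (crossSection γ b v p.1 p.2 : ℂ) *
      (f (postVelStar v p.1 p.2) * g (postVel v p.1 p.2) - f p.1 * g v)
  else 0

/-- The truncated collision operator
`Q_δ(f, g)(v) = ∫∫_{θ ≥ δ} B {f(v'_*) g(v') - f(v_*) g(v)} dσ dv_*`. The singular integral `Q(f, g)`
is its limit as `δ → 0+` (for `s ≥ 1/2` the integral over all angles is not absolutely convergent,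
even for smooth `f` and `g`, and has to be read in this sense). -/
def truncQ (γ : ℝ) (b : ℝ → ℝ) (δ : ℝ) (f g : V → ℂ) (v : V) : ℂ :=
  ∫ p : V × S2, collisionIntegrand γ b δ f g v p ∂((volume : Measure V).prod sphereMeasure)

/-- Multiplication of a function by the weight `W_l`. -/
def weighted (l : ℝ) (g : V → ℂ) (v : V) : ℂ := (weight l v : ℂ) * g v

/-- The truncated commutator `W_l Q_δ(f, g) - Q_δ(f, W_l g)`. -/
def truncCommutator (γ : ℝ) (b : ℝ → ℝ) (l δ : ℝ) (f g : V → ℂ) (v : V) : ℂ :=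
  (weight l v : ℂ) * truncQ γ b δ f g v - truncQ γ b δ f (weighted l g) v

/-- `(W_l Q(f, g) - Q(f, W_l g), h)_{L²}` is well defined and equal to `L`: all the integrals
with the grazing collisions `θ < δ` removed converge absolutely, and the `L²` products
`(W_l Q_δ(f, g) - Q_δ(f, W_l g), h)` tend to `L` as `δ → 0+`. -/
structure HasCommutatorPairing (γ : ℝ) (b : ℝ → ℝ) (l : ℝ) (f g h : V → ℂ) (L : ℂ) : Prop where
  integrable_left : ∀ δ : ℝ, 0 < δ → ∀ᵐ v : V,
    Integrable (collisionIntegrand γ b δ f g v) ((volume : Measure V).prod sphereMeasure)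
  integrable_right : ∀ δ : ℝ, 0 < δ → ∀ᵐ v : V,
    Integrable (collisionIntegrand γ b δ f (weighted l g) v)
      ((volume : Measure V).prod sphereMeasure)
  integrable_pairing : ∀ δ : ℝ, 0 < δ →
    Integrable (fun v : V => truncCommutator γ b l δ f g v * conj (h v))
  tendsto : Tendsto (fun δ : ℝ => ∫ v : V, truncCommutator γ b l δ f g v * conj (h v))
    (𝓝[>] (0 : ℝ)) (𝓝 L)

/-- Membership in the weighted Lebesgue space `L^p_l`: `W_l f ∈ L^p(ℝ³)`. -/
def MemLpW (p : ℝ≥0∞) (l : ℝ) (f : V → ℂ) : Prop := MemLp (weighted l f) p volume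

/-- The norm `‖f‖_{L^p_l} = ‖W_l f‖_{L^p}` (used for `f` in `L^p_l`). -/
def normLpW (p : ℝ≥0∞) (l : ℝ) (f : V → ℂ) : ℝ := (eLpNorm (weighted l f) p volume).toReal

/-- The norm `‖g‖_{H^m_l} = ‖W_l g‖_{H^m}`, `m ≥ 0`, with value `∞` if `g` is not in `H^m_l`:
it is the `L²` norm of `G`, where `G ∈ L²` is the Bessel potential
`𝓕⁻¹ ((1 + |ξ|²)^{m/2} 𝓕 (W_l g))`, and the infimum over the (at most one) such `G`. -/
def enormHW (m l : ℝ) (g : V → ℂ) : ℝ≥0∞ :=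
  ⨅ (u : Lp ℂ 2 (volume : Measure V)) (_ : u =ᵐ[volume] weighted l g)
    (G : Lp ℂ 2 (volume : Measure V))
    (_ : TemperedDistribution.besselPotential V ℂ m (u : 𝓢'(V, ℂ)) = (G : 𝓢'(V, ℂ))), ‖G‖ₑ

/-- Membership in the weighted Sobolev space `H^m_l`, `m ≥ 0`. -/
def MemHW (m l : ℝ) (g : V → ℂ) : Prop := enormHW m l g < ∞

/-- The norm of `H^m_l` as a real number (used for `g` in `H^m_l`). -/
def normHW (m l : ℝ) (g : V → ℂ) : ℝ := (enormHW m l g).toReal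

end Boltzmann

end

open Boltzmann

/-!
The change of variables between a collision and its inverse (`measurePreserving_prePost`) turns the
truncated commutator product into the integral over `θ ≥ δ` of
`B f(v_*) g(v) conj h(v') (W_l(v') - W_l(v))`, the function `kern`. The loss parts of the two
collision operators cancel, and the singularity of `b` at `θ = 0` meets the weight difference, which
is of first order in `θ`. It remains to integrate `kern`, if necessary after a symmetrization, and
to let `δ → 0` by dominated convergence (`exists_hasCommutatorPairing`).

For `s < 1/2` one factor `θ` makes the angular integral converge. For fixed `v_*` both `v` and `v'`
have a marginal dominated by Lebesgue measure (`DominatedMarginal`, from the Jacobian of `v ↦ v'`),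
so that the Cauchy-Schwarz inequality gives the estimate with `f` in a weighted `L¹` space. For `f`
in `L²` the weight difference is split into `⟨v⟩^l (θ ⟨v_*⟩)^β` with `β > 2s` and `(θ ⟨v_*⟩)^l`
(`abs_weight_sub_le_add`). The first term loses `3/2 + β < l` powers of the weight of `f`. In the
second one `f` and `h` are integrated over `v_*` for fixed `v`, where the Jacobian of `v_* ↦ v'`
costs a factor `θ^{-3}`, shared by the two factors of the Cauchy-Schwarz inequality
(`lintegral_partner_mul_le`).

For `s ≥ 1/2` the part of first order in `θ` has to cancel. The integral of `kern` is unchanged by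
two measure preserving maps that keep `θ`: the half turn of `σ` about `v - v_*` (`turnPost`), under
which the two values of `v' - v` add up to a vector of second order, and the exchange of `v` with
its reflection in `v'` (`swapPre`), under which the two values of `v' - v` add up to zero.
Averaging `kern` over the map leaves, for `x = θ ⟨v_*⟩ ≤ 1/4`, terms of order `x²` and terms of order
`x` that multiply an increment between `v` and `v'` of `W_l h` for the first map, and of the weighted
function `g` for the second one (`exists_norm_kern_add_turnPost_le`,
`exists_norm_kern_add_swapPre_le`); the collisions with `x > 1/4` are not singular. Angular
integrals of these coefficients grow like `⟨v_*⟩^{1+κ}` if `2s ≤ 1 + κ`, which explains the weight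
of `f`.

Increments of a function `F` along a collision are estimated through averages over balls
(`enorm_sub_sq_le_average`): `|F(v') - F(v)|²` is bounded by the means of the squared increments
from `v` and from `v'` over balls of radius comparable to a bound of `|v' - v|`. After integration
over the collisions only the `L²` modulus of continuity of `F` is left, which the Fourier transform
bounds by the Sobolev norm of order `m > κ` (`lintegral_translate_sub_le`,
`IsAngularFactor.exists_lintegral_increment_le`).
-/

noncomputable section

namespace Boltzmann

/-! ### Polar coordinates and the sphere -/

instance : SFinite sphereMeasure := by unfold sphereMeasure; infer_instance
instance : IsFiniteMeasure sphereMeasure := by unfold sphereMeasure; infer_instance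

lemma finrank_V : Module.finrank ℝ V = 3 := by simp

lemma norm_S2 (σ : S2) : ‖(σ : V)‖ = 1 := norm_eq_of_mem_sphere σ

/-- Integration in polar coordinates on `ℝ³`. -/
lemma lintegral_polar (F : V → ℝ≥0∞) (hF : Measurable F) :
    ∫⁻ u, F u = ∫⁻ r : Set.Ioi (0 : ℝ), ∫⁻ k : S2, F ((r : ℝ) • (k : V)) ∂sphereMeasure
      ∂(Measure.volumeIoiPow 2) := by
  have hmp := (volume : Measure V).measurePreserving_homeomorphUnitSphereProd
  rw [finrank_V] at hmp
  have h1 : ∫⁻ u, F u = ∫⁻ u : ({0}ᶜ : Set V), F u ∂((volume : Measure V).comap (↑)) := by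
    rw [lintegral_subtype_comap (measurableSet_singleton _).compl]
    have h0 : ∀ᵐ u : V, u ∈ ({0}ᶜ : Set V) := compl_mem_ae_iff.mpr (measure_singleton _)
    rw [Measure.restrict_eq_self_of_ae_mem h0]
  rw [h1, ← hmp.symm (homeomorphUnitSphereProd V).toMeasurableEquiv |>.lintegral_comp_emb
    (MeasurableEquiv.measurableEmbedding _)]
  rw [lintegral_prod_symm]
  · rfl
  · refine Measurable.aemeasurable ?_
    fun_prop

/-- A fixed point of the sphere, the value of `dir` at the origin. -/
def pole : S2 := ⟨EuclideanSpace.single 2 1, by simp⟩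

/-- The direction `u / |u|` of a vector, with the junk value `pole` at the origin. -/
def dir (u : V) : S2 :=
  ⟨if u = 0 then (pole : V) else ‖u‖⁻¹ • u, by
    split_ifs with h
    · exact pole.2
    · simp [norm_smul, h]⟩

lemma norm_smul_dir (u : V) : ‖u‖ • (dir u : V) = u := by
  by_cases h : u = 0
  · simp [h]
  · simp [dir, h, smul_smul]

lemma dir_smul {r : ℝ} (hr : 0 < r) (k : S2) : dir (r • (k : V)) = k := by
  have hk : (k : V) ≠ 0 := by
    intro h; have := norm_S2 k; simp [h] at this
  ext1
  simp [dir, hr.ne', hk, norm_smul, abs_of_pos hr, smul_smul]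

lemma measurable_dir : Measurable dir := by
  refine Measurable.subtype_mk (Measurable.ite (measurableSet_singleton _) ?_ ?_)
  · exact measurable_const
  · fun_prop

/-- Exchange of the direction of a relative velocity with a point of the sphere. -/
def swapDir (p : V × S2) : V × S2 := (‖p.1‖ • (p.2 : V), dir p.1)

lemma measurable_swapDir : Measurable swapDir := by
  unfold swapDir
  have := measurable_dir
  fun_prop

/-- In polar coordinates the exchange is the exchange of two points of the sphere at a fixed radius.
-/
lemma measurePreserving_swapDir :
    MeasurePreserving swapDir ((volume : Measure V).prod sphereMeasure)
      ((volume : Measure V).prod sphereMeasure) := by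
  refine ⟨measurable_swapDir, Measure.ext_of_lintegral _ fun F hF => ?_⟩
  have hd := measurable_dir
  rw [lintegral_map hF measurable_swapDir, lintegral_prod _ (by
    have := hF.comp measurable_swapDir; exact this.aemeasurable), lintegral_prod _ hF.aemeasurable,
    lintegral_polar _ (by
      have := hF.comp measurable_swapDir
      exact this.lintegral_prod_right'), lintegral_polar _ hF.lintegral_prod_right']
  refine lintegral_congr fun r => ?_
  rw [lintegral_lintegral_swap]
  · refine lintegral_congr fun σ => lintegral_congr fun k => ?_
    have hr : (0 : ℝ) < r := r.2
    simp [swapDir, dir_smul hr, norm_smul, abs_of_pos hr]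
  · refine Measurable.aemeasurable ?_
    have := hF.comp measurable_swapDir
    exact this.comp (by fun_prop : Measurable fun p : S2 × S2 => (((r : ℝ) • (p.1 : V), p.2)))

/-- Integrals over the sphere as integrals over the ball; this transfers facts about Lebesgue
measure, such as its invariance under rotations, to `sphereMeasure`. -/
lemma lintegral_sphere_eq_ball (F : S2 → ℝ≥0∞) (hF : Measurable F) :
    ∫⁻ u in Metric.ball (0 : V) 1, F (dir u) =
      ENNReal.ofReal (1 / 3) * ∫⁻ k, F k ∂sphereMeasure := by
  have hd := measurable_dir
  rw [← lintegral_indicator measurableSet_ball, lintegral_polar]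
  · have : ∀ r : Set.Ioi (0 : ℝ), ∫⁻ k : S2, (Metric.ball (0 : V) 1).indicator
        (fun u => F (dir u)) ((r : ℝ) • (k : V)) ∂sphereMeasure
        = (Set.Iio (⟨1, Set.mem_Ioi.2 one_pos⟩ : Set.Ioi (0 : ℝ))).indicator
          (fun _ => ∫⁻ k, F k ∂sphereMeasure) r := by
      intro r
      have hr : (0 : ℝ) < r := r.2
      by_cases h : (r : ℝ) < 1
      · rw [Set.indicator_of_mem (by exact h)]
        refine lintegral_congr fun k => ?_
        rw [Set.indicator_of_mem, dir_smul hr]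
        simp [norm_smul, abs_of_pos hr, h]
      · rw [Set.indicator_of_notMem (by exact h)]
        rw [← lintegral_zero (μ := sphereMeasure)]
        refine lintegral_congr fun k => ?_
        rw [Set.indicator_of_notMem]
        simp [norm_smul, abs_of_pos hr, not_lt.mp h]
    simp_rw [this]
    rw [lintegral_indicator measurableSet_Iio, setLIntegral_const, Measure.volumeIoiPow_apply_Iio,
      mul_comm]
    norm_num
  · exact (hF.comp hd).indicator measurableSet_ball

/-- The action of a linear isometry on the unit sphere. -/
def sphereMap (R : V ≃ₗᵢ[ℝ] V) (σ : S2) : S2 := ⟨R σ, by simp⟩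

lemma measurable_sphereMap (R : V ≃ₗᵢ[ℝ] V) : Measurable (sphereMap R) :=
  (R.continuous.measurable.comp measurable_subtype_coe).subtype_mk

lemma dir_isometry (R : V ≃ₗᵢ[ℝ] V) {u : V} (hu : u ≠ 0) : dir (R u) = sphereMap R (dir u) := by
  ext1
  simp [dir, sphereMap, hu]

lemma measurePreserving_sphereMap (R : V ≃ₗᵢ[ℝ] V) :
    MeasurePreserving (sphereMap R) sphereMeasure sphereMeasure := by
  refine ⟨measurable_sphereMap R, Measure.ext_of_lintegral _ fun F hF => ?_⟩
  rw [lintegral_map hF (measurable_sphereMap R)]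
  have h3 : ENNReal.ofReal (1 / 3) ≠ 0 := by simp
  refine (ENNReal.mul_right_inj h3 ENNReal.ofReal_ne_top).mp ?_
  rw [← lintegral_sphere_eq_ball _ hF,
    ← lintegral_sphere_eq_ball (fun σ => F (sphereMap R σ)) (hF.comp (measurable_sphereMap R))]
  rw [← (R.measurePreserving.restrict_preimage (s := Metric.ball (0 : V) 1)
    measurableSet_ball).lintegral_comp (f := fun u => F (dir u)) (hF.comp measurable_dir)]
  have : R ⁻¹' Metric.ball (0 : V) 1 = Metric.ball 0 1 := by ext; simp
  rw [this]
  refine lintegral_congr_ae ?_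
  filter_upwards [ae_restrict_of_ae (compl_mem_ae_iff.mpr (measure_singleton (0 : V)))] with u hu
  rw [dir_isometry R hu]

lemma dir_ne_zero_smul {u : V} (hu : u ≠ 0) : (dir u : V) = ‖u‖⁻¹ • u := by
  simp [dir, hu]

/-- The reflection in the plane orthogonal to `n - m` maps `n` to `m`. -/
lemma exists_isometry_map (n m : S2) : ∃ R : V ≃ₗᵢ[ℝ] V, sphereMap R n = m := by
  refine ⟨(Submodule.span ℝ {(n : V) - m})ᗮ.reflection, ?_⟩
  ext1
  exact Submodule.reflection_sub (by simp)

/-- The integral over `ℝ³` as an iterated integral over the height and the horizontal plane. -/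
lemma lintegral_coord (G : ℝ → ℝ → ℝ → ℝ≥0∞)
    (hG : Measurable fun p : ℝ × ℝ × ℝ => G p.1 p.2.1 p.2.2) :
    ∫⁻ u : V, G (u 2) (u 0) (u 1) = ∫⁻ z, ∫⁻ q : ℝ × ℝ, G z q.1 q.2 := by
  have h1 := (EuclideanSpace.volume_preserving_symm_measurableEquiv_toLp (Fin 3))
  have h2 := volume_preserving_piFinSuccAbove (fun _ : Fin 3 => ℝ) 2
  have h3 := volume_preserving_finTwoArrow ℝ
  have h4 := ((MeasurePreserving.id (volume : Measure ℝ)).prod h3).comp (h2.comp h1)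
  have h5 := h4.lintegral_comp hG
  rw [← lintegral_prod (fun p : ℝ × ℝ × ℝ => G p.1 p.2.1 p.2.2) hG.aemeasurable]
  exact h5

/-- The half plane of heights `z` and horizontal radii `r > 0`, with the factor `r` of the
horizontal polar coordinates, is again given polar coordinates `(R, θ)`; then `r = R sin θ`. -/
lemma lintegral_ball_angle (F : ℝ → ℝ≥0∞) (hF : Measurable F) :
    ∫⁻ u in Metric.ball (0 : V) 1, F (InnerProductGeometry.angle (pole : V) u) =
      ENNReal.ofReal (1 / 3) * (ENNReal.ofReal (2 * Real.pi) *
        ∫⁻ θ in Set.Ioo 0 Real.pi, ENNReal.ofReal (Real.sin θ) * F θ) := by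
  set G : ℝ → ℝ → ℝ → ℝ≥0∞ := fun z x y =>
    if z ^ 2 + (x ^ 2 + y ^ 2) < 1 then F (Real.arccos (z / √(z ^ 2 + (x ^ 2 + y ^ 2)))) else 0
    with hGdef
  have hG : Measurable fun p : ℝ × ℝ × ℝ => G p.1 p.2.1 p.2.2 := by
    refine Measurable.ite (measurableSet_lt (by fun_prop) (by fun_prop)) ?_ measurable_const
    exact hF.comp (Real.continuous_arccos.measurable.comp (by fun_prop))
  have e1 : ∫⁻ u in Metric.ball (0 : V) 1, F (InnerProductGeometry.angle (pole : V) u) =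
      ∫⁻ u : V, G (u 2) (u 0) (u 1) := by
    rw [← lintegral_indicator measurableSet_ball]
    refine lintegral_congr fun u => ?_
    have hn : ‖u‖ = √(u 2 ^ 2 + (u 0 ^ 2 + u 1 ^ 2)) := by
      rw [EuclideanSpace.norm_eq, Fin.sum_univ_three]
      simp only [Real.norm_eq_abs, sq_abs]
      congr 1; ring
    have hin : inner ℝ (pole : V) u = u 2 := by
      simp [pole, EuclideanSpace.inner_single_left]
    simp only [hGdef, Set.indicator, mem_ball_zero_iff, InnerProductGeometry.angle, hin, norm_S2,
      one_mul, hn]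
    congr 1
    rw [Real.sqrt_lt' one_pos, one_pow]
  have e2 : ∀ z, ∫⁻ q : ℝ × ℝ, G z q.1 q.2 = ENNReal.ofReal (2 * Real.pi) * ∫⁻ r in Set.Ioi (0:ℝ),
      ENNReal.ofReal r * G z r 0 := by
    intro z
    rw [← lintegral_comp_polarCoord_symm (fun q => G z q.1 q.2), polarCoord_target,
      Measure.volume_eq_prod, ← Measure.prod_restrict, lintegral_prod]
    · rw [← lintegral_const_mul]
      · refine setLIntegral_congr_fun measurableSet_Ioi fun r hr => ?_
        have : ∀ φ : ℝ, ENNReal.ofReal r • G z (polarCoord.symm (r, φ)).1 (polarCoord.symm (r, φ)).2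
            = ENNReal.ofReal r * G z r 0 := by
          intro φ
          have h : (r * Real.cos φ) ^ 2 + (r * Real.sin φ) ^ 2 = r ^ 2 + 0 ^ 2 := by
            linear_combination r ^ 2 * Real.sin_sq_add_cos_sq φ
          simp only [polarCoord_symm_apply, smul_eq_mul, hGdef, h]
        simp only [this, lintegral_const, Measure.restrict_apply MeasurableSet.univ, Set.univ_inter,
          Real.volume_Ioo]
        rw [mul_comm]; congr 2; ring
      · have : Measurable fun r : ℝ => ((z, (r, (0:ℝ))) : ℝ × ℝ × ℝ) := by fun_prop
        have := hG.comp this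
        exact ENNReal.measurable_ofReal.mul this
    · refine Measurable.aemeasurable ?_
      have : Measurable fun p : ℝ × ℝ => ((z, polarCoord.symm p) : ℝ × ℝ × ℝ) :=
        measurable_const.prodMk continuous_polarCoord_symm.measurable
      have := hG.comp this
      exact (ENNReal.measurable_ofReal.comp measurable_fst).mul this
  have e3 : ∫⁻ z, ∫⁻ r in Set.Ioi (0:ℝ), ENNReal.ofReal r * G z r 0 =
      ENNReal.ofReal (1 / 3) * ∫⁻ θ in Set.Ioo 0 Real.pi, ENNReal.ofReal (Real.sin θ) * F θ := by
    have hm : Measurable fun q : ℝ × ℝ => ENNReal.ofReal q.2 * G q.1 q.2 0 :=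
      (ENNReal.measurable_ofReal.comp measurable_snd).mul
        (hG.comp (by fun_prop : Measurable fun q : ℝ × ℝ => ((q.1, q.2, (0:ℝ)) : ℝ × ℝ × ℝ)))
    have t1 : ∫⁻ z, ∫⁻ r in Set.Ioi (0:ℝ), ENNReal.ofReal r * G z r 0 =
        ∫⁻ q : ℝ × ℝ, ENNReal.ofReal q.2 * G q.1 q.2 0 := by
      rw [Measure.volume_eq_prod, lintegral_prod _ hm.aemeasurable]
      refine lintegral_congr fun z => ?_
      rw [← lintegral_indicator measurableSet_Ioi]
      refine lintegral_congr fun r => ?_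
      by_cases hr : 0 < r
      · rw [Set.indicator_of_mem (by exact hr)]
      · rw [Set.indicator_of_notMem (by exact hr)]
        simp [ENNReal.ofReal_of_nonpos (not_lt.mp hr)]
    rw [t1, ← lintegral_comp_polarCoord_symm, polarCoord_target,
      Measure.volume_eq_prod, ← Measure.prod_restrict, lintegral_prod]
    · have t2 : ∀ R ∈ Set.Ioi (0:ℝ), ∫⁻ φ in Set.Ioo (-Real.pi) Real.pi, ENNReal.ofReal R •
          (ENNReal.ofReal (polarCoord.symm (R, φ)).2 * G (polarCoord.symm (R, φ)).1
            (polarCoord.symm (R, φ)).2 0) =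
          (if R < 1 then ENNReal.ofReal (R ^ 2) else 0) *
            ∫⁻ θ in Set.Ioo 0 Real.pi, ENNReal.ofReal (Real.sin θ) * F θ := by
        intro R hR
        have hR' : (0:ℝ) < R := hR
        have hm2 : Measurable fun θ => ENNReal.ofReal (Real.sin θ) * F θ := by fun_prop
        rw [← lintegral_const_mul _ hm2, ← lintegral_indicator measurableSet_Ioo,
          ← lintegral_indicator measurableSet_Ioo]
        refine lintegral_congr fun φ => ?_
        have hsq : (R * Real.cos φ) ^ 2 + ((R * Real.sin φ) ^ 2 + 0 ^ 2) = R ^ 2 := by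
          linear_combination R ^ 2 * Real.sin_sq_add_cos_sq φ
        have hlt : R ^ 2 < 1 ↔ R < 1 := by
          rw [sq_lt_one_iff_abs_lt_one, abs_of_pos hR']
        by_cases h0 : φ ∈ Set.Ioo 0 Real.pi
        · have h2 : φ ∈ Set.Ioo (-Real.pi) Real.pi := ⟨by linarith [h0.1, Real.pi_pos], h0.2⟩
          rw [Set.indicator_of_mem h2, Set.indicator_of_mem h0]
          simp only [polarCoord_symm_apply, hGdef, hsq, Real.sqrt_sq hR'.le,
            mul_div_cancel_left₀ _ hR'.ne', Real.arccos_cos h0.1.le h0.2.le]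
          by_cases h1 : R < 1
          · simp only [hlt, h1, if_true, smul_eq_mul]
            rw [ENNReal.ofReal_mul hR'.le, pow_two, ENNReal.ofReal_mul hR'.le]
            ring
          · simp [hlt, h1]
        · rw [Set.indicator_of_notMem h0]
          by_cases h2 : φ ∈ Set.Ioo (-Real.pi) Real.pi
          · rw [Set.indicator_of_mem h2]
            have : Real.sin φ ≤ 0 := by
              refine Real.sin_nonpos_of_nonpos_of_neg_pi_le ?_ h2.1.le
              by_contra hc
              exact h0 ⟨not_le.mp hc, h2.2⟩
            simp only [polarCoord_symm_apply]
            rw [ENNReal.ofReal_of_nonpos (p := R * Real.sin φ) (by nlinarith)]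
            simp
          · rw [Set.indicator_of_notMem h2]
      rw [setLIntegral_congr_fun measurableSet_Ioi t2, lintegral_mul_const]
      · congr 1
        have : ∀ R ∈ Set.Ioi (0:ℝ), (if R < 1 then ENNReal.ofReal (R ^ 2) else 0) =
            (Set.Ioo 0 1).indicator (fun R => ENNReal.ofReal (R ^ 2)) R := by
          intro R hR
          have hR' : (0:ℝ) < R := hR
          simp [Set.indicator, hR']
        rw [setLIntegral_congr_fun measurableSet_Ioi this, setLIntegral_indicator measurableSet_Ioo,
          Set.inter_eq_left.mpr (fun x hx => hx.1), restrict_Ioo_eq_restrict_Ioc,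
          ← ofReal_integral_eq_lintegral_ofReal, ← intervalIntegral.integral_of_le zero_le_one,
          integral_pow]
        · norm_num
        · exact (intervalIntegral.intervalIntegrable_pow 2).1
        · filter_upwards with x using by positivity
      · exact Measurable.ite measurableSet_Iio (by fun_prop) measurable_const
    · refine Measurable.aemeasurable ?_
      exact (ENNReal.measurable_ofReal.comp measurable_fst).mul
        (hm.comp continuous_polarCoord_symm.measurable)
  rw [e1, lintegral_coord G hG]
  simp_rw [e2]
  rw [lintegral_const_mul, e3]
  · ring
  · have hm : Measurable fun q : ℝ × ℝ => ENNReal.ofReal q.2 * G q.1 q.2 0 :=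
      (ENNReal.measurable_ofReal.comp measurable_snd).mul
        (hG.comp (by fun_prop : Measurable fun q : ℝ × ℝ => ((q.1, q.2, (0:ℝ)) : ℝ × ℝ × ℝ)))
    exact hm.lintegral_prod_right'

lemma measurable_angle {α : Type*} [MeasurableSpace α] {f g : α → V} (hf : Measurable f)
    (hg : Measurable g) : Measurable fun a => InnerProductGeometry.angle (f a) (g a) := by
  unfold InnerProductGeometry.angle
  exact Real.continuous_arccos.measurable.comp ((hf.inner hg).div (hf.norm.mul hg.norm))

lemma angle_dir {n u : V} (hu : u ≠ 0) :
    InnerProductGeometry.angle n (dir u) = InnerProductGeometry.angle n u := by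
  rw [dir_ne_zero_smul hu, InnerProductGeometry.angle_smul_right_of_pos _ _ (by positivity)]

/-- Archimedes' formula: the angle with a fixed direction has density `2π sin θ` on the sphere. -/
lemma lintegral_angle {n : V} (hn : n ≠ 0) (F : ℝ → ℝ≥0∞) (hF : Measurable F) :
    ∫⁻ σ : S2, F (InnerProductGeometry.angle n σ) ∂sphereMeasure = ENNReal.ofReal (2 * Real.pi) *
        ∫⁻ θ in Set.Ioo 0 Real.pi, ENNReal.ofReal (Real.sin θ) * F θ := by
  obtain ⟨R, hR⟩ := exists_isometry_map (dir n) pole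
  have h0 : ∀ σ : S2, InnerProductGeometry.angle n σ =
      InnerProductGeometry.angle (pole : V) (sphereMap R σ) := by
    intro σ
    rw [← hR]
    change _ = InnerProductGeometry.angle (R.toLinearIsometry (dir n)) (R.toLinearIsometry σ)
    rw [LinearIsometry.angle_map, InnerProductGeometry.angle_comm, ← angle_dir hn,
      InnerProductGeometry.angle_comm]
  simp_rw [h0]
  have hm : Measurable fun σ : S2 => F (InnerProductGeometry.angle (pole : V) σ) :=
    hF.comp (measurable_angle measurable_const measurable_subtype_coe)
  rw [(measurePreserving_sphereMap R).lintegral_comp hm]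
  refine (ENNReal.mul_right_inj (a := ENNReal.ofReal (1 / 3)) (by simp)
    ENNReal.ofReal_ne_top).mp ?_
  rw [← lintegral_sphere_eq_ball _ hm, ← lintegral_ball_angle F hF]
  refine lintegral_congr_ae ?_
  filter_upwards [ae_restrict_of_ae (compl_mem_ae_iff.mpr (measure_singleton (0 : V)))] with u hu
  rw [angle_dir hu]

/-! ### Changes of variables between the velocities of a collision -/

/-- The map `x ↦ (x + |x| τ) / 2`, which sends the relative velocity to `v' - v_*`. -/
def halfMap (τ : S2) (x : V) : V := (1 / 2 : ℝ) • (x + ‖x‖ • (τ : V))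

lemma inner_S2_self (τ : S2) : inner ℝ (τ : V) τ = 1 := by
  rw [real_inner_self_eq_norm_sq, norm_S2]; norm_num

lemma inner_eq_norm_mul_cos (x : V) (τ : S2) :
    inner ℝ x (τ : V) = ‖x‖ * Real.cos (InnerProductGeometry.angle x τ) := by
  rw [← InnerProductGeometry.cos_angle_mul_norm_mul_norm x (τ : V), norm_S2]; ring

lemma one_add_cos (θ : ℝ) : 1 + Real.cos θ = 2 * Real.cos (θ / 2) ^ 2 := by
  have := Real.cos_sq (θ / 2)
  rw [mul_div_cancel₀ _ two_ne_zero] at this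
  linarith

lemma one_sub_cos (θ : ℝ) : 1 - Real.cos θ = 2 * Real.sin (θ / 2) ^ 2 := by
  have := one_add_cos θ
  have := Real.sin_sq_add_cos_sq (θ / 2)
  linarith

lemma cos_half_angle_nonneg (x : V) (τ : V) :
    0 ≤ Real.cos (InnerProductGeometry.angle x τ / 2) :=
  Real.cos_nonneg_of_mem_Icc ⟨by linarith [InnerProductGeometry.angle_nonneg x τ, Real.pi_pos],
    by linarith [InnerProductGeometry.angle_le_pi x τ]⟩

lemma sin_half_angle_nonneg (x : V) (τ : V) :
    0 ≤ Real.sin (InnerProductGeometry.angle x τ / 2) :=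
  Real.sin_nonneg_of_mem_Icc ⟨by linarith [InnerProductGeometry.angle_nonneg x τ],
    by linarith [InnerProductGeometry.angle_le_pi x τ, Real.pi_pos]⟩

lemma norm_halfMap (τ : S2) (x : V) :
    ‖halfMap τ x‖ = ‖x‖ * Real.cos (InnerProductGeometry.angle x τ / 2) := by
  have h1 : ‖halfMap τ x‖ ^ 2 = (‖x‖ * Real.cos (InnerProductGeometry.angle x τ / 2)) ^ 2 := by
    rw [halfMap, norm_smul, mul_pow, norm_add_sq_real, inner_smul_right, inner_eq_norm_mul_cos,
      norm_smul, norm_S2, norm_norm, mul_pow, Real.norm_eq_abs]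
    have := one_add_cos (InnerProductGeometry.angle x τ)
    rw [abs_of_pos (by norm_num : (0:ℝ) < 1 / 2)]
    linear_combination ‖x‖ ^ 2 / 2 * this
  exact (pow_left_inj₀ (norm_nonneg _)
    (mul_nonneg (norm_nonneg _) (cos_half_angle_nonneg _ _)) two_ne_zero).mp h1

lemma inner_halfMap (τ : S2) (x : V) :
    inner ℝ (halfMap τ x) (τ : V) = ‖x‖ * Real.cos (InnerProductGeometry.angle x τ / 2) ^ 2 := by
  rw [halfMap, inner_smul_left, inner_add_left, inner_smul_left, inner_S2_self,
    inner_eq_norm_mul_cos]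
  have := one_add_cos (InnerProductGeometry.angle x τ)
  simp only [conj_trivial]
  linear_combination ‖x‖ / 2 * this

lemma cos_half_pos {x : V} {τ : S2} (h : InnerProductGeometry.angle x τ < Real.pi) :
    0 < Real.cos (InnerProductGeometry.angle x τ / 2) :=
  Real.cos_pos_of_mem_Ioo ⟨by linarith [InnerProductGeometry.angle_nonneg x (τ : V), Real.pi_pos],
    by linarith⟩

/-- `v' - v_*` bisects the angle between the relative velocity and `σ`. -/
lemma angle_halfMap {τ : S2} {x : V} (hx : x ≠ 0) (h : InnerProductGeometry.angle x τ < Real.pi) :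
    InnerProductGeometry.angle (halfMap τ x) τ = InnerProductGeometry.angle x τ / 2 := by
  have hc := cos_half_pos h
  rw [InnerProductGeometry.angle, inner_halfMap, norm_halfMap, norm_S2]
  have hx' : ‖x‖ ≠ 0 := norm_ne_zero_iff.mpr hx
  rw [show ‖x‖ * Real.cos (InnerProductGeometry.angle x τ / 2) ^ 2 /
    (‖x‖ * Real.cos (InnerProductGeometry.angle x τ / 2) * 1) =
    Real.cos (InnerProductGeometry.angle x τ / 2) by field_simp]
  exact Real.arccos_cos (by linarith [InnerProductGeometry.angle_nonneg x (τ : V)])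
    (by linarith [InnerProductGeometry.angle_le_pi x (τ : V), Real.pi_pos])

/-- The derivative of `halfMap`, half of the identity plus a map of rank one. -/
def halfMapDeriv (τ : S2) (x : V) : V →L[ℝ] V :=
  (1 / 2 : ℝ) • (ContinuousLinearMap.id ℝ V +
    (‖x‖⁻¹ • innerSL ℝ x).smulRight (τ : V))

lemma hasFDerivAt_norm_of_ne_zero {x : V} (hx : x ≠ 0) :
    HasFDerivAt (fun y : V => ‖y‖) (‖x‖⁻¹ • innerSL ℝ x) x := by
  have h := (hasStrictFDerivAt_norm_sq x).hasFDerivAt.sqrt (by simpa using hx)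
  have e : (fun y : V => √(‖y‖ ^ 2)) = fun y => ‖y‖ := by
    ext y; exact Real.sqrt_sq (norm_nonneg y)
  rw [e] at h
  have e2 : (1 / (2 * √(‖x‖ ^ 2))) • 2 • innerSL ℝ x = ‖x‖⁻¹ • innerSL ℝ x := by
    rw [Real.sqrt_sq (norm_nonneg x)]
    ext y
    simp
    ring
  rwa [e2] at h

lemma hasFDerivAt_halfMap {τ : S2} {x : V} (hx : x ≠ 0) :
    HasFDerivAt (halfMap τ) (halfMapDeriv τ x) x :=
  ((hasFDerivAt_id x).add ((hasFDerivAt_norm_of_ne_zero hx).smul_const (τ : V))).const_smul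
    (1 / 2 : ℝ)

/-- Up to the factor `1 / 8` this is the determinant of a transvection. -/
lemma det_halfMapDeriv {τ : S2} {x : V} (hx : x ≠ 0) :
    (halfMapDeriv τ x).det = Real.cos (InnerProductGeometry.angle x τ / 2) ^ 2 / 4 := by
  have e : (halfMapDeriv τ x : V →ₗ[ℝ] V) = (1 / 2 : ℝ) • LinearMap.transvection
      ((‖x‖⁻¹ • innerSL ℝ x : V →L[ℝ] ℝ) : V →ₗ[ℝ] ℝ) (τ : V) := by
    ext y i
    simp [halfMapDeriv, LinearMap.transvection]
  rw [ContinuousLinearMap.det, e, LinearMap.det_smul, LinearMap.transvection.det, finrank_V]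
  have h2 := one_add_cos (InnerProductGeometry.angle x τ)
  have hx' : ‖x‖ ≠ 0 := norm_ne_zero_iff.mpr hx
  simp [inner_eq_norm_mul_cos, hx']
  linear_combination h2 / 8

/-- The image determines the angle, which it halves, then the norm of `x`, and so `x` itself. -/
lemma injOn_halfMap (τ : S2) :
    Set.InjOn (halfMap τ) {x : V | x ≠ 0 ∧ InnerProductGeometry.angle x τ < Real.pi} := by
  rintro x ⟨hx, hxa⟩ y ⟨hy, hya⟩ h
  have ha := congrArg (fun z => InnerProductGeometry.angle z (τ : V)) h
  have hn := congrArg norm h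
  simp only [angle_halfMap hx hxa, angle_halfMap hy hya] at ha
  rw [norm_halfMap, norm_halfMap, ha] at hn
  have hn' := mul_right_cancel₀ (cos_half_pos hya).ne' hn
  rw [halfMap, halfMap, hn'] at h
  exact add_right_cancel (smul_right_injective V (by norm_num : (1 / 2 : ℝ) ≠ 0) h)

lemma measurableSet_angle_lt (τ : V) (a : ℝ) :
    MeasurableSet {x : V | InnerProductGeometry.angle x τ < a} :=
  measurableSet_lt (measurable_angle measurable_id measurable_const) measurable_const

/-- The regular change of variables `x ↦ (x + |x| τ) / 2`. -/
lemma lintegral_halfMap_le (τ : S2) (K : V → ℝ → ℝ≥0∞) :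
    ∫⁻ x in {x : V | x ≠ 0 ∧ InnerProductGeometry.angle x τ < Real.pi},
        K (halfMap τ x) (InnerProductGeometry.angle x τ) ≤
      ∫⁻ y in {y : V | InnerProductGeometry.angle y τ < Real.pi / 2},
        ENNReal.ofReal (4 / Real.cos (InnerProductGeometry.angle y τ) ^ 2) *
          K y (2 * InnerProductGeometry.angle y τ) := by
  have hs : MeasurableSet {x : V | x ≠ 0 ∧ InnerProductGeometry.angle x τ < Real.pi} :=
    (measurableSet_singleton (0 : V)).compl.inter (measurableSet_angle_lt _ _)
  have h := lintegral_image_eq_lintegral_abs_det_fderiv_mul volume hs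
    (fun x hx => (hasFDerivAt_halfMap (τ := τ) hx.1).hasFDerivWithinAt) (injOn_halfMap τ)
    (fun y => ENNReal.ofReal (4 / Real.cos (InnerProductGeometry.angle y τ) ^ 2) *
          K y (2 * InnerProductGeometry.angle y τ))
  have h2 : ∫⁻ x in {x : V | x ≠ 0 ∧ InnerProductGeometry.angle x τ < Real.pi},
        K (halfMap τ x) (InnerProductGeometry.angle x τ) =
      ∫⁻ x in {x : V | x ≠ 0 ∧ InnerProductGeometry.angle x τ < Real.pi},
        ENNReal.ofReal |(halfMapDeriv τ x).det| *
        (ENNReal.ofReal (4 / Real.cos (InnerProductGeometry.angle (halfMap τ x) τ) ^ 2) *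
          K (halfMap τ x) (2 * InnerProductGeometry.angle (halfMap τ x) τ)) := by
    refine setLIntegral_congr_fun hs fun x hx => ?_
    have hc := cos_half_pos hx.2
    simp only [angle_halfMap hx.1 hx.2, mul_div_cancel₀ _ (two_ne_zero (α := ℝ)),
      det_halfMapDeriv hx.1]
    rw [← mul_assoc, ← ENNReal.ofReal_mul (abs_nonneg _), abs_of_nonneg (by positivity)]
    rw [show Real.cos (InnerProductGeometry.angle x τ / 2) ^ 2 / 4 *
      (4 / Real.cos (InnerProductGeometry.angle x τ / 2) ^ 2) = 1 by field_simp]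
    simp
  rw [h2, ← h]
  refine lintegral_mono_set ?_
  rintro _ ⟨x, hx, rfl⟩
  have := angle_halfMap hx.1 hx.2
  simp only [Set.mem_ofPred_eq, this]
  linarith [hx.2]

lemma lintegral_double_angle (H : ℝ → ℝ≥0∞) :
    ∫⁻ ψ in Set.Ioo 0 (Real.pi / 2), H (2 * ψ) =
      ENNReal.ofReal (1 / 2) * ∫⁻ θ in Set.Ioo 0 Real.pi, H θ := by
  have himg : (fun ψ : ℝ => 2 * ψ) '' Set.Ioo 0 (Real.pi / 2) = Set.Ioo 0 Real.pi := by
    rw [Set.image_mul_left_Ioo two_pos]; congr 1 <;> ring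
  have h := lintegral_image_eq_lintegral_abs_deriv_mul (s := Set.Ioo 0 (Real.pi / 2))
    (f := fun ψ : ℝ => 2 * ψ) (f' := fun _ => 2) measurableSet_Ioo
    (fun x _ => by simpa using ((hasDerivAt_id x).const_mul (2:ℝ)).hasDerivWithinAt)
    (fun x _ y _ hxy => by simpa using hxy) H
  rw [himg] at h
  rw [h, lintegral_const_mul' _ _ ENNReal.ofReal_ne_top, ← mul_assoc,
    ← ENNReal.ofReal_mul (by norm_num)]
  norm_num

/-- The change of variables at a fixed `τ`, integrated over the sphere. Archimedes' formula in the
variable `ψ = θ / 2` turns the Jacobian into a factor `sin (θ / 2) / cos² (θ / 2)`, regular at `θ =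
0` and singular at `θ = π`. -/
lemma lintegral_sphere_halfMap_le (K : V → ℝ → ℝ≥0∞) (hK : Measurable (Function.uncurry K)) :
    ∫⁻ τ : S2, ∫⁻ x in {x : V | x ≠ 0 ∧ InnerProductGeometry.angle x τ < Real.pi},
        K (halfMap τ x) (InnerProductGeometry.angle x τ) ∂volume ∂sphereMeasure ≤
      ∫⁻ y, ∫⁻ θ in Set.Ioo 0 Real.pi, ENNReal.ofReal
        (4 * Real.pi * Real.sin (θ / 2) / Real.cos (θ / 2) ^ 2) * K y θ := by
  -- The integrand as a function of the new variable and its angle `ψ = θ / 2` with `τ`.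
  set k : V → ℝ → ℝ≥0∞ := fun y ψ => if ψ < Real.pi / 2 then
    ENNReal.ofReal (4 / Real.cos ψ ^ 2) * K y (2 * ψ) else 0 with hk
  have hkm : Measurable (Function.uncurry k) := by
    refine Measurable.ite (measurableSet_lt measurable_snd measurable_const) ?_ measurable_const
    refine Measurable.mul (by fun_prop) ?_
    exact hK.comp (by fun_prop : Measurable fun p : V × ℝ => (p.1, 2 * p.2))
  calc _ ≤ ∫⁻ τ : S2, ∫⁻ y : V, k y (InnerProductGeometry.angle y τ) ∂volume ∂sphereMeasure := by
        refine lintegral_mono fun τ => (lintegral_halfMap_le τ K).trans ?_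
        rw [← lintegral_indicator (measurableSet_angle_lt _ _)]
        refine lintegral_mono fun y => ?_
        by_cases h : InnerProductGeometry.angle y τ < Real.pi / 2
        · rw [Set.indicator_of_mem (by exact h)]; simp [hk, h]
        · rw [Set.indicator_of_notMem (by exact h)]; simp
    _ = ∫⁻ y : V, ∫⁻ τ : S2, k y (InnerProductGeometry.angle y τ) ∂sphereMeasure := by
        refine lintegral_lintegral_swap (Measurable.aemeasurable ?_)
        exact hkm.comp (measurable_snd.prodMk
          (measurable_angle measurable_snd (measurable_subtype_coe.comp measurable_fst)))
    _ = ∫⁻ y, ENNReal.ofReal (2 * Real.pi) * ∫⁻ ψ in Set.Ioo 0 Real.pi,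
          ENNReal.ofReal (Real.sin ψ) * k y ψ := by
        refine lintegral_congr_ae ?_
        have h0 : ∀ᵐ u : V, u ∈ ({0}ᶜ : Set V) := compl_mem_ae_iff.mpr (measure_singleton _)
        filter_upwards [h0] with y hy
        exact lintegral_angle hy (k y) (hkm.comp measurable_prodMk_left)
    _ = _ := by
        refine lintegral_congr fun y => ?_
        have e1 : ∫⁻ ψ in Set.Ioo 0 Real.pi, ENNReal.ofReal (Real.sin ψ) * k y ψ =
            ∫⁻ ψ in Set.Ioo 0 (Real.pi / 2), (fun θ => ENNReal.ofReal
              (4 * Real.sin (θ / 2) / Real.cos (θ / 2) ^ 2) * K y θ) (2 * ψ) := by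
          rw [← lintegral_indicator measurableSet_Ioo, ← lintegral_indicator measurableSet_Ioo]
          refine lintegral_congr fun ψ => ?_
          simp only [Set.indicator, Set.mem_Ioo, hk]
          by_cases h1 : 0 < ψ
          · by_cases h2 : ψ < Real.pi / 2
            · have h3 : ψ < Real.pi := by linarith [Real.pi_pos]
              simp only [h1, h2, h3, and_self, if_true,
                mul_div_cancel_left₀ _ (two_ne_zero (α := ℝ))]
              rw [← mul_assoc,
                ← ENNReal.ofReal_mul (Real.sin_nonneg_of_nonneg_of_le_pi h1.le h3.le)]
              congr 2; ring
            · simp [h2]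
          · simp [h1]
        rw [e1, lintegral_double_angle (fun θ => ENNReal.ofReal
              (4 * Real.sin (θ / 2) / Real.cos (θ / 2) ^ 2) * K y θ),
          ← lintegral_const_mul' _ _ ENNReal.ofReal_ne_top,
          ← lintegral_const_mul' _ _ ENNReal.ofReal_ne_top]
        refine lintegral_congr fun θ => ?_
        rw [← mul_assoc, ← mul_assoc, ← ENNReal.ofReal_mul (by positivity),
          ← ENNReal.ofReal_mul (by positivity)]
        congr 2; ring

/-- The measure `sin θ b(cos θ) dθ` on the angles `0 < θ < π`. -/
def angMeasure (b : ℝ → ℝ) : Measure ℝ :=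
  (volume.restrict (Set.Ioo 0 Real.pi)).withDensity
    fun θ => ENNReal.ofReal (Real.sin θ) * ENNReal.ofReal (b (Real.cos θ))

lemma lintegral_angMeasure {b : ℝ → ℝ} (hb : Measurable b) {F : ℝ → ℝ≥0∞} (hF : Measurable F) :
    ∫⁻ θ, F θ ∂angMeasure b = ∫⁻ θ in Set.Ioo 0 Real.pi,
      ENNReal.ofReal (Real.sin θ) * (ENNReal.ofReal (b (Real.cos θ)) * F θ) := by
  rw [angMeasure, lintegral_withDensity_eq_lintegral_mul _ (by fun_prop) hF]
  simp only [Pi.mul_apply, mul_assoc]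

instance {b : ℝ → ℝ} : SFinite (angMeasure b) := by unfold angMeasure; infer_instance

/-- `b(cos θ)` as an extended non-negative number. -/
def angFactor (b : ℝ → ℝ) (v w : V) (σ : S2) : ℝ≥0∞ :=
  ENNReal.ofReal (b (Real.cos (deviation v w σ)))

lemma measurable_deviation : Measurable fun p : V × V × S2 => deviation p.1 p.2.1 p.2.2 :=
  measurable_angle (measurable_fst.sub (measurable_fst.comp measurable_snd))
    (measurable_subtype_coe.comp (measurable_snd.comp measurable_snd))

lemma measurable_angFactor {b : ℝ → ℝ} (hb : Measurable b) :
    Measurable fun p : V × V × S2 => angFactor b p.1 p.2.1 p.2.2 :=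
  ENNReal.measurable_ofReal.comp
    (hb.comp (Real.continuous_cos.measurable.comp measurable_deviation))

lemma lintegral_angFactor {b : ℝ → ℝ} (hb : Measurable b) {v w : V} (hvw : v ≠ w)
    {F : ℝ → ℝ≥0∞} (hF : Measurable F) :
    ∫⁻ σ, angFactor b v w σ * F (deviation v w σ) ∂sphereMeasure =
      ENNReal.ofReal (2 * Real.pi) * ∫⁻ θ, F θ ∂angMeasure b := by
  rw [lintegral_angMeasure hb hF]
  exact lintegral_angle (sub_ne_zero.mpr hvw)
    (fun θ => ENNReal.ofReal (b (Real.cos θ)) * F θ) (by fun_prop)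

/-- The marginal in `(v, θ)` of the collisions with a fixed partner `w`. -/
lemma lintegral_pre {b : ℝ → ℝ} (hb : Measurable b) (w : V) (K : V → ℝ → ℝ≥0∞)
    (hK : Measurable (Function.uncurry K)) :
    ∫⁻ v, ∫⁻ σ, angFactor b v w σ * K v (deviation v w σ) ∂sphereMeasure =
      ENNReal.ofReal (2 * Real.pi) * ∫⁻ v, ∫⁻ θ, K v θ ∂angMeasure b := by
  rw [← lintegral_const_mul' _ _ ENNReal.ofReal_ne_top]
  refine lintegral_congr_ae ?_
  have h0 : ∀ᵐ u : V, u ∈ ({w}ᶜ : Set V) := compl_mem_ae_iff.mpr (measure_singleton _)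
  filter_upwards [h0] with v hv
  exact lintegral_angFactor hb hv (hK.comp measurable_prodMk_left)

lemma postVel_eq (v w : V) (σ : S2) : postVel v w σ = w + halfMap σ (v - w) := by
  rw [postVel, halfMap]; module

/-- The set `θ = π`, where `halfMap` is not injective, is excluded by the assumption on `k`. -/
lemma lintegral_halfMap_sphere_le (k : V → ℝ → ℝ≥0∞) (hkm : Measurable (Function.uncurry k))
    (hk : ∀ y, k y Real.pi = 0) :
    ∫⁻ x : V, ∫⁻ σ : S2, k (halfMap σ x) (InnerProductGeometry.angle x σ) ∂sphereMeasure ≤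
      ∫⁻ y, ∫⁻ θ in Set.Ioo 0 Real.pi, ENNReal.ofReal
        (4 * Real.pi * Real.sin (θ / 2) / Real.cos (θ / 2) ^ 2) * k y θ := by
  have hhm : Measurable fun p : V × S2 => halfMap p.2 p.1 := by unfold halfMap; fun_prop
  have ham : Measurable fun p : V × S2 => InnerProductGeometry.angle p.1 (p.2 : V) :=
    measurable_angle (by fun_prop) (by fun_prop)
  have hkc : Measurable fun p : V × S2 =>
      k (halfMap p.2 p.1) (InnerProductGeometry.angle p.1 (p.2 : V)) := hkm.comp (hhm.prodMk ham)
  rw [lintegral_lintegral_swap hkc.aemeasurable]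
  refine le_trans (lintegral_mono fun σ => ?_) (lintegral_sphere_halfMap_le k hkm)
  have hs : MeasurableSet {x : V | x ≠ 0 ∧ InnerProductGeometry.angle x σ < Real.pi} :=
    (measurableSet_singleton (0 : V)).compl.inter (measurableSet_angle_lt _ _)
  rw [← lintegral_indicator hs]
  refine lintegral_mono_ae ?_
  have h0 : ∀ᵐ u : V, u ∈ ({0}ᶜ : Set V) := compl_mem_ae_iff.mpr (measure_singleton _)
  filter_upwards [h0] with x hx
  by_cases h : InnerProductGeometry.angle x σ < Real.pi
  · have hx' : x ∈ {x : V | x ≠ 0 ∧ InnerProductGeometry.angle x σ < Real.pi} := ⟨hx, h⟩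
    rw [Set.indicator_of_mem hx']
  · have : InnerProductGeometry.angle x σ = Real.pi :=
      le_antisymm (InnerProductGeometry.angle_le_pi _ _) (not_lt.mp h)
    simp [this, hk]

lemma sin_half_div_le {θ : ℝ} (h0 : 0 < θ) (h2 : θ ≤ Real.pi / 2) :
    4 * Real.pi * Real.sin (θ / 2) / Real.cos (θ / 2) ^ 2 ≤ 8 * Real.pi * Real.sin θ := by
  have hc : √2 / 2 ≤ Real.cos (θ / 2) := by
    rw [← Real.cos_pi_div_four]
    exact Real.cos_le_cos_of_nonneg_of_le_pi (by linarith) (by linarith [Real.pi_pos])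
      (by linarith)
  have hs : 0 ≤ Real.sin (θ / 2) := Real.sin_nonneg_of_nonneg_of_le_pi
    (by linarith) (by linarith [Real.pi_pos])
  have h2' : (1.4 : ℝ) ≤ √2 := Real.le_sqrt_of_sq_le (by norm_num)
  have hc' : 0.7 ≤ Real.cos (θ / 2) := by linarith
  have hsin : Real.sin θ = 2 * Real.sin (θ / 2) * Real.cos (θ / 2) := by
    rw [← Real.sin_two_mul]; congr 1; ring
  rw [hsin, div_le_iff₀ (by positivity)]
  have h3 : 1 ≤ 4 * Real.cos (θ / 2) ^ 3 := by
    have := pow_le_pow_left₀ (by norm_num) hc' 3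
    norm_num at this ⊢
    linarith
  have : 0 ≤ Real.pi * Real.sin (θ / 2) := mul_nonneg Real.pi_pos.le hs
  calc 4 * Real.pi * Real.sin (θ / 2) = 4 * (Real.pi * Real.sin (θ / 2)) * 1 := by ring
    _ ≤ 4 * (Real.pi * Real.sin (θ / 2)) * (4 * Real.cos (θ / 2) ^ 3) := by gcongr
    _ = _ := by ring

lemma cos_half_div_le {θ : ℝ} (h0 : 0 < θ) (h2 : θ ≤ Real.pi / 2) :
    4 * Real.pi * Real.cos (θ / 2) / Real.sin (θ / 2) ^ 2 ≤
      2 * Real.pi ^ 4 * Real.sin θ * θ ^ (-3 : ℝ) := by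
  have hs : θ / Real.pi ≤ Real.sin (θ / 2) := by
    have := Real.mul_le_sin (x := θ / 2) (by linarith) (by linarith [Real.pi_pos])
    calc θ / Real.pi = 2 / Real.pi * (θ / 2) := by ring
      _ ≤ _ := this
  have hs0 : 0 < θ / Real.pi := div_pos h0 Real.pi_pos
  have hspos : 0 < Real.sin (θ / 2) := hs0.trans_le hs
  have hc : 0 ≤ Real.cos (θ / 2) := Real.cos_nonneg_of_mem_Icc
    ⟨by linarith [Real.pi_pos], by linarith [Real.pi_pos]⟩
  have hsin : Real.sin θ = 2 * Real.sin (θ / 2) * Real.cos (θ / 2) := by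
    rw [← Real.sin_two_mul]; congr 1; ring
  rw [hsin, div_le_iff₀ (by positivity), Real.rpow_neg h0.le]
  have h3 : θ ^ 3 / Real.pi ^ 3 ≤ Real.sin (θ / 2) ^ 3 := by
    rw [← div_pow]; exact pow_le_pow_left₀ hs0.le hs 3
  rw [show (3:ℝ) = ((3:ℕ):ℝ) by norm_num, Real.rpow_natCast]
  have h4 : 1 ≤ Real.pi ^ 3 * (Real.sin (θ / 2) ^ 3 * (θ ^ 3)⁻¹) := by
    rw [div_le_iff₀ (pow_pos Real.pi_pos 3)] at h3
    rw [← mul_assoc, ← div_eq_mul_inv, le_div_iff₀ (by positivity)]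
    linarith
  have : 0 ≤ Real.pi * Real.cos (θ / 2) := mul_nonneg Real.pi_pos.le hc
  calc 4 * Real.pi * Real.cos (θ / 2) = 4 * (Real.pi * Real.cos (θ / 2)) * 1 := by ring
    _ ≤ 4 * (Real.pi * Real.cos (θ / 2)) *
        (Real.pi ^ 3 * (Real.sin (θ / 2) ^ 3 * (θ ^ 3)⁻¹)) := by gcongr
    _ = _ := by ring

/-- An angular Jacobian `J` need only be bounded on `0 < θ ≤ π / 2`, where `b(cos θ)` lives. -/
lemma angular_jacobian_le {b : ℝ → ℝ} (hb : Measurable b) (hb0 : ∀ x, x < 0 → b x = 0)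
    {F G J : ℝ → ℝ≥0∞} (hF : Measurable F) (c : ℝ≥0∞) (hc : c ≠ ∞)
    (h : ∀ θ, 0 < θ → θ ≤ Real.pi / 2 → J θ * G θ ≤ c * ENNReal.ofReal (Real.sin θ) * F θ) :
    ∫⁻ θ in Set.Ioo 0 Real.pi, J θ * (ENNReal.ofReal (b (Real.cos θ)) * G θ) ≤
      c * ∫⁻ θ, F θ ∂angMeasure b := by
  rw [lintegral_angMeasure hb hF, ← lintegral_const_mul' _ _ hc]
  refine setLIntegral_mono (by fun_prop) fun θ hθ => ?_
  by_cases h2 : Real.pi / 2 < θ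
  · have : b (Real.cos θ) = 0 := hb0 _ (Real.cos_neg_of_pi_div_two_lt_of_lt h2
      (by linarith [hθ.2, Real.pi_pos]))
    simp [this]
  · calc J θ * (ENNReal.ofReal (b (Real.cos θ)) * G θ)
        = ENNReal.ofReal (b (Real.cos θ)) * (J θ * G θ) := by ring
      _ ≤ ENNReal.ofReal (b (Real.cos θ)) * (c * ENNReal.ofReal (Real.sin θ) * F θ) := by
          exact mul_le_mul' le_rfl (h θ hθ.1 (not_lt.mp h2))
      _ = _ := by ring

/-- The marginal in `(v', θ)` of the collisions with a fixed partner `w`: for `θ ≤ π / 2` the map `v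
↦ v'` has a Jacobian bounded from below. -/
lemma lintegral_post_le {b : ℝ → ℝ} (hb : Measurable b) (hb0 : ∀ x, x < 0 → b x = 0)
    (w : V) (K : V → ℝ → ℝ≥0∞) (hK : Measurable (Function.uncurry K)) :
    ∫⁻ v, ∫⁻ σ, angFactor b v w σ * K (postVel v w σ) (deviation v w σ) ∂sphereMeasure ≤
      ENNReal.ofReal (8 * Real.pi) * ∫⁻ v, ∫⁻ θ, K v θ ∂angMeasure b := by
  have hkm : Measurable (Function.uncurry
      fun (y : V) (θ : ℝ) => ENNReal.ofReal (b (Real.cos θ)) * K (w + y) θ) := by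
    refine Measurable.mul (by fun_prop) ?_
    exact hK.comp (by fun_prop : Measurable fun p : V × ℝ => (w + p.1, p.2))
  have h1 := lintegral_halfMap_sphere_le _ hkm (fun y => by simp [hb0 (-1) (by norm_num)])
  have e1 : ∫⁻ v, ∫⁻ σ, angFactor b v w σ * K (postVel v w σ) (deviation v w σ) ∂sphereMeasure =
      ∫⁻ x : V, ∫⁻ σ : S2, ENNReal.ofReal (b (Real.cos (InnerProductGeometry.angle x σ))) *
        K (w + halfMap σ x) (InnerProductGeometry.angle x σ) ∂sphereMeasure := by
    conv_rhs => rw [← lintegral_sub_right_eq_self _ w]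
    simp only [postVel_eq, angFactor, deviation]
  rw [e1]
  refine h1.trans ?_
  rw [← lintegral_add_left_eq_self (fun y => ∫⁻ θ, K y θ ∂angMeasure b) w,
    ← lintegral_const_mul' _ _ ENNReal.ofReal_ne_top]
  refine lintegral_mono fun y => ?_
  have hKy : Measurable (K (w + y)) := hK.comp measurable_prodMk_left
  refine angular_jacobian_le hb hb0 hKy _ ENNReal.ofReal_ne_top fun θ h0 h2 => ?_
  rw [← ENNReal.ofReal_mul (by positivity)]
  exact mul_le_mul_left (ENNReal.ofReal_le_ofReal (sin_half_div_le h0 h2)) _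

/-- With `v` fixed, `v'` is the image of the relative velocity under `halfMap` for the direction
`-σ`. -/
lemma postVel_eq' (v w : V) (σ : S2) :
    postVel v w σ = v - halfMap (sphereMap (.neg ℝ) σ) (v - w) := by
  simp only [postVel, halfMap, sphereMap, LinearIsometryEquiv.coe_neg]; module

lemma lintegral_Ioo_pi_sub (F : ℝ → ℝ≥0∞) :
    ∫⁻ θ in Set.Ioo 0 Real.pi, F (Real.pi - θ) = ∫⁻ θ in Set.Ioo 0 Real.pi, F θ := by
  rw [← lintegral_indicator measurableSet_Ioo, ← lintegral_indicator measurableSet_Ioo,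
    ← lintegral_sub_left_eq_self _ Real.pi]
  refine lintegral_congr fun θ => ?_
  by_cases h : θ ∈ Set.Ioo 0 Real.pi
  · have h' : Real.pi - θ ∈ Set.Ioo 0 Real.pi := ⟨by linarith [h.2], by linarith [h.1]⟩
    rw [Set.indicator_of_mem h, Set.indicator_of_mem h', sub_sub_cancel]
  · have h' : Real.pi - θ ∉ Set.Ioo 0 Real.pi :=
      fun hh => h ⟨by linarith [hh.2], by linarith [hh.1]⟩
    rw [Set.indicator_of_notMem h, Set.indicator_of_notMem h']

/-- The singular change of variables `v_* ↦ v'` for fixed `v`, at the price of a factor `θ⁻³`. -/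
lemma lintegral_post_singular_le {b : ℝ → ℝ} (hb : Measurable b) (hb0 : ∀ x, x < 0 → b x = 0)
    (v : V) (K : V → ℝ → ℝ≥0∞) (hK : Measurable (Function.uncurry K)) (hK0 : ∀ y, K y 0 = 0) :
    ∫⁻ w, ∫⁻ σ, angFactor b v w σ * K (postVel v w σ) (deviation v w σ) ∂sphereMeasure ≤
      ENNReal.ofReal (2 * Real.pi ^ 4) *
        ∫⁻ y, ∫⁻ θ, ENNReal.ofReal (θ ^ (-3 : ℝ)) * K y θ ∂angMeasure b := by
  obtain ⟨k, hk⟩ : ∃ k : V → ℝ → ℝ≥0∞, k = fun y θ =>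
    ENNReal.ofReal (b (Real.cos (Real.pi - θ))) * K (v - y) (Real.pi - θ) := ⟨_, rfl⟩
  have hkm : Measurable (Function.uncurry k) := by
    rw [hk]
    refine Measurable.mul (by fun_prop) ?_
    exact hK.comp (by fun_prop : Measurable fun p : V × ℝ => (v - p.1, Real.pi - p.2))
  have hhm : Measurable fun p : V × S2 => halfMap p.2 p.1 := by unfold halfMap; fun_prop
  have ham : Measurable fun p : V × S2 => InnerProductGeometry.angle p.1 (p.2 : V) :=
    measurable_angle (by fun_prop) (by fun_prop)
  have hkc : Measurable fun p : V × S2 =>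
      k (halfMap p.2 p.1) (InnerProductGeometry.angle p.1 (p.2 : V)) := hkm.comp (hhm.prodMk ham)
  have e1 : ∫⁻ w, ∫⁻ σ, angFactor b v w σ * K (postVel v w σ) (deviation v w σ) ∂sphereMeasure
      = ∫⁻ x : V, ∫⁻ σ : S2, k (halfMap σ x) (InnerProductGeometry.angle x σ) ∂sphereMeasure := by
    -- The substitution `σ ↦ -σ` turns `θ` into `π - θ`, so that the singularity of the Jacobian of
    -- `halfMap` at `π` becomes one at `θ = 0`.
    rw [← lintegral_sub_left_eq_self _ v]
    refine lintegral_congr fun x => ?_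
    have hkx : Measurable fun σ : S2 => k (halfMap σ x) (InnerProductGeometry.angle x (σ : V)) :=
      hkc.comp measurable_prodMk_left
    rw [← (measurePreserving_sphereMap (.neg ℝ)).lintegral_comp hkx]
    refine lintegral_congr fun σ => ?_
    have : InnerProductGeometry.angle x (sphereMap (.neg ℝ) σ) =
        Real.pi - InnerProductGeometry.angle x σ := by
      simp [sphereMap, InnerProductGeometry.angle_neg_right]
    simp only [hk, this, postVel_eq', angFactor, deviation, sub_sub_cancel]
  rw [e1]
  refine (lintegral_halfMap_sphere_le k hkm (fun y => by simp [hk, hK0])).trans ?_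
  rw [← lintegral_sub_left_eq_self
    (fun y => ∫⁻ θ, ENNReal.ofReal (θ ^ (-3 : ℝ)) * K y θ ∂angMeasure b) v,
    ← lintegral_const_mul' _ _ ENNReal.ofReal_ne_top]
  refine lintegral_mono fun y => ?_
  have hKy : Measurable (K (v - y)) := hK.comp measurable_prodMk_left
  rw [← lintegral_Ioo_pi_sub]
  simp only [hk, sub_sub_cancel]
  refine angular_jacobian_le hb hb0 (by fun_prop) _ ENNReal.ofReal_ne_top fun θ h0 h2 => ?_
  have hsθ : 0 ≤ Real.sin θ := Real.sin_nonneg_of_nonneg_of_le_pi h0.le (by linarith [Real.pi_pos])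
  rw [show (Real.pi - θ) / 2 = Real.pi / 2 - θ / 2 by ring, Real.sin_pi_div_two_sub,
    Real.cos_pi_div_two_sub, ← ENNReal.ofReal_mul (by positivity), ← mul_assoc,
    ← ENNReal.ofReal_mul (by positivity)]
  exact mul_le_mul_left (ENNReal.ofReal_le_ofReal (cos_half_div_le h0 h2)) _

/-! ### The collision measure and its symmetries -/

/-- The product measure `dv dv_* dσ`. -/
abbrev collMeasure : Measure (V × V × S2) :=
  (volume : Measure V).prod ((volume : Measure V).prod sphereMeasure)

lemma lintegral_collMeasure {F : V × V × S2 → ℝ≥0∞} (hF : Measurable F) :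
    ∫⁻ p, F p ∂collMeasure = ∫⁻ w, ∫⁻ v, ∫⁻ σ, F (v, w, σ) ∂sphereMeasure := by
  rw [lintegral_prod _ hF.aemeasurable]
  have h1 : ∀ v, ∫⁻ q : V × S2, F (v, q) ∂((volume : Measure V).prod sphereMeasure) =
      ∫⁻ w, ∫⁻ σ, F (v, w, σ) ∂sphereMeasure := fun v =>
    lintegral_prod _ (hF.comp measurable_prodMk_left).aemeasurable
  simp_rw [h1]
  refine lintegral_lintegral_swap (Measurable.aemeasurable ?_)
  have : Measurable fun q : (V × V) × S2 => F (q.1.1, q.1.2, q.2) := hF.comp (by fun_prop)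
  exact this.lintegral_prod_right'

lemma lintegral_collMeasure_relative {F : V × V × S2 → ℝ≥0∞} (hF : Measurable F) :
    ∫⁻ p, F p ∂collMeasure = ∫⁻ w, ∫⁻ u, ∫⁻ σ, F (w + u, w, σ) ∂sphereMeasure := by
  rw [lintegral_collMeasure hF]
  refine lintegral_congr fun w => ?_
  rw [← lintegral_add_left_eq_self _ w]

/-- The exchange `(v, v_*, σ) ↦ (v', v'_*, (v - v_*) / |v - v_*|)` of a collision with its
inverse. -/
def prePost (p : V × V × S2) : V × V × S2 :=
  (postVel p.1 p.2.1 p.2.2, postVelStar p.1 p.2.1 p.2.2, dir (p.1 - p.2.1))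

/-- The map `(v, v_*, σ) ↦ (v_* + |v - v_*| σ, v_*, (v - v_*) / |v - v_*|)`, which fixes `v_*`,
`v'` and the deviation angle. -/
def swapPre (p : V × V × S2) : V × V × S2 :=
  (p.2.1 + ‖p.1 - p.2.1‖ • (p.2.2 : V), p.2.1, dir (p.1 - p.2.1))

lemma norm_two_inner_smul_sub (k σ : S2) :
    ‖(2 * inner ℝ (k : V) (σ : V)) • (k : V) - (σ : V)‖ = 1 := by
  have h : ‖(2 * inner ℝ (k : V) (σ : V)) • (k : V) - (σ : V)‖ ^ 2 = 1 := by
    rw [norm_sub_sq_real, norm_smul, norm_S2, norm_S2, inner_smul_left]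
    simp only [norm_mul, Real.norm_eq_abs, mul_pow, sq_abs, conj_trivial, mul_one]
    ring
  nlinarith [norm_nonneg ((2 * inner ℝ (k : V) (σ : V)) • (k : V) - (σ : V))]

/-- The rotation by the angle `π` about the axis `k`. -/
def halfTurn (k σ : S2) : S2 :=
  ⟨(2 * inner ℝ (k : V) (σ : V)) • (k : V) - (σ : V), by simpa using norm_two_inner_smul_sub k σ⟩

/-- The rotation of `σ` by the angle `π` about the axis `v - v_*`. -/
def turnPost (p : V × V × S2) : V × V × S2 :=
  (p.1, p.2.1, halfTurn (dir (p.1 - p.2.1)) p.2.2)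

lemma measurable_postVel : Measurable fun p : V × V × S2 => postVel p.1 p.2.1 p.2.2 := by
  unfold postVel; fun_prop

lemma measurable_postVelStar : Measurable fun p : V × V × S2 => postVelStar p.1 p.2.1 p.2.2 := by
  unfold postVelStar; fun_prop

lemma measurable_prePost : Measurable prePost := by
  have h1 := measurable_postVel
  have h2 := measurable_postVelStar
  have h3 := measurable_dir
  unfold prePost
  fun_prop

lemma measurable_swapPre : Measurable swapPre := by
  have h3 := measurable_dir
  unfold swapPre
  fun_prop

lemma measurable_halfTurn {α : Type*} [MeasurableSpace α] {f g : α → S2} (hf : Measurable f)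
    (hg : Measurable g) : Measurable fun a => halfTurn (f a) (g a) := by
  unfold halfTurn
  refine Measurable.subtype_mk ?_
  fun_prop

lemma measurable_turnPost : Measurable turnPost := by
  have h3 : Measurable fun p : V × V × S2 => dir (p.1 - p.2.1) :=
    measurable_dir.comp (by fun_prop)
  have h4 := measurable_halfTurn h3 (by fun_prop : Measurable fun p : V × V × S2 => p.2.2)
  unfold turnPost
  fun_prop

lemma halfTurn_eq (k σ : S2) :
    halfTurn k σ = sphereMap (Submodule.span ℝ {(k : V)}).reflection σ := by
  ext1
  simp only [halfTurn, sphereMap]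
  rw [Submodule.reflection_singleton_apply]
  simp [two_mul, add_smul, two_smul]

lemma lintegral_swapDir {F : V × S2 → ℝ≥0∞} (hF : Measurable F) :
    ∫⁻ u : V, ∫⁻ σ : S2, F (‖u‖ • (σ : V), dir u) ∂sphereMeasure =
      ∫⁻ u : V, ∫⁻ σ : S2, F (u, σ) ∂sphereMeasure := by
  have h := measurePreserving_swapDir.lintegral_comp hF
  have hc : Measurable fun q => F (swapDir q) := hF.comp measurable_swapDir
  rw [lintegral_prod _ hF.aemeasurable, lintegral_prod _ hc.aemeasurable] at h
  exact h

/-- At a fixed `v_*` this is the exchange of directions for the relative velocity. -/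
lemma measurePreserving_swapPre : MeasurePreserving swapPre collMeasure collMeasure := by
  refine ⟨measurable_swapPre, Measure.ext_of_lintegral _ fun F hF => ?_⟩
  have hc : Measurable fun q => F (swapPre q) := hF.comp measurable_swapPre
  rw [lintegral_map hF measurable_swapPre, lintegral_collMeasure_relative hF,
    lintegral_collMeasure_relative hc]
  refine lintegral_congr fun w => ?_
  rw [← lintegral_swapDir (F := fun q : V × S2 => F (w + q.1, w, q.2)) (hF.comp (by fun_prop))]
  simp only [swapPre, add_sub_cancel_left]

/-- At fixed `v` and `v_*` this is a rotation of the sphere. -/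
lemma measurePreserving_turnPost : MeasurePreserving turnPost collMeasure collMeasure := by
  refine ⟨measurable_turnPost, Measure.ext_of_lintegral _ fun F hF => ?_⟩
  have hc : Measurable fun q => F (turnPost q) := hF.comp measurable_turnPost
  rw [lintegral_map hF measurable_turnPost, lintegral_collMeasure hF,
    lintegral_collMeasure hc]
  refine lintegral_congr fun w => lintegral_congr fun v => ?_
  have h : Measurable fun σ => F (v, w, σ) := hF.comp (by fun_prop)
  rw [← (measurePreserving_sphereMap
    (Submodule.span ℝ {(dir (v - w) : V)}).reflection).lintegral_comp h]
  simp only [turnPost, halfTurn_eq]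

/-- Passage from `v_*` to the center of mass, at a fixed relative velocity. -/
lemma lintegral_center {G : V → V → S2 → ℝ≥0∞}
    (hG : Measurable fun p : V × V × S2 => G p.1 p.2.1 p.2.2) :
    ∫⁻ w, ∫⁻ u, ∫⁻ σ, G (w + (1 / 2 : ℝ) • u) u σ ∂sphereMeasure =
      ∫⁻ w, ∫⁻ u, ∫⁻ σ, G w u σ ∂sphereMeasure := by
  have h0 : Measurable fun q : (V × V) × S2 => G q.1.1 q.1.2 q.2 := hG.comp (by fun_prop :
    Measurable fun q : (V × V) × S2 => (q.1.1, q.1.2, q.2))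
  have h1 : Measurable fun q : (V × V) × S2 => G (q.1.1 + (1 / 2 : ℝ) • q.1.2) q.1.2 q.2 :=
    hG.comp (by fun_prop :
      Measurable fun q : (V × V) × S2 => (q.1.1 + (1 / 2 : ℝ) • q.1.2, q.1.2, q.2))
  refine (lintegral_lintegral_swap (Measurable.aemeasurable h1.lintegral_prod_right')).trans
    (Eq.trans ?_ (lintegral_lintegral_swap
      (Measurable.aemeasurable h0.lintegral_prod_right')).symm)
  refine lintegral_congr fun u => ?_
  exact lintegral_add_right_eq_self (fun w => ∫⁻ σ, G w u σ ∂sphereMeasure) _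

/-- In the variables center of mass, relative velocity and `σ`, the exchange of a collision with its
inverse fixes the center of mass and exchanges the directions. -/
lemma measurePreserving_prePost : MeasurePreserving prePost collMeasure collMeasure := by
  refine ⟨measurable_prePost, Measure.ext_of_lintegral _ fun F hF => ?_⟩
  have hd := measurable_dir
  have hc : Measurable fun q => F (prePost q) := hF.comp measurable_prePost
  rw [lintegral_map hF measurable_prePost, lintegral_collMeasure_relative hF,
    lintegral_collMeasure_relative hc]
  have e1 := lintegral_center (G := fun c u σ =>
    F (c + (1 / 2 : ℝ) • ‖u‖ • (σ : V), c - (1 / 2 : ℝ) • ‖u‖ • (σ : V), dir u))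
    (hF.comp (by fun_prop))
  have e2 := lintegral_center (G := fun c u σ =>
    F (c + (1 / 2 : ℝ) • u, c - (1 / 2 : ℝ) • u, σ)) (hF.comp (by fun_prop))
  have e3 : ∀ c : V, _ := fun c => lintegral_swapDir (F := fun q : V × S2 =>
    F (c + (1 / 2 : ℝ) • q.1, c - (1 / 2 : ℝ) • q.1, q.2)) (hF.comp (by fun_prop))
  -- `e1` and `e2` introduce the center of mass `c` after and before the exchange of directions
  -- `e3`.
  simp only [e3, ← e2] at e1
  have a1 : ∀ w u : V, w + (1 / 2 : ℝ) • u + (1 / 2 : ℝ) • u = w + u := fun w u => by module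
  have a2 : ∀ w u : V, w + (1 / 2 : ℝ) • u - (1 / 2 : ℝ) • u = w := fun w u => by module
  have b1 : ∀ (w u : V) (σ : S2), postVel (w + u) w σ =
      w + (1 / 2 : ℝ) • u + (1 / 2 : ℝ) • ‖u‖ • (σ : V) := fun w u σ => by
    rw [postVel, add_sub_cancel_left]; module
  have b2 : ∀ (w u : V) (σ : S2), postVelStar (w + u) w σ =
      w + (1 / 2 : ℝ) • u - (1 / 2 : ℝ) • ‖u‖ • (σ : V) := fun w u σ => by
    rw [postVelStar, add_sub_cancel_left]; module
  simpa only [a1, a2, prePost, b1, b2, add_sub_cancel_left] using e1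

lemma postVel_sub_postVelStar (v w : V) (σ : S2) :
    postVel v w σ - postVelStar v w σ = ‖v - w‖ • (σ : V) := by
  unfold postVel postVelStar; module

lemma norm_postVel_sub_postVelStar (v w : V) (σ : S2) :
    ‖postVel v w σ - postVelStar v w σ‖ = ‖v - w‖ := by
  rw [postVel_sub_postVelStar, norm_smul, norm_S2]; simp

lemma half_norm_smul_dir (u : V) : (‖u‖ / 2) • (dir u : V) = (1 / 2 : ℝ) • u := by
  conv_rhs => rw [← norm_smul_dir u]
  rw [smul_smul]; congr 1; ring

lemma postVel_postVel (v w : V) (σ : S2) :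
    postVel (postVel v w σ) (postVelStar v w σ) (dir (v - w)) = v := by
  rw [postVel, norm_postVel_sub_postVelStar, half_norm_smul_dir]
  unfold postVel postVelStar; module

lemma angle_smul_dir (u : V) (σ : S2) :
    InnerProductGeometry.angle (‖u‖ • (σ : V)) (dir u) = InnerProductGeometry.angle u σ := by
  by_cases hu : u = 0
  · simp [hu]
  · rw [angle_dir hu, InnerProductGeometry.angle_smul_left_of_pos _ _ (norm_pos_iff.mpr hu),
      InnerProductGeometry.angle_comm]

lemma deviation_prePost (v w : V) (σ : S2) :
    deviation (postVel v w σ) (postVelStar v w σ) (dir (v - w)) = deviation v w σ := by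
  rw [deviation, postVel_sub_postVelStar, angle_smul_dir, deviation]

lemma deviation_swapPre (v w : V) (σ : S2) :
    deviation (w + ‖v - w‖ • (σ : V)) w (dir (v - w)) = deviation v w σ := by
  rw [deviation, add_sub_cancel_left, angle_smul_dir, deviation]

lemma norm_swapPre (v w : V) (σ : S2) : ‖w + ‖v - w‖ • (σ : V) - w‖ = ‖v - w‖ := by
  rw [add_sub_cancel_left, norm_smul, norm_S2]; simp

lemma postVel_swapPre (v w : V) (σ : S2) :
    postVel (w + ‖v - w‖ • (σ : V)) w (dir (v - w)) = postVel v w σ := by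
  rw [postVel, norm_swapPre, half_norm_smul_dir, postVel]
  module

lemma deviation_turnPost (v w : V) (σ : S2) :
    deviation v w (halfTurn (dir (v - w)) σ) = deviation v w σ := by
  by_cases h : v - w = 0
  · simp [deviation, h]
  · rw [deviation, deviation, InnerProductGeometry.angle_comm (v - w), ← angle_dir h,
      InnerProductGeometry.angle_comm (v - w), ← angle_dir h, InnerProductGeometry.angle,
      InnerProductGeometry.angle]
    congr 1
    rw [norm_S2, norm_S2, norm_S2]
    congr 1
    simp only [halfTurn]
    rw [inner_sub_left, inner_smul_left, inner_S2_self, real_inner_comm]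
    simp; ring

/-- The two velocities `v'` exchanged by the half turn average to a point at distance of second
order in the deviation angle from `v`. -/
lemma postVel_add_postVel_halfTurn (v w : V) (σ : S2) :
    (postVel v w σ - v) + (postVel v w (halfTurn (dir (v - w)) σ) - v) =
      -(1 - Real.cos (deviation v w σ)) • (v - w) := by
  have hin : (‖v - w‖ / 2) • (2 * inner ℝ (dir (v - w) : V) (σ : V)) • (dir (v - w) : V) =
      Real.cos (deviation v w σ) • (v - w) := by
    by_cases h0 : v - w = 0
    · simp [h0]
    · have hc : inner ℝ (dir (v - w) : V) (σ : V) = Real.cos (deviation v w σ) := by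
        rw [inner_eq_norm_mul_cos, norm_S2, one_mul, InnerProductGeometry.angle_comm, angle_dir h0,
          InnerProductGeometry.angle_comm, deviation]
      rw [smul_comm, half_norm_smul_dir, hc, smul_smul]
      congr 1; ring
  simp only [halfTurn, postVel]
  rw [smul_sub, hin]
  module

/-! ### Angular integrals -/

/-- Below the angle `θ₀` the density `sin θ b(cos θ)` is bounded by a multiple of `θ^{-1-r}`, for
any `r ≥ 2s`; above `θ₀` it has finite mass. -/
lemma IsAngularFactor.exists_lintegral_le {s : ℝ} {b : ℝ → ℝ} (hb : IsAngularFactor s b) {r : ℝ}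
    (hr : 2 * s ≤ r) : ∃ c M θ₀ : ℝ, 0 < c ∧ 0 ≤ M ∧ 0 < θ₀ ∧ θ₀ ≤ 1 ∧
      ∀ F : ℝ → ℝ≥0∞, Measurable F → ∀ B : ℝ≥0∞, (∀ θ ∈ Set.Icc θ₀ (Real.pi / 2), F θ ≤ B) →
        ∫⁻ θ, F θ ∂angMeasure b ≤
          (∫⁻ θ in Set.Ioo 0 θ₀, ENNReal.ofReal (c * θ ^ (-1 - r)) * F θ) +
            ENNReal.ofReal M * B := by
  obtain ⟨c, hc, hO⟩ := hb.singular.1.exists_pos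
  rw [isBigOWith_iff] at hO
  obtain ⟨u, hu, hsub⟩ := mem_nhdsGT_iff_exists_Ioo_subset.mp hO
  have hu0 : (0 : ℝ) < u := hu
  set θ₀ := min u 1 with hθ₀
  have h0 : 0 < θ₀ := lt_min hu0 one_pos
  set D : ℝ → ℝ := fun θ => Real.sin θ * b (Real.cos θ) with hD
  have hDint := hb.integrable_away θ₀ h0
  have hpi := Real.pi_gt_three
  have hM : ∫⁻ θ in Set.Icc θ₀ (Real.pi / 2), ENNReal.ofReal (D θ) < ∞ :=
    hDint.lintegral_lt_top
  refine ⟨c, (∫⁻ θ in Set.Icc θ₀ (Real.pi / 2), ENNReal.ofReal (D θ)).toReal, θ₀, hc,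
    ENNReal.toReal_nonneg, h0, min_le_right _ _, fun F hF B hB => ?_⟩
  rw [ENNReal.ofReal_toReal hM.ne, lintegral_angMeasure hb.measurable hF]
  have hmb := hb.measurable
  have hDm : Measurable fun θ => ENNReal.ofReal (D θ) := by fun_prop
  have hle : ∀ θ ∈ Set.Ioo 0 Real.pi, ENNReal.ofReal (Real.sin θ) *
      (ENNReal.ofReal (b (Real.cos θ)) * F θ) ≤
      (Set.Ioo 0 θ₀).indicator (fun θ => ENNReal.ofReal (c * θ ^ (-1 - r)) * F θ) θ +
      (Set.Icc θ₀ (Real.pi / 2)).indicator (fun θ => ENNReal.ofReal (D θ) * B) θ := by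
    intro θ hθ
    have hs : 0 ≤ Real.sin θ := Real.sin_nonneg_of_nonneg_of_le_pi hθ.1.le hθ.2.le
    rw [← mul_assoc, ← ENNReal.ofReal_mul hs]
    change ENNReal.ofReal (D θ) * F θ ≤ _
    rcases lt_or_ge θ θ₀ with h1 | h1
    · rw [Set.indicator_of_mem (show θ ∈ Set.Ioo 0 θ₀ from ⟨hθ.1, h1⟩)]
      refine le_add_right (mul_le_mul' (ENNReal.ofReal_le_ofReal ?_) le_rfl)
      have h2 := hsub ⟨hθ.1, h1.trans_le (min_le_left _ _)⟩
      simp only [Set.mem_ofPred_eq, Real.norm_eq_abs] at h2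
      refine (le_abs_self _).trans (h2.trans ?_)
      rw [abs_of_nonneg (Real.rpow_nonneg hθ.1.le _)]
      refine mul_le_mul_of_nonneg_left ?_ hc.le
      exact Real.rpow_le_rpow_of_exponent_ge hθ.1 (h1.le.trans (min_le_right _ _)) (by linarith)
    · rcases le_or_gt θ (Real.pi / 2) with h2 | h2
      · rw [Set.indicator_of_mem (show θ ∈ Set.Icc θ₀ (Real.pi / 2) from ⟨h1, h2⟩)]
        exact le_add_left (mul_le_mul' le_rfl (hB θ ⟨h1, h2⟩))
      · have : D θ = 0 := by
          simp only [hD]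
          rw [hb.eq_zero_of_neg _ (Real.cos_neg_of_pi_div_two_lt_of_lt h2 (by linarith [hθ.2])),
            mul_zero]
        simp [this]
  refine (setLIntegral_mono' measurableSet_Ioo hle).trans ?_
  refine (setLIntegral_le_lintegral _ _).trans ?_
  rw [lintegral_add_left (Measurable.indicator (by fun_prop) measurableSet_Ioo),
    lintegral_indicator measurableSet_Ioo, lintegral_indicator measurableSet_Icc,
    lintegral_mul_const _ hDm]

lemma rpow_le_of_mem_Icc {a c θ : ℝ} (p : ℝ) (ha : 0 < a) (h : θ ∈ Set.Icc a c) :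
    θ ^ p ≤ a ^ p + c ^ p := by
  have hθ : 0 < θ := ha.trans_le h.1
  rcases le_or_gt 0 p with hp | hp
  · have := Real.rpow_le_rpow hθ.le h.2 hp
    have := Real.rpow_nonneg ha.le p
    linarith
  · have := Real.rpow_le_rpow_of_nonpos ha h.1 hp.le
    have := Real.rpow_nonneg (hθ.le.trans h.2) p
    linarith

/-- Small angles: a power `θ ^ p` with `p > r ≥ 2s` is integrable up to `θ = 0`. -/
lemma IsAngularFactor.exists_lintegral_le_small {s : ℝ} {b : ℝ → ℝ} (hb : IsAngularFactor s b)
    {r p : ℝ} (hr : 2 * s ≤ r) (hp : r < p) : ∃ C : ℝ, 0 ≤ C ∧ ∀ t : ℝ, 0 < t →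
      ∫⁻ θ, (if θ ≤ t then ENNReal.ofReal (θ ^ p) else 0) ∂angMeasure b ≤
        ENNReal.ofReal (C * t ^ (p - r)) := by
  obtain ⟨c, M, θ₀, hc, hM, h0, h1, h⟩ := hb.exists_lintegral_le hr
  set Bp := θ₀ ^ p + (Real.pi / 2) ^ p with hBp
  have hBp0 : 0 ≤ Bp := by positivity
  refine ⟨c / (p - r) + M * Bp * θ₀ ^ (-(p - r)), ?_, fun t ht => ?_⟩
  · have : 0 < p - r := sub_pos.mpr hp
    positivity
  have hpr : 0 < p - r := sub_pos.mpr hp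
  have hFm : Measurable fun θ : ℝ => if θ ≤ t then ENNReal.ofReal (θ ^ p) else 0 :=
    Measurable.ite measurableSet_Iic (by fun_prop) measurable_const
  refine (h _ hFm (ENNReal.ofReal (Bp * θ₀ ^ (-(p - r)) * t ^ (p - r))) ?_).trans ?_
  · intro θ hθ
    split_ifs with hθt
    · refine ENNReal.ofReal_le_ofReal ((rpow_le_of_mem_Icc p h0 hθ).trans ?_)
      have h2 : 1 ≤ θ₀ ^ (-(p - r)) * t ^ (p - r) := by
        rw [Real.rpow_neg h0.le, inv_mul_eq_div, one_le_div (by positivity)]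
        exact Real.rpow_le_rpow h0.le (hθ.1.trans hθt) hpr.le
      calc Bp = Bp * 1 := by ring
        _ ≤ Bp * (θ₀ ^ (-(p - r)) * t ^ (p - r)) := by gcongr
        _ = _ := by ring
    · exact zero_le
  · have e1 : ∫⁻ θ in Set.Ioo 0 θ₀, ENNReal.ofReal (c * θ ^ (-1 - r)) *
        (if θ ≤ t then ENNReal.ofReal (θ ^ p) else 0) ≤
        ENNReal.ofReal (c / (p - r) * t ^ (p - r)) := by
      have hi : IntervalIntegrable (fun θ : ℝ => c * θ ^ (p - 1 - r)) volume 0 t :=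
        (intervalIntegral.intervalIntegrable_rpow' (by linarith)).const_mul c
      calc _ ≤ ∫⁻ θ in Set.Ioc 0 t, ENNReal.ofReal (c * θ ^ (p - 1 - r)) := by
            rw [← lintegral_indicator measurableSet_Ioo, ← lintegral_indicator measurableSet_Ioc]
            refine lintegral_mono fun θ => ?_
            by_cases hθ : θ ∈ Set.Ioo 0 θ₀
            · rw [Set.indicator_of_mem hθ]
              by_cases hθt : θ ≤ t
              · rw [Set.indicator_of_mem (show θ ∈ Set.Ioc 0 t from ⟨hθ.1, hθt⟩), if_pos hθt,
                  ← ENNReal.ofReal_mul (mul_nonneg hc.le (Real.rpow_nonneg hθ.1.le _)), mul_assoc,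
                  ← Real.rpow_add hθ.1]
                refine le_of_eq ?_
                congr 3; ring
              · simp [hθt]
            · rw [Set.indicator_of_notMem hθ]; exact zero_le
        _ = ENNReal.ofReal (∫ θ in (0:ℝ)..t, c * θ ^ (p - 1 - r)) := by
            rw [intervalIntegral.integral_of_le ht.le, ofReal_integral_eq_lintegral_ofReal hi.1]
            filter_upwards [ae_restrict_mem measurableSet_Ioc] with θ hθ
            exact mul_nonneg hc.le (Real.rpow_nonneg hθ.1.le _)
        _ = _ := by
            rw [intervalIntegral.integral_const_mul, integral_rpow (Or.inl (by linarith))]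
            rw [show p - 1 - r + 1 = p - r by ring, Real.zero_rpow hpr.ne', sub_zero]
            congr 1; ring
    refine (add_le_add e1 le_rfl).trans (le_of_eq ?_)
    rw [← ENNReal.ofReal_mul hM, ← ENNReal.ofReal_add (by positivity) (by positivity)]
    congr 1; ring

/-- Large angles: a power `θ ^ p` with `p < r`, `r ≥ 2s`, away from `θ = 0`. -/
lemma IsAngularFactor.exists_lintegral_le_large {s : ℝ} {b : ℝ → ℝ} (hb : IsAngularFactor s b)
    {r p : ℝ} (hr : 2 * s ≤ r) (hp : p < r) : ∃ C : ℝ, 0 ≤ C ∧ ∀ t : ℝ, 0 < t →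
      ∫⁻ θ, (if t ≤ θ then ENNReal.ofReal (θ ^ p) else 0) ∂angMeasure b ≤
        ENNReal.ofReal (C * t ^ (p - r)) := by
  obtain ⟨c, M, θ₀, hc, hM, h0, h1, h⟩ := hb.exists_lintegral_le hr
  set Bp := θ₀ ^ p + (Real.pi / 2) ^ p with hBp
  have hBp0 : 0 ≤ Bp := by positivity
  have hpr : 0 < r - p := sub_pos.mpr hp
  refine ⟨c / (r - p) + M * Bp * (Real.pi / 2) ^ (r - p), by positivity, fun t ht => ?_⟩
  have hFm : Measurable fun θ : ℝ => if t ≤ θ then ENNReal.ofReal (θ ^ p) else 0 :=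
    Measurable.ite measurableSet_Ici (by fun_prop) measurable_const
  refine (h _ hFm (ENNReal.ofReal (Bp * (Real.pi / 2) ^ (r - p) * t ^ (p - r))) ?_).trans ?_
  · intro θ hθ
    split_ifs with hθt
    · refine ENNReal.ofReal_le_ofReal ((rpow_le_of_mem_Icc p h0 hθ).trans ?_)
      have h2 : 1 ≤ (Real.pi / 2) ^ (r - p) * t ^ (p - r) := by
        rw [← neg_sub r p, Real.rpow_neg ht.le, ← div_eq_mul_inv, one_le_div (by positivity)]
        exact Real.rpow_le_rpow ht.le (hθt.trans hθ.2) hpr.le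
      calc Bp = Bp * 1 := by ring
        _ ≤ Bp * ((Real.pi / 2) ^ (r - p) * t ^ (p - r)) := by gcongr
        _ = _ := by ring
    · exact zero_le
  · have e1 : ∫⁻ θ in Set.Ioo 0 θ₀, ENNReal.ofReal (c * θ ^ (-1 - r)) *
        (if t ≤ θ then ENNReal.ofReal (θ ^ p) else 0) ≤
        ENNReal.ofReal (c / (r - p) * t ^ (p - r)) := by
      have hi : IntegrableOn (fun θ : ℝ => c * θ ^ (p - 1 - r)) (Set.Ioi t) :=
        (integrableOn_Ioi_rpow_of_lt (by linarith) ht).const_mul c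
      calc _ ≤ ∫⁻ θ in Set.Ici t, ENNReal.ofReal (c * θ ^ (p - 1 - r)) := by
            rw [← lintegral_indicator measurableSet_Ioo, ← lintegral_indicator measurableSet_Ici]
            refine lintegral_mono fun θ => ?_
            by_cases hθ : θ ∈ Set.Ioo 0 θ₀
            · rw [Set.indicator_of_mem hθ]
              by_cases hθt : t ≤ θ
              · rw [Set.indicator_of_mem (show θ ∈ Set.Ici t from hθt), if_pos hθt,
                  ← ENNReal.ofReal_mul (mul_nonneg hc.le (Real.rpow_nonneg hθ.1.le _)), mul_assoc,
                  ← Real.rpow_add hθ.1]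
                refine le_of_eq ?_
                congr 3; ring
              · simp [hθt]
            · rw [Set.indicator_of_notMem hθ]; exact zero_le
        _ = ∫⁻ θ in Set.Ioi t, ENNReal.ofReal (c * θ ^ (p - 1 - r)) :=
            setLIntegral_congr Ioi_ae_eq_Ici.symm
        _ = ENNReal.ofReal (∫ θ in Set.Ioi t, c * θ ^ (p - 1 - r)) := by
            rw [ofReal_integral_eq_lintegral_ofReal hi]
            filter_upwards [ae_restrict_mem measurableSet_Ioi] with θ hθ
            exact mul_nonneg hc.le (Real.rpow_nonneg (ht.trans hθ).le _)
        _ = _ := by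
            rw [integral_const_mul, integral_Ioi_rpow_of_lt (by linarith) ht]
            rw [show p - 1 - r + 1 = -(r - p) by ring, show p - r = -(r - p) by ring]
            congr 1; field_simp
    refine (add_le_add e1 le_rfl).trans (le_of_eq ?_)
    rw [← ENNReal.ofReal_mul hM, ← ENNReal.ofReal_add (by positivity) (by positivity)]
    congr 1; ring

/-! ### Translations and the Sobolev norm -/

open FourierTransform in
lemma fourier_compSubConst (y : V) (φ : 𝓢(V, ℂ)) (ξ : V) :
    (𝓕 (SchwartzMap.compSubConstCLM ℂ (-y) φ)) ξ = (𝐞 (inner ℝ y ξ) : ℂ) * (𝓕 φ) ξ := by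
  rw [SchwartzMap.fourier_coe, SchwartzMap.fourier_coe]
  have h := congrFun (VectorFourier.fourierIntegral_comp_add_right Real.fourierChar
    (volume : Measure V) (innerₗ V) (φ : V → ℂ) y) ξ
  have e : (fun x => (SchwartzMap.compSubConstCLM ℂ (-y) φ) x) = (φ : V → ℂ) ∘ fun v => v + y := by
    ext x; simp
  change VectorFourier.fourierIntegral Real.fourierChar volume (innerₗ V)
    (fun x => (SchwartzMap.compSubConstCLM ℂ (-y) φ) x) ξ = _
  rw [e, h]
  rfl

/-- The translation `u ↦ u(· + y)` on `L²`. -/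
def translate (y : V) : Lp ℂ 2 (volume : Measure V) →ₗᵢ[ℂ] Lp ℂ 2 (volume : Measure V) :=
  Lp.compMeasurePreservingₗᵢ ℂ (fun x : V => x + y) (measurePreserving_add_right volume y)

lemma coeFn_translate (y : V) (u : Lp ℂ 2 (volume : Measure V)) :
    translate y u =ᵐ[volume] fun x => u (x + y) :=
  Lp.coeFn_compMeasurePreserving u (measurePreserving_add_right volume y)

lemma memLp_character (y : V) :
    MemLp (fun ξ : V => (Real.fourierChar (inner ℝ y ξ) : ℂ)) ∞ volume := by
  refine memLp_top_of_bound (Continuous.aestronglyMeasurable ?_) 1 (ae_of_all _ fun ξ => ?_)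
  · exact continuous_subtype_val.comp (Real.continuous_fourierChar.comp (by fun_prop))
  · exact (Circle.norm_coe _).le

open FourierTransform in
/-- By density of the Schwartz functions in `L²`. -/
lemma fourier_translate (y : V) (u : Lp ℂ 2 (volume : Measure V)) :
    (𝓕 (translate y u) : Lp ℂ 2 (volume : Measure V)) = (memLp_character y).toLp _ • 𝓕 u := by
  have hc : Continuous fun v : Lp ℂ 2 (volume : Measure V) =>
      ((memLp_character y).toLp _ • v : Lp ℂ 2 (volume : Measure V)) := by
    refine (LipschitzWith.of_dist_le_mul (K := ‖(memLp_character y).toLp _‖₊) fun a c =>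
      ?_).continuous
    rw [dist_eq_norm, dist_eq_norm, sub_eq_add_neg, ← Lp.smul_neg, ← Lp.add_smul, ← sub_eq_add_neg]
    exact Lp.norm_smul_le _ _
  refine DenseRange.induction_on
    (p := fun u : Lp ℂ 2 (volume : Measure V) =>
      (𝓕 (translate y u) : Lp ℂ 2 (volume : Measure V)) = (memLp_character y).toLp _ • 𝓕 u)
    (SchwartzMap.denseRange_toLpCLM (p := 2) ENNReal.ofNat_ne_top) u ?_ fun φ => ?_
  · refine isClosed_eq ?_ ?_
    · exact (Lp.fourierTransformₗᵢ V ℂ).continuous.comp (translate y).continuous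
    · exact hc.comp (Lp.fourierTransformₗᵢ V ℂ).continuous
  · have e : translate y (φ.toLp 2) = (SchwartzMap.compSubConstCLM ℂ (-y) φ).toLp 2 := by
      refine Lp.ext ?_
      have h1 :=
        (measurePreserving_add_right (volume : Measure V) y).quasiMeasurePreserving.ae_eq_comp
        (φ.coeFn_toLp 2 volume)
      filter_upwards [coeFn_translate y (φ.toLp 2),
        (SchwartzMap.compSubConstCLM ℂ (-y) φ).coeFn_toLp 2 volume, h1] with x a1 a2 a3
      rw [a1, a2]
      simpa using a3
    rw [SchwartzMap.toLpCLM_apply, e, SchwartzMap.toLp_fourier_eq, SchwartzMap.toLp_fourier_eq]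
    refine Lp.ext ?_
    filter_upwards [Lp.coeFn_lpSMul (r := 2) ((memLp_character y).toLp _) ((𝓕 φ).toLp 2),
      (memLp_character y).coeFn_toLp, (𝓕 φ).coeFn_toLp 2 volume,
      (𝓕 (SchwartzMap.compSubConstCLM ℂ (-y) φ)).coeFn_toLp 2 volume] with x a1 a2 a3 a4
    rw [a1, a4, Pi.smul_apply', a2, a3, smul_eq_mul, fourier_compSubConst]

lemma memLp_bessel {m : ℝ} (hm : 0 ≤ m) :
    MemLp (fun ξ : V => (((1 + ‖ξ‖ ^ 2) ^ (-m / 2) : ℝ) : ℂ)) ∞ volume := by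
  refine memLp_top_of_bound (Continuous.aestronglyMeasurable ?_) 1 (ae_of_all _ fun ξ => ?_)
  · refine Complex.continuous_ofReal.comp ?_
    exact Continuous.rpow_const (by fun_prop) fun x => Or.inl (by positivity)
  · rw [Complex.norm_real, Real.norm_eq_abs, abs_of_nonneg (by positivity)]
    exact Real.rpow_le_one_of_one_le_of_nonpos (by nlinarith [sq_nonneg ‖ξ‖]) (by linarith)

open FourierTransform in
/-- The Bessel potential `G` of order `m` gives back `u` through the bounded multiplier `(1 +
|ξ|²)^{-m/2}`. -/
lemma fourier_eq_bessel_smul {m : ℝ} (hm : 0 ≤ m) {u G : Lp ℂ 2 (volume : Measure V)}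
    (h : TemperedDistribution.besselPotential V ℂ m (u : 𝓢'(V, ℂ)) = (G : 𝓢'(V, ℂ))) :
    (𝓕 u : Lp ℂ 2 (volume : Measure V)) = (memLp_bessel hm).toLp _ • 𝓕 G := by
  rw [← TemperedDistribution.besselPotential_neg_apply_eq_iff] at h
  have h2 := congrArg (fun T : 𝓢'(V, ℂ) => (𝓕 T : 𝓢'(V, ℂ))) h
  simp only [TemperedDistribution.fourier_besselPotential_eq_smulLeftCLM_fourier_apply] at h2
  rw [Lp.fourier_toTemperedDistribution_eq, Lp.fourier_toTemperedDistribution_eq,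
    ← Lp.toTemperedDistribution_smul_eq (p := ∞) (q := 2) (r := 2) (by fun_prop)
      (memLp_bessel hm)] at h2
  have hker := Lp.ker_toTemperedDistributionCLM_eq_bot (F := ℂ) (μ := (volume : Measure V)) (p := 2)
  exact (LinearMap.ker_eq_bot.mp hker h2).symm

/-- The `L²` norm is dominated by the Sobolev norm of order `m ≥ 0`. -/
lemma norm_le_of_besselPotential_eq {m : ℝ} (hm : 0 ≤ m) {u G : Lp ℂ 2 (volume : Measure V)}
    (h : TemperedDistribution.besselPotential V ℂ m (u : 𝓢'(V, ℂ)) = (G : 𝓢'(V, ℂ))) :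
    ‖u‖ ≤ ‖G‖ := by
  rw [← Lp.norm_fourier_eq u, ← Lp.norm_fourier_eq G, fourier_eq_bessel_smul hm h]
  have := Lp.norm_le_mul_norm_of_ae_le_mul (c := 1) (μ := (volume : Measure V)) (p := 2)
    (f := (memLp_bessel hm).toLp _ • FourierTransform.fourier G)
    (g := FourierTransform.fourier G) ?_
  · simpa using this
  filter_upwards [Lp.coeFn_lpSMul (r := 2) ((memLp_bessel hm).toLp _) (FourierTransform.fourier G),
    (memLp_bessel hm).coeFn_toLp] with ξ a1 a2
  rw [a1, Pi.smul_apply', a2, norm_smul]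
  gcongr
  rw [Complex.norm_real, Real.norm_eq_abs, abs_of_nonneg (by positivity)]
  exact Real.rpow_le_one_of_one_le_of_nonpos (by nlinarith [sq_nonneg ‖ξ‖]) (by linarith)

lemma norm_character_sub_one_le (y ξ : V) {m : ℝ} (hm : 0 < m) (hm1 : m ≤ 1) :
    ‖(Real.fourierChar (inner ℝ y ξ) : ℂ) - 1‖ ≤ 7 * (‖y‖ * ‖ξ‖) ^ m := by
  have ht : |inner ℝ y ξ| ≤ ‖y‖ * ‖ξ‖ := abs_real_inner_le_norm y ξ
  have h0 : 0 ≤ ‖y‖ * ‖ξ‖ := by positivity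
  -- The character is at distance at most `2π |y| |ξ|` and at most `2` from `1`; the exponent `m ≤
  -- 1` interpolates between the two.
  rcases le_total (‖y‖ * ‖ξ‖) 1 with h1 | h1
  · have h2 : ‖(Real.fourierChar (inner ℝ y ξ) : ℂ) - 1‖ ≤ ‖2 * Real.pi * inner ℝ y ξ‖ := by
      rw [Real.fourierChar_apply, mul_comm _ Complex.I]
      exact Real.norm_exp_I_mul_ofReal_sub_one_le
    have h3 : ‖y‖ * ‖ξ‖ ≤ (‖y‖ * ‖ξ‖) ^ m := Real.self_le_rpow_of_le_one h0 h1 hm1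
    rw [Real.norm_eq_abs, abs_mul, abs_of_nonneg (by positivity)] at h2
    have h4 := Real.pi_lt_d2
    nlinarith [Real.pi_pos]
  · have h2 : ‖(Real.fourierChar (inner ℝ y ξ) : ℂ) - 1‖ ≤ 2 := by
      refine (norm_sub_le _ _).trans ?_
      rw [Circle.norm_coe, norm_one]; norm_num
    have h3 : 1 ≤ (‖y‖ * ‖ξ‖) ^ m := Real.one_le_rpow h1 hm.le
    linarith

/-- On the Fourier side the translation by `y` multiplies by a character `e`, and
`|e - 1| (1 + |ξ|²)^{-m'/2}` is at most a constant times `min 1 (|y|^m)`. -/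
lemma norm_translate_sub_le {m m' : ℝ} (hm : 0 < m) (hm1 : m ≤ 1) (hmm : m ≤ m')
    {u G : Lp ℂ 2 (volume : Measure V)}
    (h : TemperedDistribution.besselPotential V ℂ m' (u : 𝓢'(V, ℂ)) = (G : 𝓢'(V, ℂ))) (y : V) :
    ‖translate y u - u‖ ≤ 7 * min 1 (‖y‖ ^ m) * ‖G‖ := by
  rw [mul_min_of_nonneg _ _ (by norm_num), min_mul_of_nonneg _ _ (norm_nonneg _), le_min_iff]
  refine ⟨?_, ?_⟩
  · have h1 := norm_le_of_besselPotential_eq (hm.le.trans hmm) h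
    have h2 := norm_sub_le (translate y u) u
    rw [LinearIsometry.norm_map] at h2
    linarith [norm_nonneg G]
  rw [← Lp.norm_fourier_eq (translate y u - u), ← Lp.norm_fourier_eq G]
  have e : (FourierTransform.fourier (translate y u - u) : Lp ℂ 2 (volume : Measure V)) =
      FourierTransform.fourier (translate y u) - FourierTransform.fourier u :=
    (Lp.fourierTransformₗᵢ V ℂ).map_sub _ _
  rw [e, fourier_translate]
  refine Lp.norm_le_mul_norm_of_ae_le_mul ?_
  have hu := fourier_eq_bessel_smul (hm.le.trans hmm) h
  have hm0 := hm.le.trans hmm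
  filter_upwards [Lp.coeFn_sub (((memLp_character y).toLp _ • FourierTransform.fourier u :
      Lp ℂ 2 (volume : Measure V))) (FourierTransform.fourier u),
    Lp.coeFn_lpSMul (r := 2) ((memLp_character y).toLp _) (FourierTransform.fourier u),
    (memLp_character y).coeFn_toLp,
    Lp.coeFn_lpSMul (r := 2) ((memLp_bessel hm0).toLp _) (FourierTransform.fourier G),
    (memLp_bessel hm0).coeFn_toLp] with ξ a1 a2 a3 a4 a5
  rw [a1, Pi.sub_apply, a2, Pi.smul_apply', a3, hu, a4, Pi.smul_apply', a5, smul_eq_mul,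
    smul_eq_mul, ← mul_assoc, ← sub_mul, norm_mul]
  gcongr
  rw [← sub_one_mul, norm_mul, Complex.norm_real, Real.norm_eq_abs, abs_of_nonneg (by positivity)]
  refine (mul_le_mul_of_nonneg_right (norm_character_sub_one_le y ξ hm hm1)
    (by positivity)).trans ?_
  rw [Real.mul_rpow (norm_nonneg _) (norm_nonneg _), mul_assoc, mul_assoc]
  gcongr
  refine mul_le_of_le_one_right (by positivity) ?_
  have h1 : (1 : ℝ) ≤ 1 + ‖ξ‖ ^ 2 := by nlinarith [sq_nonneg ‖ξ‖]
  have h2 : ‖ξ‖ ^ m ≤ (1 + ‖ξ‖ ^ 2) ^ (m' / 2) := by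
    calc ‖ξ‖ ^ m = (‖ξ‖ ^ 2) ^ (m / 2) := by
          rw [← Real.rpow_natCast, ← Real.rpow_mul (norm_nonneg _)]; congr 1; push_cast; ring
      _ ≤ (1 + ‖ξ‖ ^ 2) ^ (m / 2) := by
          apply Real.rpow_le_rpow (by positivity) (by linarith) (by linarith)
      _ ≤ _ := Real.rpow_le_rpow_of_exponent_le h1 (by linarith)
  calc ‖ξ‖ ^ m * (1 + ‖ξ‖ ^ 2) ^ (-m' / 2)
      ≤ (1 + ‖ξ‖ ^ 2) ^ (m' / 2) * (1 + ‖ξ‖ ^ 2) ^ (-m' / 2) := by gcongr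
    _ = 1 := by rw [← Real.rpow_add (by linarith)]; simp [neg_div]

lemma lintegral_enorm_sq_eq (u : Lp ℂ 2 (volume : Measure V)) {F : V → ℂ} (hF : u =ᵐ[volume] F) :
    ∫⁻ v, ‖F v‖ₑ ^ 2 = ‖u‖ₑ ^ 2 := by
  have h := Lp.enorm_def u
  rw [eLpNorm_eq_lintegral_rpow_enorm_toReal (by simp) (by simp)] at h
  rw [h, ← ENNReal.rpow_natCast, ← ENNReal.rpow_mul]
  simp only [ENNReal.toReal_ofNat]
  norm_num
  exact lintegral_congr_ae (hF.mono fun x hx => by simp only [hx])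

/-- The `L²` modulus of continuity of a function of finite Sobolev norm of order `m' ≥ m`, for a
representative `F` that is defined everywhere. -/
lemma lintegral_translate_sub_le {m m' : ℝ} (hm : 0 < m) (hm1 : m ≤ 1) (hmm : m ≤ m')
    {u G : Lp ℂ 2 (volume : Measure V)}
    (h : TemperedDistribution.besselPotential V ℂ m' (u : 𝓢'(V, ℂ)) = (G : 𝓢'(V, ℂ)))
    {F : V → ℂ} (hF : u =ᵐ[volume] F) (y : V) :
    ∫⁻ v, ‖F (v + y) - F v‖ₑ ^ 2 ≤
      49 * ‖G‖ₑ ^ 2 * ENNReal.ofReal (min 1 (‖y‖ ^ (2 * m))) := by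
  have hF2 := (measurePreserving_add_right (volume : Measure V) y).quasiMeasurePreserving.ae_eq_comp
    hF
  rw [lintegral_enorm_sq_eq (translate y u - u)]
  · have h1 := norm_translate_sub_le hm hm1 hmm h y
    have h2 := ENNReal.ofReal_le_ofReal h1
    rw [ofReal_norm, ENNReal.ofReal_mul (by positivity), ENNReal.ofReal_mul (by positivity),
      ofReal_norm] at h2
    refine (pow_le_pow_left' h2 2).trans (le_of_eq ?_)
    have e : min 1 (‖y‖ ^ (2 * m)) = min 1 (‖y‖ ^ m) ^ 2 := by
      have e1 : ‖y‖ ^ (2 * m) = (‖y‖ ^ m) ^ 2 := by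
        rw [← Real.rpow_natCast, ← Real.rpow_mul (norm_nonneg _)]; congr 1; push_cast; ring
      have e2 : (0 : ℝ) ≤ ‖y‖ ^ m := by positivity
      rw [e1]
      rcases le_total 1 (‖y‖ ^ m) with h | h
      · rw [min_eq_left h, min_eq_left (by nlinarith)]; norm_num
      · rw [min_eq_right h, min_eq_right (by nlinarith)]
    rw [e, ENNReal.ofReal_pow (by positivity), mul_pow, mul_pow, ENNReal.ofReal_ofNat]
    ring
  · filter_upwards [hF, hF2, coeFn_translate y u, Lp.coeFn_sub (translate y u) u]
      with v a1 a2 a3 a4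
    rw [a4, Pi.sub_apply, a3, a1]
    exact congrArg (· - F v) a2

/-! ### The Japanese bracket and the weights -/

/-- The Japanese bracket `⟨v⟩ = (1 + |v|²)^{1/2}`. -/
def jap (v : V) : ℝ := √(1 + ‖v‖ ^ 2)

lemma jap_sq (v : V) : jap v ^ 2 = 1 + ‖v‖ ^ 2 := Real.sq_sqrt (by positivity)

lemma one_le_jap (v : V) : 1 ≤ jap v := Real.one_le_sqrt.mpr (by nlinarith [sq_nonneg ‖v‖])

lemma jap_pos (v : V) : 0 < jap v := zero_lt_one.trans_le (one_le_jap v)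

lemma norm_le_jap (v : V) : ‖v‖ ≤ jap v := Real.le_sqrt_of_sq_le (by linarith)

lemma continuous_jap : Continuous jap := by unfold jap; fun_prop

lemma measurable_jap : Measurable jap := continuous_jap.measurable

lemma weight_eq (l : ℝ) (v : V) : weight l v = jap v ^ l := by
  rw [weight, jap, Real.sqrt_eq_rpow, ← Real.rpow_mul (by positivity)]
  congr 1; ring

lemma weight_natCast (l : ℕ) (v : V) : weight l v = jap v ^ l := by
  rw [weight_eq, Real.rpow_natCast]

lemma weight_pos (l : ℝ) (v : V) : 0 < weight l v := by unfold weight; positivity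

lemma weight_mul (l m : ℝ) (v : V) : weight l v * weight m v = weight (l + m) v := by
  rw [weight_eq, weight_eq, weight_eq, Real.rpow_add (jap_pos v)]

lemma weight_le_weight {l m : ℝ} (h : l ≤ m) (v : V) : weight l v ≤ weight m v := by
  rw [weight_eq, weight_eq]; exact Real.rpow_le_rpow_of_exponent_le (one_le_jap v) h

lemma continuous_weight (l : ℝ) : Continuous (weight l) := by
  have : weight l = fun v => jap v ^ l := funext (weight_eq l)
  rw [this]
  exact continuous_jap.rpow_const fun v => Or.inl (jap_pos v).ne'

lemma measurable_weight (l : ℝ) : Measurable (weight l) := (continuous_weight l).measurable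

lemma jap_le_add (a b : V) : jap a ≤ jap b + ‖a - b‖ := by
  refine Real.sqrt_le_iff.mpr ⟨by positivity [jap_pos b], ?_⟩
  have h1 : ‖a‖ ≤ ‖b‖ + ‖a - b‖ := by
    have := norm_add_le b (a - b); rwa [add_sub_cancel] at this
  have h2 := norm_le_jap b
  have h3 := jap_sq b
  nlinarith [norm_nonneg a, norm_nonneg b, norm_nonneg (a - b)]

lemma abs_jap_sub_le (a b : V) : |jap a - jap b| ≤ ‖a - b‖ := by
  rw [abs_sub_le_iff]
  have h1 := jap_le_add a b
  have h2 := jap_le_add b a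
  rw [norm_sub_rev] at h2
  constructor <;> linarith

lemma jap_sub_sq_le (v w : V) : jap (v - w) ^ 2 ≤ 2 * (jap v ^ 2 * jap w ^ 2) := by
  rw [jap_sq, jap_sq, jap_sq]
  have h := norm_sub_le v w
  nlinarith [norm_nonneg (v - w), norm_nonneg v, norm_nonneg w, sq_nonneg (‖v‖ - ‖w‖),
    sq_nonneg (‖v‖ * ‖w‖)]

lemma jap_sub_le (v w : V) : jap (v - w) ≤ 2 * (jap v * jap w) := by
  have h := jap_sub_sq_le v w
  have h1 : 0 < jap v * jap w := mul_pos (jap_pos v) (jap_pos w)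
  refine abs_le_of_sq_le_sq' (by nlinarith) (by positivity) |>.2

lemma norm_sub_le_jap (v w : V) : ‖v - w‖ ≤ 2 * (jap v * jap w) :=
  (norm_le_jap _).trans (jap_sub_le v w)

lemma norm_postVel_sub_left (v w : V) (σ : S2) :
    ‖postVel v w σ - v‖ = ‖v - w‖ * Real.sin (deviation v w σ / 2) := by
  have e : postVel v w σ - v = (1 / 2 : ℝ) • (‖v - w‖ • (σ : V) - (v - w)) := by
    unfold postVel; module
  have h : ‖postVel v w σ - v‖ ^ 2 = (‖v - w‖ * Real.sin (deviation v w σ / 2)) ^ 2 := by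
    rw [e, norm_smul, mul_pow, norm_sub_sq_real, inner_smul_left, real_inner_comm,
      inner_eq_norm_mul_cos, norm_smul, norm_S2, norm_norm, mul_pow, Real.norm_eq_abs]
    have h1 := one_sub_cos (deviation v w σ)
    rw [deviation] at *
    simp only [conj_trivial]
    norm_num
    linear_combination (1 / 2 * ‖v - w‖ ^ 2) * h1
  have h2 := sin_half_angle_nonneg (v - w) (σ : V)
  exact (pow_left_inj₀ (norm_nonneg _) (mul_nonneg (norm_nonneg _) h2) two_ne_zero).mp h

lemma norm_postVel_sub_right (v w : V) (σ : S2) :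
    ‖postVel v w σ - w‖ = ‖v - w‖ * Real.cos (deviation v w σ / 2) := by
  rw [postVel_eq, add_sub_cancel_left, norm_halfMap, deviation]

lemma deviation_nonneg (v w : V) (σ : S2) : 0 ≤ deviation v w σ :=
  InnerProductGeometry.angle_nonneg _ _

lemma norm_postVel_sub_le (v w : V) (σ : S2) :
    ‖postVel v w σ - v‖ ≤ ‖v - w‖ * deviation v w σ / 2 := by
  rw [norm_postVel_sub_left, mul_div_assoc]
  gcongr
  exact Real.sin_le (by have := deviation_nonneg v w σ; linarith)

lemma norm_sub_sq_le_postVel {v w : V} {σ : S2} (h : deviation v w σ ≤ Real.pi / 2) :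
    ‖v - w‖ ^ 2 ≤ 2 * ‖postVel v w σ - w‖ ^ 2 := by
  rw [norm_postVel_sub_right, mul_pow]
  have h1 := one_add_cos (deviation v w σ)
  have h2 : 0 ≤ Real.cos (deviation v w σ) :=
    Real.cos_nonneg_of_mem_Icc ⟨by linarith [deviation_nonneg v w σ, Real.pi_pos], h⟩
  nlinarith [sq_nonneg ‖v - w‖]

/-- The displacement `v' - v` is of first order in `θ ⟨v_*⟩`, relative to `⟨v⟩`. -/
lemma norm_postVel_sub_le_jap (v w : V) (σ : S2) :
    ‖postVel v w σ - v‖ ≤ deviation v w σ * jap w * jap v := by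
  have h1 := norm_postVel_sub_le v w σ
  have h2 := norm_sub_le_jap v w
  have h3 := deviation_nonneg v w σ
  nlinarith

/-- The same relative to `⟨v'⟩`; it needs `θ ≤ π / 2`, where `|v' - v_*|` is comparable to `|v -
v_*|`. -/
lemma norm_postVel_sub_le_jap' {v w : V} {σ : S2} (h : deviation v w σ ≤ Real.pi / 2) :
    ‖postVel v w σ - v‖ ≤ 2 * (deviation v w σ * jap w) * jap (postVel v w σ) := by
  have h1 := norm_postVel_sub_le v w σ
  have h2 := norm_sub_le_jap (postVel v w σ) w
  have h3 := deviation_nonneg v w σ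
  have h4 := norm_sub_sq_le_postVel h
  have h5 : ‖v - w‖ ≤ 2 * ‖postVel v w σ - w‖ := by
    nlinarith [norm_nonneg (v - w), norm_nonneg (postVel v w σ - w)]
  nlinarith

/-- The kinetic factor costs the weights of exponent `max γ 0`; for `γ ≤ 0` it is at most `1`. -/
lemma kinetic_le (γ : ℝ) (v w : V) :
    (1 + ‖v - w‖ ^ 2) ^ (γ / 2) ≤ 2 ^ max γ 0 * (jap v ^ max γ 0 * jap w ^ max γ 0) := by
  have h0 : (1 + ‖v - w‖ ^ 2) ^ (γ / 2) = weight γ (v - w) := rfl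
  rw [h0]
  refine (weight_le_weight (le_max_left γ 0) _).trans ?_
  rw [weight_eq, ← Real.mul_rpow (jap_pos v).le (jap_pos w).le,
    ← Real.mul_rpow (by norm_num) (by positivity [jap_pos v, jap_pos w])]
  exact Real.rpow_le_rpow (jap_pos _).le (jap_sub_le v w) (le_max_right _ _)

lemma kinetic_le_postVel (γ : ℝ) {v w : V} {σ : S2} (h : deviation v w σ ≤ Real.pi / 2) :
    (1 + ‖v - w‖ ^ 2) ^ (γ / 2) ≤
      2 ^ max γ 0 * (jap (postVel v w σ) ^ max γ 0 * jap w ^ max γ 0) := by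
  have h0 : (1 + ‖v - w‖ ^ 2) ^ (γ / 2) = weight γ (v - w) := rfl
  rw [h0]
  refine (weight_le_weight (le_max_left γ 0) _).trans ?_
  rw [weight_eq, ← Real.mul_rpow (jap_pos _).le (jap_pos w).le,
    ← Real.mul_rpow (by norm_num) (by positivity [jap_pos (postVel v w σ), jap_pos w])]
  refine Real.rpow_le_rpow (jap_pos _).le ?_ (le_max_right _ _)
  have h1 := norm_sub_sq_le_postVel h
  have h2 := jap_sub_sq_le (postVel v w σ) w
  have h3 : jap (v - w) ^ 2 ≤ 2 * jap (postVel v w σ - w) ^ 2 := by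
    rw [jap_sq, jap_sq]; linarith
  have h4 : 0 < jap (postVel v w σ) * jap w := mul_pos (jap_pos _) (jap_pos w)
  exact abs_le_of_sq_le_sq' (by nlinarith) (by positivity) |>.2

/-! ### Differences of weights along a collision -/

lemma abs_pow_sub_pow_le_of_le {a c M : ℝ} (ha : 0 ≤ a) (hc : 0 ≤ c) (haM : a ≤ M) (hcM : c ≤ M)
    (l : ℕ) : |a ^ l - c ^ l| ≤ |a - c| * l * M ^ (l - 1) := by
  refine (abs_pow_sub_pow_le a c l).trans ?_
  gcongr
  rw [abs_of_nonneg ha, abs_of_nonneg hc]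
  exact max_le haM hcM

/-- The weight difference is controlled by the deviation angle, and vanishes for `l = 0`. -/
lemma abs_weight_sub_le (l : ℕ) {v w : V} {σ : S2} (h : deviation v w σ ≤ Real.pi / 2) :
    |weight l (postVel v w σ) - weight l v| ≤
      l * 3 ^ l * (jap v ^ l * jap w ^ l * deviation v w σ) := by
  rcases l with _ | l
  · simp [weight]
  rw [weight_natCast, weight_natCast]
  have hX := one_le_jap w
  have hv := jap_pos v
  have hθ := deviation_nonneg v w σ
  have hd := norm_postVel_sub_le_jap v w σ
  have hM : jap (postVel v w σ) ≤ 3 * (jap v * jap w) := by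
    have := jap_le_add (postVel v w σ) v
    have h2 : deviation v w σ ≤ 2 := by linarith [Real.pi_lt_d2]
    nlinarith [mul_pos hv (jap_pos w)]
  have hM' : jap v ≤ 3 * (jap v * jap w) := by nlinarith
  refine (abs_pow_sub_pow_le_of_le (jap_pos _).le hv.le hM hM' _).trans ?_
  have h1 := (abs_jap_sub_le (postVel v w σ) v).trans hd
  calc |jap (postVel v w σ) - jap v| * ((l + 1 : ℕ) : ℝ) * (3 * (jap v * jap w)) ^ (l + 1 - 1)
      ≤ (deviation v w σ * jap w * jap v) * ((l + 1 : ℕ) : ℝ) * (3 * (jap v * jap w)) ^ l := by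
        rw [Nat.add_sub_cancel]; gcongr
    _ = ((l + 1 : ℕ) : ℝ) * 3 ^ l * (jap v ^ (l + 1) * jap w ^ (l + 1) * deviation v w σ) := by
        ring
    _ ≤ _ := by
        have := jap_pos w
        gcongr
        · norm_num
        · omega

/-- The counterpart of `abs_weight_sub_le` with the weight at `v'` on the right-hand side. -/
lemma abs_weight_sub_le_postVel (l : ℕ) {v w : V} {σ : S2} (h : deviation v w σ ≤ Real.pi / 2) :
    |weight l (postVel v w σ) - weight l v| ≤
      l * 5 ^ l * (jap (postVel v w σ) ^ l * jap w ^ l * deviation v w σ) := by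
  rcases l with _ | l
  · simp [weight]
  rw [weight_natCast, weight_natCast]
  have hX := one_le_jap w
  have hv := jap_pos (postVel v w σ)
  have hθ := deviation_nonneg v w σ
  have hd := norm_postVel_sub_le_jap' h
  have hM : jap v ≤ 5 * (jap (postVel v w σ) * jap w) := by
    have := jap_le_add v (postVel v w σ)
    rw [norm_sub_rev] at this
    have h2 : deviation v w σ ≤ 2 := by linarith [Real.pi_lt_d2]
    nlinarith [mul_pos hv (jap_pos w)]
  have hM' : jap (postVel v w σ) ≤ 5 * (jap (postVel v w σ) * jap w) := by nlinarith
  refine (abs_pow_sub_pow_le_of_le hv.le (jap_pos v).le hM' hM _).trans ?_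
  have h1 := (abs_jap_sub_le (postVel v w σ) v).trans hd
  calc |jap (postVel v w σ) - jap v| * ((l + 1 : ℕ) : ℝ) *
        (5 * (jap (postVel v w σ) * jap w)) ^ (l + 1 - 1)
      ≤ (2 * (deviation v w σ * jap w) * jap (postVel v w σ)) * ((l + 1 : ℕ) : ℝ) *
          (5 * (jap (postVel v w σ) * jap w)) ^ l := by
        rw [Nat.add_sub_cancel]; gcongr
    _ = ((l + 1 : ℕ) : ℝ) * (2 * 5 ^ l) *
          (jap (postVel v w σ) ^ (l + 1) * jap w ^ (l + 1) * deviation v w σ) := by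
        ring
    _ ≤ _ := by
        have := jap_pos w
        rw [pow_succ (5 : ℝ) l, mul_comm (5 ^ l : ℝ) 5]
        gcongr
        norm_num

lemma abs_one_add_pow_sub_le (l : ℕ) {e : ℝ} (he : |e| ≤ 1) :
    |(1 + e) ^ l - 1 - l * e| ≤ 3 ^ l * e ^ 2 := by
  induction l with
  | zero => simp; positivity
  | succ l ih =>
    have e1 : (1 + e) ^ (l + 1) - 1 - ((l + 1 : ℕ) : ℝ) * e =
        (1 + e) * ((1 + e) ^ l - 1 - l * e) + l * e ^ 2 := by push_cast; ring
    rw [e1]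
    have h1 : |1 + e| ≤ 2 := (abs_add_le _ _).trans (by rw [abs_one]; linarith)
    have h2 : (l : ℝ) ≤ 3 ^ l := by exact_mod_cast (Nat.lt_pow_self (by norm_num : 1 < 3)).le
    calc |(1 + e) * ((1 + e) ^ l - 1 - l * e) + l * e ^ 2|
        ≤ |1 + e| * |(1 + e) ^ l - 1 - l * e| + l * e ^ 2 := by
          refine (abs_add_le _ _).trans ?_
          rw [abs_mul, abs_of_nonneg (by positivity : (0 : ℝ) ≤ l * e ^ 2)]
      _ ≤ 2 * (3 ^ l * e ^ 2) + 3 ^ l * e ^ 2 := by gcongr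
      _ = _ := by ring

/-- A second-order difference of `l`-th powers, when the second-order difference of the squares is
small. -/
lemma abs_pow_add_pow_sub_le (l : ℕ) {a b c x : ℝ} (hc : 0 < c) (hx0 : 0 ≤ x) (hx : x ≤ 1 / 4)
    (ha : |a - c| ≤ 2 * x * c) (hb : |b - c| ≤ 2 * x * c)
    (hab : |a ^ 2 + b ^ 2 - 2 * c ^ 2| ≤ 10 * x ^ 2 * c ^ 2) :
    |a ^ l + b ^ l - 2 * c ^ l| ≤ l * (9 + 8 * 3 ^ l) * (c ^ l * x ^ 2) := by
  rcases l.eq_zero_or_pos with rfl | hl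
  · norm_num
  obtain ⟨p, hp⟩ : ∃ p, a = c * (1 + p) := ⟨(a - c) / c, by field_simp; ring⟩
  obtain ⟨q, hq⟩ : ∃ q, b = c * (1 + q) := ⟨(b - c) / c, by field_simp; ring⟩
  subst hp hq
  have hp : |p| ≤ 2 * x := by
    have : |c * (1 + p) - c| = c * |p| := by
      rw [show c * (1 + p) - c = c * p by ring, abs_mul, abs_of_pos hc]
    rw [this] at ha
    nlinarith
  have hq : |q| ≤ 2 * x := by
    have : |c * (1 + q) - c| = c * |q| := by
      rw [show c * (1 + q) - c = c * q by ring, abs_mul, abs_of_pos hc]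
    rw [this] at hb
    nlinarith
  have hp2 : p ^ 2 ≤ 4 * x ^ 2 := by rw [← sq_abs]; nlinarith [abs_nonneg p]
  have hq2 : q ^ 2 ≤ 4 * x ^ 2 := by rw [← sq_abs]; nlinarith [abs_nonneg q]
  have hpq : |2 * (p + q) + (p ^ 2 + q ^ 2)| ≤ 10 * x ^ 2 := by
    have : |(c * (1 + p)) ^ 2 + (c * (1 + q)) ^ 2 - 2 * c ^ 2| =
        c ^ 2 * |2 * (p + q) + (p ^ 2 + q ^ 2)| := by
      rw [show (c * (1 + p)) ^ 2 + (c * (1 + q)) ^ 2 - 2 * c ^ 2 =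
        c ^ 2 * (2 * (p + q) + (p ^ 2 + q ^ 2)) by ring, abs_mul, abs_of_pos (by positivity)]
    rw [this, mul_comm] at hab
    exact le_of_mul_le_mul_right hab (by positivity)
  have hpq' : |p + q| ≤ 9 * x ^ 2 := by
    rw [abs_le] at hpq ⊢
    constructor <;> nlinarith [sq_nonneg p, sq_nonneg q]
  have h1 := abs_one_add_pow_sub_le l (e := p) (by linarith)
  have h2 := abs_one_add_pow_sub_le l (e := q) (by linarith)
  have hl1 : (1 : ℝ) ≤ l := by exact_mod_cast hl
  have key : |((1 + p) ^ l - 1 - l * p) + ((1 + q) ^ l - 1 - l * q) + l * (p + q)| ≤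
      l * (9 + 8 * 3 ^ l) * x ^ 2 := by
    calc _ ≤ 3 ^ l * p ^ 2 + 3 ^ l * q ^ 2 + l * |p + q| := by
          refine (abs_add_le _ _).trans (add_le_add ((abs_add_le _ _).trans (add_le_add h1 h2)) ?_)
          rw [abs_mul, Nat.abs_cast]
      _ ≤ 3 ^ l * (4 * x ^ 2) + 3 ^ l * (4 * x ^ 2) + l * (9 * x ^ 2) := by gcongr
      _ ≤ l * (3 ^ l * (4 * x ^ 2) + 3 ^ l * (4 * x ^ 2)) + l * (9 * x ^ 2) := by
          have : 0 ≤ 3 ^ l * (4 * x ^ 2) + 3 ^ l * (4 * x ^ 2) := by positivity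
          nlinarith
      _ = _ := by ring
  have e : (c * (1 + p)) ^ l + (c * (1 + q)) ^ l - 2 * c ^ l =
      c ^ l * (((1 + p) ^ l - 1 - l * p) + ((1 + q) ^ l - 1 - l * q) + l * (p + q)) := by
    rw [mul_pow, mul_pow]; ring
  rw [e, abs_mul, abs_of_pos (by positivity)]
  calc _ ≤ c ^ l * (l * (9 + 8 * 3 ^ l) * x ^ 2) := by gcongr
    _ = _ := by ring

/-! ### Weight differences of near-grazing collisions -/

lemma abs_rpow_neg_sub_one_le {q t : ℝ} (hq : 0 ≤ q) (ht : |t - 1| ≤ 1 / 2) :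
    |t ^ (-q) - 1| ≤ q * 2 ^ (q + 1) * |t - 1| := by
  have hs : ∀ x ∈ Set.Icc (1 / 2 : ℝ) (3 / 2), HasDerivWithinAt (fun y : ℝ => y ^ (-q))
      (-q * x ^ (-q - 1)) (Set.Icc (1 / 2 : ℝ) (3 / 2)) x := fun x hx =>
    (Real.hasDerivAt_rpow_const (Or.inl (by linarith [hx.1]))).hasDerivWithinAt
  have hb : ∀ x ∈ Set.Icc (1 / 2 : ℝ) (3 / 2), ‖-q * x ^ (-q - 1)‖ ≤ q * 2 ^ (q + 1) := by
    intro x hx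
    have hx0 : 0 < x := by linarith [hx.1]
    rw [norm_mul, norm_neg, Real.norm_of_nonneg hq, Real.norm_of_nonneg (by positivity)]
    gcongr
    calc x ^ (-q - 1) ≤ (1 / 2 : ℝ) ^ (-q - 1) :=
          Real.rpow_le_rpow_of_nonpos (by norm_num) hx.1 (by linarith)
      _ = 2 ^ (q + 1) := by
          rw [one_div, Real.inv_rpow (by norm_num), ← Real.rpow_neg (by norm_num)]
          congr 1; ring
  rw [abs_le] at ht
  have h := (convex_Icc (1 / 2 : ℝ) (3 / 2)).norm_image_sub_le_of_norm_hasDerivWithin_le hs hb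
    (x := 1) (y := t) ⟨by norm_num, by norm_num⟩ ⟨by linarith, by linarith⟩
  simpa using h

/-- The mean value inequality for `t ↦ t^{-q}` near `t = 1`, by homogeneity. -/
lemma abs_rpow_neg_sub_le {q a c x : ℝ} (hq : 0 ≤ q) (hc : 0 < c) (hx : x ≤ 1 / 4)
    (ha : |a - c| ≤ 2 * x * c) :
    |a ^ (-q) - c ^ (-q)| ≤ q * 2 ^ (q + 2) * (x * c ^ (-q)) := by
  obtain ⟨t, ht⟩ : ∃ t, a = c * t := ⟨a / c, by field_simp⟩
  subst ht
  have h1 : |t - 1| ≤ 2 * x := by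
    have : |c * t - c| = c * |t - 1| := by
      rw [show c * t - c = c * (t - 1) by ring, abs_mul, abs_of_pos hc]
    rw [this] at ha
    nlinarith
  have h2 : |t - 1| ≤ 1 / 2 := by linarith
  have h3 : 0 ≤ t := by rw [abs_le] at h2; linarith
  have h4 := abs_rpow_neg_sub_one_le hq h2
  rw [Real.mul_rpow hc.le h3,
    show c ^ (-q) * t ^ (-q) - c ^ (-q) = c ^ (-q) * (t ^ (-q) - 1) by ring,
    abs_mul, abs_of_nonneg (by positivity)]
  calc c ^ (-q) * |t ^ (-q) - 1| ≤ c ^ (-q) * (q * 2 ^ (q + 1) * (2 * x)) := by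
        gcongr
        exact h4.trans (by gcongr)
    _ = _ := by rw [show q + 2 = q + 1 + 1 by ring, Real.rpow_add_one (by norm_num) (q + 1)]; ring

section Near

variable {v w : V} {σ : S2}

lemma deviation_le_of_near (h : deviation v w σ * jap w ≤ 1 / 4) :
    deviation v w σ ≤ Real.pi / 2 := by
  have h1 := one_le_jap w
  have h2 := deviation_nonneg v w σ
  nlinarith [Real.pi_gt_three]

lemma abs_jap_postVel_sub_le :
    |jap (postVel v w σ) - jap v| ≤ 2 * (deviation v w σ * jap w) * jap v := by
  refine (abs_jap_sub_le _ _).trans ((norm_postVel_sub_le_jap v w σ).trans ?_)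
  have := mul_nonneg (mul_nonneg (deviation_nonneg v w σ) (jap_pos w).le) (jap_pos v).le
  linarith

lemma abs_jap_sub_postVel_le (h : deviation v w σ ≤ Real.pi / 2) :
    |jap v - jap (postVel v w σ)| ≤ 2 * (deviation v w σ * jap w) * jap (postVel v w σ) := by
  refine (abs_jap_sub_le _ _).trans ?_
  rw [norm_sub_rev]
  exact norm_postVel_sub_le_jap' h

lemma jap_postVel_le_of_near (h : deviation v w σ * jap w ≤ 1 / 4) :
    jap (postVel v w σ) ≤ 2 * jap v := by
  have h1 := (abs_le.mp (abs_jap_postVel_sub_le (v := v) (w := w) (σ := σ))).2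
  nlinarith [jap_pos v]

lemma jap_le_postVel_of_near (h : deviation v w σ * jap w ≤ 1 / 4) :
    jap v ≤ 2 * jap (postVel v w σ) := by
  have h1 := (abs_le.mp (abs_jap_sub_postVel_le (deviation_le_of_near h))).2
  nlinarith [jap_pos (postVel v w σ)]

lemma abs_weight_neg_sub_le {q : ℝ} (hq : 0 ≤ q) (h : deviation v w σ * jap w ≤ 1 / 4) :
    |weight (-q) (postVel v w σ) - weight (-q) v| ≤
      q * 2 ^ (q + 2) * (deviation v w σ * jap w * weight (-q) v) := by
  rw [weight_eq, weight_eq]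
  exact abs_rpow_neg_sub_le hq (jap_pos v) h abs_jap_postVel_sub_le

lemma abs_weight_neg_sub_le_postVel {q : ℝ} (hq : 0 ≤ q)
    (h : deviation v w σ * jap w ≤ 1 / 4) :
    |weight (-q) v - weight (-q) (postVel v w σ)| ≤
      q * 2 ^ (q + 2) * (deviation v w σ * jap w * weight (-q) (postVel v w σ)) := by
  rw [weight_eq, weight_eq]
  exact abs_rpow_neg_sub_le hq (jap_pos _) h (abs_jap_sub_postVel_le (deviation_le_of_near h))

/-- The first-order parts of the two weight differences at `v'` and at its image under the half turn
about `v - v_*` cancel. -/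
lemma abs_weight_postVel_add_halfTurn_sub_le (l : ℕ) (h : deviation v w σ * jap w ≤ 1 / 4) :
    |weight l (postVel v w σ) + weight l (postVel v w (halfTurn (dir (v - w)) σ)) -
        2 * weight l v| ≤
      l * (9 + 8 * 3 ^ l) * (jap v ^ l * (deviation v w σ * jap w) ^ 2) := by
  obtain ⟨τ, hτ⟩ : ∃ τ, τ = halfTurn (dir (v - w)) σ := ⟨_, rfl⟩
  have hdev : deviation v w τ = deviation v w σ := hτ ▸ deviation_turnPost v w σ
  have hadd := postVel_add_postVel_halfTurn v w σ
  rw [← hτ] at hadd ⊢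
  simp only [weight_natCast]
  have hx0 : 0 ≤ deviation v w σ * jap w := mul_nonneg (deviation_nonneg v w σ) (jap_pos w).le
  have h2 := abs_jap_postVel_sub_le (v := v) (w := w) (σ := τ)
  rw [hdev] at h2
  refine abs_pow_add_pow_sub_le l (jap_pos v) hx0 h abs_jap_postVel_sub_le h2 ?_
  have ha := norm_postVel_sub_left v w σ
  have hb := norm_postVel_sub_left v w τ
  have hd := norm_postVel_sub_le_jap v w σ
  rw [hdev, ← ha] at hb
  obtain ⟨a, hadef⟩ : ∃ a, a = postVel v w σ - v := ⟨_, rfl⟩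
  obtain ⟨c, hcdef⟩ : ∃ c, c = postVel v w τ - v := ⟨_, rfl⟩
  have e1 : postVel v w σ = v + a := by rw [hadef]; abel
  have e2 : postVel v w τ = v + c := by rw [hcdef]; abel
  rw [← hadef] at hb hd
  rw [← hcdef] at hb
  -- In `⟨v + a⟩² + ⟨v + c⟩² - 2 ⟨v⟩²` the first-order part is `2 ⟨v, a + c⟩`, and `a + c` is of
  -- second order in `θ`.
  rw [← hadef, ← hcdef] at hadd
  rw [e1, e2, jap_sq, jap_sq, jap_sq, norm_add_sq_real, norm_add_sq_real, hb]
  have e3 : inner ℝ v a + inner ℝ v c =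
      -(1 - Real.cos (deviation v w σ)) * inner ℝ v (v - w) := by
    rw [← inner_add_right, hadd, inner_smul_right]
  have e4 : |inner ℝ v (v - w)| ≤ 2 * (jap v ^ 2 * jap w) := by
    refine (abs_real_inner_le_norm _ _).trans ?_
    calc ‖v‖ * ‖v - w‖ ≤ jap v * (2 * (jap v * jap w)) := by
          have := jap_pos v
          gcongr
          · exact norm_le_jap v
          · exact norm_sub_le_jap v w
      _ = _ := by ring
  have e5 : 0 ≤ 1 - Real.cos (deviation v w σ) := by linarith [Real.cos_le_one (deviation v w σ)]
  have e6 : 1 - Real.cos (deviation v w σ) ≤ deviation v w σ ^ 2 / 2 := by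
    linarith [Real.one_sub_sq_div_two_le_cos (x := deviation v w σ)]
  have e7 : (1 - Real.cos (deviation v w σ)) * |inner ℝ v (v - w)| ≤
      (deviation v w σ * jap w) ^ 2 * jap v ^ 2 := by
    have hv := jap_pos v
    have hw := one_le_jap w
    calc _ ≤ deviation v w σ ^ 2 / 2 * (2 * (jap v ^ 2 * jap w)) := by gcongr
      _ = deviation v w σ ^ 2 * jap v ^ 2 * jap w := by ring
      _ ≤ deviation v w σ ^ 2 * jap v ^ 2 * jap w ^ 2 := by gcongr; nlinarith
      _ = _ := by ring
  have e8 : ‖a‖ ^ 2 ≤ (deviation v w σ * jap w) ^ 2 * jap v ^ 2 := by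
    rw [← mul_pow]; exact pow_le_pow_left₀ (norm_nonneg _) hd 2
  have e10 : |(1 - Real.cos (deviation v w σ)) * inner ℝ v (v - w)| ≤
      (deviation v w σ * jap w) ^ 2 * jap v ^ 2 := by
    rw [abs_mul, abs_of_nonneg e5]; exact e7
  rw [jap_sq] at e8 e10
  rw [abs_le] at e10 ⊢
  have := sq_nonneg ‖a‖
  have : 0 ≤ (deviation v w σ * jap w) ^ 2 * (1 + ‖v‖ ^ 2) := by positivity
  constructor <;> nlinarith

/-- The first-order parts of the two weight differences at `v` and at its reflection
`v_* + |v - v_*| σ` in `v'` cancel. -/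
lemma abs_weight_add_swapPre_sub_le (l : ℕ) (h : deviation v w σ * jap w ≤ 1 / 4) :
    |weight l v + weight l (w + ‖v - w‖ • (σ : V)) - 2 * weight l (postVel v w σ)| ≤
      l * (9 + 8 * 3 ^ l) * (jap (postVel v w σ) ^ l * (deviation v w σ * jap w) ^ 2) := by
  simp only [weight_natCast]
  have hx0 : 0 ≤ deviation v w σ * jap w := mul_nonneg (deviation_nonneg v w σ) (jap_pos w).le
  have hd := norm_postVel_sub_le_jap' (deviation_le_of_near h)
  obtain ⟨a, hadef⟩ : ∃ a, a = postVel v w σ - v := ⟨_, rfl⟩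
  have e1 : v = postVel v w σ - a := by rw [hadef]; abel
  have e2 : w + ‖v - w‖ • (σ : V) = postVel v w σ + a := by
    rw [hadef]; unfold postVel; module
  rw [← hadef] at hd
  have h1 := abs_jap_sub_postVel_le (deviation_le_of_near h)
  have h2 : |jap (postVel v w σ + a) - jap (postVel v w σ)| ≤
      2 * (deviation v w σ * jap w) * jap (postVel v w σ) := by
    refine (abs_jap_sub_le _ _).trans ?_
    rwa [add_sub_cancel_left]
  rw [e2]
  refine abs_pow_add_pow_sub_le l (jap_pos _) hx0 h h1 h2 ?_
  have e3 : jap v ^ 2 + jap (postVel v w σ + a) ^ 2 - 2 * jap (postVel v w σ) ^ 2 =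
      2 * ‖a‖ ^ 2 := by
    have e4 : jap v ^ 2 = 1 + ‖postVel v w σ - a‖ ^ 2 := by rw [← e1, jap_sq]
    rw [e4, jap_sq, jap_sq, norm_add_sq_real, norm_sub_sq_real]; ring
  rw [e3, abs_of_nonneg (by positivity)]
  have := pow_le_pow_left₀ (norm_nonneg _) hd 2
  nlinarith [sq_nonneg (deviation v w σ * jap w * jap (postVel v w σ))]

end Near

/-! ### Collisions with a fixed partner -/

/-- The measure `b(cos θ) dv dσ` of the collisions with a partner of velocity `w`. -/
def collAt (b : ℝ → ℝ) (w : V) : Measure (V × S2) :=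
  ((volume : Measure V).prod sphereMeasure).withDensity fun q => angFactor b q.1 w q.2

lemma measurable_insert {β : Type*} [MeasurableSpace β] {F : V × V × S2 → β} (hF : Measurable F)
    (w : V) : Measurable fun q : V × S2 => F (q.1, w, q.2) := by
  have h : Measurable fun q : V × S2 => (q.1, w, q.2) := by fun_prop
  exact hF.comp h

lemma measurable_angFactor_left {b : ℝ → ℝ} (hb : Measurable b) (w : V) :
    Measurable fun q : V × S2 => angFactor b q.1 w q.2 := by
  have h := measurable_insert (measurable_angFactor hb) w
  exact h

lemma measurable_deviation_left (w : V) : Measurable fun q : V × S2 => deviation q.1 w q.2 := by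
  have h := measurable_insert measurable_deviation w
  exact h

lemma measurable_postVel_left (w : V) : Measurable fun q : V × S2 => postVel q.1 w q.2 := by
  have h := measurable_insert measurable_postVel w
  exact h

lemma lintegral_collAt {b : ℝ → ℝ} (hb : Measurable b) (w : V) {F : V × S2 → ℝ≥0∞}
    (hF : Measurable F) : ∫⁻ q, F q ∂collAt b w =
      ∫⁻ v, ∫⁻ σ, angFactor b v w σ * F (v, σ) ∂sphereMeasure := by
  have hm := measurable_angFactor_left hb w
  rw [collAt, lintegral_withDensity_eq_lintegral_mul _ hm hF,
    lintegral_prod _ (hm.mul hF).aemeasurable]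
  rfl

lemma lintegral_collMeasure_angFactor {b : ℝ → ℝ} (hb : Measurable b) {F : V × V × S2 → ℝ≥0∞}
    (hF : Measurable F) :
    ∫⁻ p, angFactor b p.1 p.2.1 p.2.2 * F p ∂collMeasure =
      ∫⁻ w, ∫⁻ q : V × S2, F (q.1, w, q.2) ∂collAt b w := by
  have h := lintegral_collMeasure ((measurable_angFactor hb).mul hF)
  refine h.trans (lintegral_congr fun w => ?_)
  rw [lintegral_collAt hb w (measurable_insert hF w)]
  rfl

/-- Integrals over the collisions of functions of `(α, θ)`, where the velocity `α` is a function of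
the collision, are dominated by the integral over independent `(v, θ)`. -/
def DominatedMarginal (b : ℝ → ℝ) (w : V) (α : V × S2 → V) : Prop :=
  Measurable α ∧ ∀ K : V → ℝ → ℝ≥0∞, Measurable (Function.uncurry K) →
    ∫⁻ q, K (α q) (deviation q.1 w q.2) ∂collAt b w ≤
      ENNReal.ofReal (8 * Real.pi) * ∫⁻ v, ∫⁻ θ, K v θ ∂angMeasure b

lemma dominatedMarginal_fst {b : ℝ → ℝ} (hb : Measurable b) (w : V) :
    DominatedMarginal b w Prod.fst := by
  refine ⟨measurable_fst, fun K hK => ?_⟩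
  have h : Measurable fun q : V × S2 => K q.1 (deviation q.1 w q.2) :=
    hK.comp (measurable_fst.prodMk (measurable_deviation_left w))
  rw [lintegral_collAt hb w h, lintegral_pre hb w K hK]
  gcongr
  norm_num

lemma dominatedMarginal_postVel {b : ℝ → ℝ} (hb : Measurable b) (hb0 : ∀ x, x < 0 → b x = 0)
    (w : V) : DominatedMarginal b w fun q => postVel q.1 w q.2 := by
  refine ⟨measurable_postVel_left w, fun K hK => ?_⟩
  have h : Measurable fun q : V × S2 => K (postVel q.1 w q.2) (deviation q.1 w q.2) :=
    hK.comp ((measurable_postVel_left w).prodMk (measurable_deviation_left w))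
  rw [lintegral_collAt hb w h]
  exact lintegral_post_le hb hb0 w K hK

/-- The Cauchy-Schwarz inequality, for a pointwise bound of the square of the integrand. -/
lemma sq_lintegral_le_of_sq_le {α : Type*} [MeasurableSpace α] {μ : Measure α}
    {F G H : α → ℝ≥0∞} (hF : AEMeasurable F μ) (hG : AEMeasurable G μ)
    (h : ∀ᵐ x ∂μ, H x ^ 2 ≤ F x * G x) :
    (∫⁻ x, H x ∂μ) ^ 2 ≤ (∫⁻ x, F x ∂μ) * ∫⁻ x, G x ∂μ := by
  have h1 : ∫⁻ x, H x ∂μ ≤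
      ∫⁻ x, (fun x => F x ^ (1 / 2 : ℝ)) x * (fun x => G x ^ (1 / 2 : ℝ)) x ∂μ := by
    refine lintegral_mono_ae (h.mono fun x hx => ?_)
    have h2 := ENNReal.rpow_le_rpow hx (by norm_num : (0 : ℝ) ≤ 1 / 2)
    rw [ENNReal.mul_rpow_of_nonneg _ _ (by norm_num), ← ENNReal.rpow_natCast,
      ← ENNReal.rpow_mul] at h2
    norm_num at h2 ⊢
    exact h2
  have hq : Real.HolderConjugate 2 2 := Real.HolderConjugate.two_two
  have h2 := ENNReal.lintegral_mul_le_Lp_mul_Lq μ hq (hF.pow_const (1 / 2 : ℝ))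
    (hG.pow_const (1 / 2 : ℝ))
  have e : ∀ y : ℝ≥0∞, (y ^ (1 / 2 : ℝ)) ^ (2 : ℝ) = y := fun y => by
    rw [← ENNReal.rpow_mul]; norm_num
  simp only [e] at h2
  have h3 := pow_le_pow_left' (h1.trans h2) 2
  refine h3.trans (le_of_eq ?_)
  have e2 : ∀ y : ℝ≥0∞, (y ^ (1 / 2 : ℝ)) ^ 2 = y := fun y => by
    rw [← ENNReal.rpow_natCast, ← ENNReal.rpow_mul]; norm_num
  rw [mul_pow, e2, e2]

/-- The `L²` norm of an extended non-negative function. -/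
def l2 (a : V → ℝ≥0∞) : ℝ≥0∞ := (∫⁻ v, a v ^ 2) ^ (1 / 2 : ℝ)

lemma l2_sq (a : V → ℝ≥0∞) : l2 a ^ 2 = ∫⁻ v, a v ^ 2 := by
  rw [l2, ← ENNReal.rpow_natCast, ← ENNReal.rpow_mul]; norm_num

lemma le_of_sq_le_sq {a c : ℝ≥0∞} (h : a ^ 2 ≤ c ^ 2) : a ≤ c :=
  (ENNReal.pow_le_pow_left_iff two_ne_zero).mp h

lemma lintegral_mul_le_l2 {a c : V → ℝ≥0∞} (ha : Measurable a) (hc : Measurable c) :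
    ∫⁻ v, a v * c v ≤ l2 a * l2 c := by
  refine le_of_sq_le_sq ?_
  rw [mul_pow, l2_sq, l2_sq]
  exact sq_lintegral_le_of_sq_le (ha.pow_const 2).aemeasurable (hc.pow_const 2).aemeasurable
    (ae_of_all _ fun x => (mul_pow _ _ 2).le)

/-- By the Cauchy-Schwarz inequality, a product of functions of two velocities with dominated
marginals is controlled by `L²` norms. -/
lemma DominatedMarginal.lintegral_mul_le {b : ℝ → ℝ} {w : V} {α β : V × S2 → V}
    (hα : DominatedMarginal b w α) (hβ : DominatedMarginal b w β) {ω : ℝ → ℝ≥0∞}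
    (hω : Measurable ω) {a c : V → ℝ≥0∞} (ha : Measurable a) (hc : Measurable c) :
    ∫⁻ q, ω (deviation q.1 w q.2) * (a (α q) * c (β q)) ∂collAt b w ≤
      ENNReal.ofReal (8 * Real.pi) * (∫⁻ θ, ω θ ∂angMeasure b) * (l2 a * l2 c) := by
  have key : ∀ {α : V × S2 → V} {a : V → ℝ≥0∞}, DominatedMarginal b w α → Measurable a →
      ∫⁻ q, ω (deviation q.1 w q.2) * a (α q) ^ 2 ∂collAt b w ≤
        ENNReal.ofReal (8 * Real.pi) * (∫⁻ θ, ω θ ∂angMeasure b) * l2 a ^ 2 := by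
    intro α a hα ha
    have hm : Measurable (Function.uncurry fun (v : V) (θ : ℝ) => ω θ * a v ^ 2) :=
      Measurable.mul (f := fun p : V × ℝ => ω p.2) (g := fun p => a p.1 ^ 2)
        (hω.comp measurable_snd) ((ha.comp measurable_fst).pow_const 2)
    refine (hα.2 _ hm).trans (le_of_eq ?_)
    rw [mul_assoc, l2_sq, ← lintegral_const_mul _ (ha.pow_const 2)]
    congr 2
    ext v
    rw [lintegral_mul_const _ hω]
  have hd := measurable_deviation_left w
  refine le_of_sq_le_sq ?_
  refine (sq_lintegral_le_of_sq_le
    (F := fun q => ω (deviation q.1 w q.2) * a (α q) ^ 2)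
    (G := fun q => ω (deviation q.1 w q.2) * c (β q) ^ 2)
    ((hω.comp hd).mul ((ha.comp hα.1).pow_const 2)).aemeasurable
    ((hω.comp hd).mul ((hc.comp hβ.1).pow_const 2)).aemeasurable
    (ae_of_all _ fun q => le_of_eq (by ring))).trans ?_
  refine (mul_le_mul' (key hα ha) (key hβ hc)).trans (le_of_eq (by ring))

/-! ### The kernel of the commutator -/

/-- The integrand of the commutator product after the pre-post-collisional change of variables,
`B f(v_*) g(v) \bar h(v') (W_l(v') - W_l(v))`. -/
def kern (γ : ℝ) (b : ℝ → ℝ) (l : ℝ) (f g h : V → ℂ) (p : V × V × S2) : ℂ :=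
  (crossSection γ b p.1 p.2.1 p.2.2 : ℂ) * (f p.2.1 * g p.1 *
    conj (h (postVel p.1 p.2.1 p.2.2)) *
      ((weight l (postVel p.1 p.2.1 p.2.2) - weight l p.1 : ℝ) : ℂ))

open Classical in
/-- The integrand `kern` with the grazing collisions `θ < δ` removed. -/
def truncKern (γ : ℝ) (b : ℝ → ℝ) (l δ : ℝ) (f g h : V → ℂ) (p : V × V × S2) : ℂ :=
  if δ ≤ deviation p.1 p.2.1 p.2.2 then kern γ b l f g h p else 0

open Classical in
/-- The loss part of the collision integrand, with the grazing collisions `θ < δ` removed. -/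
def lossPart (γ : ℝ) (b : ℝ → ℝ) (δ : ℝ) (f g : V → ℂ) (p : V × V × S2) : ℂ :=
  if δ ≤ deviation p.1 p.2.1 p.2.2 then
    (crossSection γ b p.1 p.2.1 p.2.2 : ℂ) * (f p.2.1 * g p.1) else 0

lemma crossSection_prePost (γ : ℝ) (b : ℝ → ℝ) (v w : V) (σ : S2) :
    crossSection γ b (postVel v w σ) (postVelStar v w σ) (dir (v - w)) =
      crossSection γ b v w σ := by
  rw [crossSection, norm_postVel_sub_postVelStar, deviation_prePost, crossSection]

lemma measurable_crossSection (γ : ℝ) {b : ℝ → ℝ} (hb : Measurable b) :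
    Measurable fun p : V × V × S2 => crossSection γ b p.1 p.2.1 p.2.2 := by
  have h1 : Measurable fun p : V × V × S2 => b (Real.cos (deviation p.1 p.2.1 p.2.2)) :=
    hb.comp (Real.continuous_cos.measurable.comp measurable_deviation)
  have h2 : Measurable fun p : V × V × S2 => (1 + ‖p.1 - p.2.1‖ ^ 2) ^ (γ / 2) := by fun_prop
  exact h2.mul h1

lemma measurableSet_le_deviation (δ : ℝ) :
    MeasurableSet {p : V × V × S2 | δ ≤ deviation p.1 p.2.1 p.2.2} :=
  measurableSet_le measurable_const measurable_deviation

section Measurability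

variable {γ l δ : ℝ} {b : ℝ → ℝ} {f g h : V → ℂ}

lemma measurable_kern (hb : Measurable b) (hf : Measurable f) (hg : Measurable g)
    (hh : Measurable h) : Measurable (kern γ b l f g h) := by
  have h1 := measurable_crossSection γ hb
  have h2 := measurable_postVel
  have h3 := measurable_weight l
  have h4 : Measurable fun p : V × V × S2 => conj (h (postVel p.1 p.2.1 p.2.2)) :=
    Complex.continuous_conj.measurable.comp (hh.comp h2)
  have h5 : Measurable fun p : V × V × S2 => weight l (postVel p.1 p.2.1 p.2.2) := h3.comp h2
  unfold kern
  fun_prop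

lemma measurable_truncKern (hb : Measurable b) (hf : Measurable f) (hg : Measurable g)
    (hh : Measurable h) : Measurable (truncKern γ b l δ f g h) :=
  Measurable.ite (measurableSet_le_deviation δ) (measurable_kern hb hf hg hh) measurable_const

lemma measurable_lossPart (hb : Measurable b) (hf : Measurable f) (hg : Measurable g) :
    Measurable (lossPart γ b δ f g) := by
  have h1 := measurable_crossSection γ hb
  refine Measurable.ite (measurableSet_le_deviation δ) ?_ measurable_const
  fun_prop

end Measurability

/-- The gain part is the loss part at the inverse collision. -/
lemma collisionIntegrand_eq (γ : ℝ) (b : ℝ → ℝ) (δ : ℝ) (f g : V → ℂ) (p : V × V × S2) :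
    collisionIntegrand γ b δ f g p.1 p.2 =
      lossPart γ b δ f g (prePost p) - lossPart γ b δ f g p := by
  obtain ⟨v, w, σ⟩ := p
  simp only [collisionIntegrand, lossPart, prePost, deviation_prePost, crossSection_prePost]
  split_ifs
  · ring
  · ring

/-- The change of variables that moves the test function from `v` to `v'`. -/
lemma truncKern_prePost (γ : ℝ) (b : ℝ → ℝ) (l δ : ℝ) (f g h : V → ℂ) (p : V × V × S2) :
    truncKern γ b l δ f g h (prePost p) =
      ((weight l p.1 : ℂ) * collisionIntegrand γ b δ f g p.1 p.2 -
        collisionIntegrand γ b δ f (weighted l g) p.1 p.2) * conj (h p.1) := by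
  obtain ⟨v, w, σ⟩ := p
  simp only [collisionIntegrand, truncKern, kern, prePost, deviation_prePost,
    crossSection_prePost, postVel_postVel, weighted]
  split_ifs
  · push_cast; ring
  · ring

/-! ### Changing the functions on null sets -/

lemma ae_collisionIntegrand_eq (γ : ℝ) (b : ℝ → ℝ) (δ : ℝ) {f f₀ g g₀ : V → ℂ}
    (hf : f =ᵐ[volume] f₀) (hg : g =ᵐ[volume] g₀) :
    ∀ᵐ v : V, collisionIntegrand γ b δ f g v =ᵐ[(volume : Measure V).prod sphereMeasure]
      collisionIntegrand γ b δ f₀ g₀ v := by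
  have h1 : ∀ᵐ p ∂collMeasure, f p.2.1 = f₀ p.2.1 ∧ g p.1 = g₀ p.1 := by
    have a1 : ∀ᵐ q ∂((volume : Measure V).prod sphereMeasure), f q.1 = f₀ q.1 :=
      Measure.quasiMeasurePreserving_fst.ae hf
    have a2 : ∀ᵐ p ∂collMeasure, f p.2.1 = f₀ p.2.1 := Measure.quasiMeasurePreserving_snd.ae a1
    have a3 : ∀ᵐ p ∂collMeasure, g p.1 = g₀ p.1 := Measure.quasiMeasurePreserving_fst.ae hg
    exact a2.and a3
  have h2 := measurePreserving_prePost.quasiMeasurePreserving.ae h1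
  have h3 := Measure.ae_ae_of_ae_prod (h1.and h2)
  filter_upwards [h3] with v hv
  filter_upwards [hv] with q hq
  obtain ⟨⟨a1, a2⟩, a3, a4⟩ := hq
  rw [collisionIntegrand_eq γ b δ f g (v, q), collisionIntegrand_eq γ b δ f₀ g₀ (v, q)]
  simp only [lossPart, a1, a2, a3, a4]

lemma truncQ_ae_eq (γ : ℝ) (b : ℝ → ℝ) (δ : ℝ) {f f₀ g g₀ : V → ℂ}
    (hf : f =ᵐ[volume] f₀) (hg : g =ᵐ[volume] g₀) :
    truncQ γ b δ f g =ᵐ[volume] truncQ γ b δ f₀ g₀ :=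
  (ae_collisionIntegrand_eq γ b δ hf hg).mono fun _ hv => integral_congr_ae hv

lemma weighted_ae_eq (l : ℝ) {g g₀ : V → ℂ} (hg : g =ᵐ[volume] g₀) :
    weighted l g =ᵐ[volume] weighted l g₀ :=
  hg.mono fun v hv => by simp only [weighted, hv]

lemma HasCommutatorPairing.congr {γ l : ℝ} {b : ℝ → ℝ} {f f₀ g g₀ h h₀ : V → ℂ} {L : ℂ}
    (hf : f =ᵐ[volume] f₀) (hg : g =ᵐ[volume] g₀) (hh : h =ᵐ[volume] h₀)
    (H : HasCommutatorPairing γ b l f₀ g₀ h₀ L) : HasCommutatorPairing γ b l f g h L := by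
  have key : ∀ δ, (fun v => truncCommutator γ b l δ f g v * conj (h v)) =ᵐ[volume]
      fun v => truncCommutator γ b l δ f₀ g₀ v * conj (h₀ v) := fun δ => by
    filter_upwards [truncQ_ae_eq γ b δ hf hg, truncQ_ae_eq γ b δ hf (weighted_ae_eq l hg), hh]
      with v a1 a2 a3
    simp only [truncCommutator, a1, a2, a3]
  refine ⟨fun δ hδ => ?_, fun δ hδ => ?_,
    fun δ hδ => (H.integrable_pairing δ hδ).congr (key δ).symm,
    ?_⟩
  · filter_upwards [H.integrable_left δ hδ, ae_collisionIntegrand_eq γ b δ hf hg] with v a1 a2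
    exact a1.congr a2.symm
  · filter_upwards [H.integrable_right δ hδ,
      ae_collisionIntegrand_eq γ b δ hf (weighted_ae_eq l hg)] with v a1 a2
    exact a1.congr a2.symm
  · refine H.tendsto.congr fun δ => (integral_congr_ae (key δ)).symm

/-! ### The symmetrized commutator product -/

/-- The commutator product exists as soon as `kern` becomes absolutely integrable after
symmetrization by a measure preserving map `S` that keeps the deviation angle. Since `S` keeps the
truncation `θ ≥ δ`, the truncated product is half of the truncated integral of `kern + kern ∘ S`, to
which dominated convergence applies. With `S` the identity this is the case of an absolutely
integrable `kern`. -/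
theorem exists_hasCommutatorPairing {γ l : ℝ} {b : ℝ → ℝ} (hb : Measurable b) {f g h : V → ℂ}
    (hf : Measurable f) (hg : Measurable g) (hh : Measurable h)
    (hleft : ∀ δ : ℝ, 0 < δ → ∀ᵐ v : V,
      Integrable (collisionIntegrand γ b δ f g v) ((volume : Measure V).prod sphereMeasure))
    (hright : ∀ δ : ℝ, 0 < δ → ∀ᵐ v : V,
      Integrable (collisionIntegrand γ b δ f (weighted l g) v)
        ((volume : Measure V).prod sphereMeasure))
    (hA : ∀ δ : ℝ, 0 < δ → Integrable (truncKern γ b l δ f g h) collMeasure)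
    {S : V × V × S2 → V × V × S2} (hS : MeasurePreserving S collMeasure collMeasure)
    (hSd : ∀ p, deviation (S p).1 (S p).2.1 (S p).2.2 = deviation p.1 p.2.1 p.2.2)
    {M : ℝ≥0∞} (hM : M ≠ ∞)
    (hle : ∫⁻ p, ‖kern γ b l f g h p + kern γ b l f g h (S p)‖ₑ ∂collMeasure ≤ 2 * M) :
    ∃ L : ℂ, HasCommutatorPairing γ b l f g h L ∧ ‖L‖ₑ ≤ M := by
  classical
  have hk := measurable_kern (γ := γ) (l := l) hb hf hg hh
  obtain ⟨k, hkdef⟩ : ∃ k : V × V × S2 → ℂ, k = kern γ b l f g h := ⟨_, rfl⟩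
  rw [← hkdef] at hk hle
  have hkS : Measurable fun p => k p + k (S p) := hk.add (hk.comp hS.measurable)
  have hint : Integrable (fun p => k p + k (S p)) collMeasure :=
    ⟨hkS.aestronglyMeasurable, hle.trans_lt (ENNReal.mul_lt_top (by simp) hM.lt_top)⟩
  have hpre : ∀ δ, 0 < δ →
      Integrable (fun p => truncKern γ b l δ f g h (prePost p)) collMeasure := fun δ hδ =>
    measurePreserving_prePost.integrable_comp_of_integrable (hA δ hδ)
  have key : ∀ δ, 0 < δ → (fun v => truncCommutator γ b l δ f g v * conj (h v)) =ᵐ[volume]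
      fun v => ∫ q, truncKern γ b l δ f g h (prePost (v, q))
        ∂((volume : Measure V).prod sphereMeasure) := fun δ hδ => by
    filter_upwards [hleft δ hδ, hright δ hδ] with v a1 a2
    simp only [truncKern_prePost]
    rw [integral_mul_const, integral_sub (a1.const_mul _) a2, integral_const_mul]
    rfl
  have hval : ∀ δ, 0 < δ → ∫ v : V, truncCommutator γ b l δ f g v * conj (h v) =
      (1 / 2 : ℂ) * ∫ p, (if δ ≤ deviation p.1 p.2.1 p.2.2 then k p + k (S p) else 0)
        ∂collMeasure := fun δ hδ => by
    rw [integral_congr_ae (key δ hδ), ← integral_prod _ (hpre δ hδ)]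
    have e1 : ∫ p, truncKern γ b l δ f g h (prePost p) ∂collMeasure =
        ∫ p, truncKern γ b l δ f g h p ∂collMeasure := by
      have := integral_map (μ := collMeasure) measurable_prePost.aemeasurable
        (f := truncKern γ b l δ f g h) (measurable_truncKern hb hf hg hh).aestronglyMeasurable
      rw [measurePreserving_prePost.map_eq] at this
      exact this.symm
    have e2 : ∫ p, truncKern γ b l δ f g h (S p) ∂collMeasure =
        ∫ p, truncKern γ b l δ f g h p ∂collMeasure := by
      have := integral_map (μ := collMeasure) hS.measurable.aemeasurable
        (f := truncKern γ b l δ f g h) (measurable_truncKern hb hf hg hh).aestronglyMeasurable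
      rw [hS.map_eq] at this
      exact this.symm
    have e3 : ∀ p, (if δ ≤ deviation p.1 p.2.1 p.2.2 then k p + k (S p) else 0) =
        truncKern γ b l δ f g h p + truncKern γ b l δ f g h (S p) := fun p => by
      simp only [truncKern, hSd, ← hkdef]
      split_ifs <;> simp
    simp only [e3]
    have hi : Integrable (fun p => truncKern γ b l δ f g h (S p)) collMeasure :=
      hS.integrable_comp_of_integrable (hA δ hδ)
    rw [integral_add (hA δ hδ) hi, e2, e1]
    ring
  -- The limit is the integral over `θ > 0`, which spares the proof that `θ = 0` is a null set.
  refine ⟨(1 / 2 : ℂ) * ∫ p, (if 0 < deviation p.1 p.2.1 p.2.2 then k p + k (S p) else 0)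
    ∂collMeasure, ⟨hleft, hright, fun δ hδ => ?_, ?_⟩, ?_⟩
  · exact ((hpre δ hδ).integral_prod_left).congr (key δ hδ).symm
  · have ht : Tendsto (fun δ : ℝ => ∫ p,
        (if δ ≤ deviation p.1 p.2.1 p.2.2 then k p + k (S p) else 0) ∂collMeasure)
        (𝓝[>] (0 : ℝ))
        (𝓝 (∫ p, (if 0 < deviation p.1 p.2.1 p.2.2 then k p + k (S p) else 0) ∂collMeasure)) := by
      refine tendsto_integral_filter_of_dominated_convergence (fun p => ‖k p + k (S p)‖) ?_ ?_
        hint.norm ?_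
      · exact Eventually.of_forall fun δ =>
          (Measurable.ite (measurableSet_le_deviation δ) hkS measurable_const).aestronglyMeasurable
      · refine Eventually.of_forall fun δ => ae_of_all _ fun p => ?_
        split_ifs <;> simp
      · refine ae_of_all _ fun p => ?_
        split_ifs with hp
        · refine tendsto_const_nhds.congr' ?_
          filter_upwards [Ioc_mem_nhdsGT hp] with δ hδ
          rw [if_pos hδ.2]
        · refine tendsto_const_nhds.congr' ?_
          filter_upwards [self_mem_nhdsWithin] with δ hδ
          rw [if_neg]
          exact fun h' => hp (lt_of_lt_of_le hδ h')
    refine (ht.const_mul (1 / 2 : ℂ)).congr' ?_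
    filter_upwards [self_mem_nhdsWithin] with δ hδ
    exact (hval δ hδ).symm
  · rw [enorm_mul]
    have h2 : ‖(1 / 2 : ℂ)‖ₑ = 2⁻¹ := by
      rw [← ofReal_norm, norm_div, norm_one, Complex.norm_ofNat, one_div,
        ENNReal.ofReal_inv_of_pos (by norm_num), ENNReal.ofReal_ofNat]
    have h3 : ‖∫ p, (if 0 < deviation p.1 p.2.1 p.2.2 then k p + k (S p) else 0) ∂collMeasure‖ₑ ≤
        2 * M := by
      refine (enorm_integral_le_lintegral_enorm _).trans ((lintegral_mono fun p => ?_).trans hle)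
      split_ifs <;> simp
    rw [h2]
    calc (2 : ℝ≥0∞)⁻¹ * _ ≤ 2⁻¹ * (2 * M) := by gcongr
      _ = M := by rw [← mul_assoc, ENNReal.inv_mul_cancel (by simp) (by simp), one_mul]

/-! ### Absolute convergence away from grazing collisions -/

lemma lintegral_weight_neg_two_sq_lt_top :
    ∫⁻ v : V, ENNReal.ofReal (weight (-2) v) ^ 2 < ∞ := by
  have h := integrable_rpow_neg_one_add_norm_sq (E := V) (μ := volume) (r := 4)
    (by rw [finrank_V]; norm_num)
  have h2 := h.2
  refine lt_of_le_of_lt (lintegral_mono fun v => ?_) h2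
  rw [← ENNReal.ofReal_pow (weight_pos _ _).le, ← ofReal_norm,
    Real.norm_of_nonneg (by positivity), sq, weight_mul, weight]
  norm_num

open Classical in
/-- The kinetic factor is absorbed by the weights of exponent `max γ 0`. -/
lemma enorm_lossPart_le {γ δ : ℝ} {b : ℝ → ℝ} (hb : ∀ x, 0 ≤ b x) (f g : V → ℂ) (p : V × V × S2) :
    ‖lossPart γ b δ f g p‖ₑ ≤ angFactor b p.1 p.2.1 p.2.2 *
      (ENNReal.ofReal (2 ^ max γ 0) * ‖weighted (max γ 0) f p.2.1‖ₑ *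
        ((if δ ≤ deviation p.1 p.2.1 p.2.2 then 1 else 0) * ‖weighted (max γ 0) g p.1‖ₑ)) := by
  obtain ⟨v, w, σ⟩ := p
  simp only [lossPart]
  split_ifs with h
  swap
  · simp
  have hk := kinetic_le γ v w
  have hv := weight_pos (max γ 0) v
  have hw := weight_pos (max γ 0) w
  rw [← weight_eq, ← weight_eq] at hk
  have e : ‖(crossSection γ b v w σ : ℂ) * (f w * g v)‖ ≤
      b (Real.cos (deviation v w σ)) * (2 ^ max γ 0 * ‖weighted (max γ 0) f w‖ *
        (1 * ‖weighted (max γ 0) g v‖)) := by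
    rw [norm_mul, norm_mul, Complex.norm_real, weighted, weighted, norm_mul, norm_mul,
      Complex.norm_real, Complex.norm_real, Real.norm_of_nonneg hv.le, Real.norm_of_nonneg hw.le,
      crossSection, Real.norm_of_nonneg (mul_nonneg (by positivity) (hb _))]
    calc _ = b (Real.cos (deviation v w σ)) * (‖f w‖ * ‖g v‖) *
          (1 + ‖v - w‖ ^ 2) ^ (γ / 2) := by ring
      _ ≤ b (Real.cos (deviation v w σ)) * (‖f w‖ * ‖g v‖) *
          (2 ^ max γ 0 * (weight (max γ 0) v * weight (max γ 0) w)) := by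
        have := hb (Real.cos (deviation v w σ))
        gcongr
      _ = _ := by ring
  have h2 := ENNReal.ofReal_le_ofReal e
  rw [ofReal_norm, ENNReal.ofReal_mul (hb _), ENNReal.ofReal_mul (by positivity),
    ENNReal.ofReal_mul (by positivity), ENNReal.ofReal_mul (by positivity), ofReal_norm,
    ofReal_norm, ENNReal.ofReal_one] at h2
  exact h2

lemma IsAngularFactor.lintegral_away_lt_top {s : ℝ} {b : ℝ → ℝ} (hb : IsAngularFactor s b) {δ : ℝ}
    (hδ : 0 < δ) : ∫⁻ θ, (if δ ≤ θ then 1 else 0) ∂angMeasure b < ∞ := by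
  obtain ⟨C, hC, h⟩ := hb.exists_lintegral_le_large (r := max (2 * s) 1) (p := 0)
    (le_max_left _ _) (lt_max_of_lt_right one_pos)
  have := h δ hδ
  simp only [Real.rpow_zero, ENNReal.ofReal_one] at this
  exact this.trans_lt ENNReal.ofReal_lt_top

/-- Gain and loss part are integrable over all three variables against the square integrable weight
`⟨v⟩^{-2}`; by Fubini the integrals over `(v_*, σ)` are finite for almost every `v`. -/
lemma ae_integrable_collisionIntegrand {s γ δ : ℝ} {b : ℝ → ℝ} (hb : IsAngularFactor s b)
    (hδ : 0 < δ) {f g : V → ℂ} (hf : Measurable f) (hg : Measurable g)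
    (hf1 : ∫⁻ w, ‖weighted (max γ 0) f w‖ₑ < ∞)
    (hg2 : ∫⁻ v, ‖weighted (max γ 0) g v‖ₑ ^ 2 < ∞) :
    ∀ᵐ v : V, Integrable (collisionIntegrand γ b δ f g v)
      ((volume : Measure V).prod sphereMeasure) := by
  classical
  have hlm := measurable_lossPart (γ := γ) (δ := δ) hb.measurable hf hg
  have hw2 := measurable_weight (-2)
  have hwg := measurable_weight (max γ 0)
  have hgm : Measurable fun v => ‖weighted (max γ 0) g v‖ₑ := by unfold weighted; fun_prop
  have hfm : Measurable fun v => ‖weighted (max γ 0) f v‖ₑ := by unfold weighted; fun_prop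
  have hem : Measurable fun v => ENNReal.ofReal (weight (-2) v) := by fun_prop
  have hωm : Measurable fun θ : ℝ => if δ ≤ θ then (1 : ℝ≥0∞) else 0 :=
    Measurable.ite measurableSet_Ici measurable_const measurable_const
  have hl2g : l2 (fun v => ‖weighted (max γ 0) g v‖ₑ) < ∞ :=
    ENNReal.rpow_lt_top_of_nonneg (by norm_num) hg2.ne
  have hl2e : l2 (fun v => ENNReal.ofReal (weight (-2) v)) < ∞ :=
    ENNReal.rpow_lt_top_of_nonneg (by norm_num) lintegral_weight_neg_two_sq_lt_top.ne
  -- both the gain and the loss part are integrable against the weight of exponent `-2`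
  have main : ∀ α : V × V × S2 → V, Measurable α →
      (∀ w, DominatedMarginal b w fun q => α (q.1, w, q.2)) →
      ∫⁻ p, ENNReal.ofReal (weight (-2) (α p)) * ‖lossPart γ b δ f g p‖ₑ ∂collMeasure < ∞ := by
    intro α hαm hα
    obtain ⟨F, hF⟩ : ∃ F : V × V × S2 → ℝ≥0∞, F = fun p =>
      ENNReal.ofReal (2 ^ max γ 0) * ‖weighted (max γ 0) f p.2.1‖ₑ *
        ((if δ ≤ deviation p.1 p.2.1 p.2.2 then 1 else 0) *
          (‖weighted (max γ 0) g p.1‖ₑ * ENNReal.ofReal (weight (-2) (α p)))) := ⟨_, rfl⟩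
    have hFm : Measurable F := by
      have h1 : Measurable fun p : V × V × S2 =>
          if δ ≤ deviation p.1 p.2.1 p.2.2 then (1 : ℝ≥0∞) else 0 := hωm.comp measurable_deviation
      have h2 : Measurable fun p : V × V × S2 => ‖weighted (max γ 0) g p.1‖ₑ :=
        hgm.comp measurable_fst
      have h3 : Measurable fun p : V × V × S2 => ‖weighted (max γ 0) f p.2.1‖ₑ :=
        hfm.comp (measurable_fst.comp measurable_snd)
      have h4 : Measurable fun p => ENNReal.ofReal (weight (-2) (α p)) := hem.comp hαm
      rw [hF]
      exact (h3.const_mul _).mul (h1.mul (h2.mul h4))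
    have h1 : ∫⁻ p, ENNReal.ofReal (weight (-2) (α p)) * ‖lossPart γ b δ f g p‖ₑ ∂collMeasure ≤
        ∫⁻ p, angFactor b p.1 p.2.1 p.2.2 * F p ∂collMeasure := by
      refine lintegral_mono fun p => ?_
      refine (mul_le_mul' le_rfl (enorm_lossPart_le hb.nonneg f g p)).trans (le_of_eq ?_)
      rw [hF]; ring
    rw [lintegral_collMeasure_angFactor hb.measurable hFm] at h1
    have h2 : ∀ w, ∫⁻ q : V × S2, F (q.1, w, q.2) ∂collAt b w ≤
        ENNReal.ofReal (2 ^ max γ 0) * ‖weighted (max γ 0) f w‖ₑ *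
          (ENNReal.ofReal (8 * Real.pi) * (∫⁻ θ, (if δ ≤ θ then 1 else 0) ∂angMeasure b) *
            (l2 (fun v => ‖weighted (max γ 0) g v‖ₑ) *
              l2 fun v => ENNReal.ofReal (weight (-2) v))) := by
      intro w
      rw [hF]
      simp only
      rw [lintegral_const_mul' _ _ (by finiteness)]
      gcongr
      exact (dominatedMarginal_fst hb.measurable w).lintegral_mul_le (hα w) hωm hgm hem
    refine h1.trans_lt ((lintegral_mono h2).trans_lt ?_)
    rw [lintegral_mul_const _ (hfm.const_mul _), lintegral_const_mul _ hfm]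
    have h3 := hb.lintegral_away_lt_top hδ
    finiteness
  have hgain := main (fun p => postVel p.1 p.2.1 p.2.2) measurable_postVel
    (dominatedMarginal_postVel hb.measurable hb.eq_zero_of_neg)
  have hloss := main (fun p => p.1) measurable_fst (dominatedMarginal_fst hb.measurable)
  have hgain2 : ∫⁻ p : V × V × S2, ENNReal.ofReal (weight (-2) p.1) *
      ‖lossPart γ b δ f g (prePost p)‖ₑ ∂collMeasure < ∞ := by
    have hm : Measurable fun p : V × V × S2 =>
        ENNReal.ofReal (weight (-2) (postVel p.1 p.2.1 p.2.2)) * ‖lossPart γ b δ f g p‖ₑ :=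
      (hem.comp measurable_postVel).mul hlm.enorm
    rw [← measurePreserving_prePost.lintegral_comp hm] at hgain
    refine lt_of_le_of_lt (le_of_eq (lintegral_congr fun p => ?_)) hgain
    simp only [prePost, postVel_postVel]
  have hsum := ENNReal.add_lt_top.mpr ⟨hgain2, hloss⟩
  have hme : Measurable fun p : V × V × S2 => ENNReal.ofReal (weight (-2) p.1) :=
    hem.comp measurable_fst
  have hlp : Measurable fun p => lossPart γ b δ f g (prePost p) := hlm.comp measurable_prePost
  have hmp : Measurable fun p : V × V × S2 => ENNReal.ofReal (weight (-2) p.1) *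
      ‖lossPart γ b δ f g (prePost p)‖ₑ := hme.mul hlp.enorm
  rw [← lintegral_add_left hmp] at hsum
  have hmtot : Measurable fun p : V × V × S2 => ENNReal.ofReal (weight (-2) p.1) *
      ‖lossPart γ b δ f g (prePost p)‖ₑ + ENNReal.ofReal (weight (-2) p.1) *
        ‖lossPart γ b δ f g p‖ₑ := hmp.add (hme.mul hlm.enorm)
  rw [lintegral_prod _ hmtot.aemeasurable] at hsum
  have hae := ae_lt_top (hmtot.lintegral_prod_right') hsum.ne
  filter_upwards [hae] with v hv
  have hcm : Measurable fun q => collisionIntegrand γ b δ f g v q := by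
    have h1 : Measurable fun p => lossPart γ b δ f g (prePost p) - lossPart γ b δ f g p :=
      hlp.sub hlm
    have h2 := h1.comp (measurable_prodMk_left (x := v))
    have e : (fun q => collisionIntegrand γ b δ f g v q) =
        (fun p => lossPart γ b δ f g (prePost p) - lossPart γ b δ f g p) ∘ Prod.mk v :=
      funext fun q => collisionIntegrand_eq γ b δ f g (v, q)
    rw [e]; exact h2
  refine ⟨hcm.aestronglyMeasurable, ?_⟩
  have hpos : ENNReal.ofReal (weight (-2) v) ≠ 0 := by simpa using weight_pos (-2) v
  simp only [← mul_add] at hv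
  rw [lintegral_const_mul' _ _ ENNReal.ofReal_ne_top] at hv
  refine lt_of_le_of_lt (lintegral_mono fun q => ?_) (ENNReal.lt_top_of_mul_ne_top_right hv.ne hpos)
  rw [collisionIntegrand_eq γ b δ f g (v, q)]
  exact enorm_sub_le

/-! ### Angular kernels -/

lemma ae_angMeasure_pos (b : ℝ → ℝ) : ∀ᵐ θ ∂angMeasure b, 0 < θ := by
  refine (withDensity_absolutelyContinuous _ _).ae_le ?_
  filter_upwards [ae_restrict_mem measurableSet_Ioo] with θ hθ using hθ.1

lemma lintegral_angMeasure_mono {b : ℝ → ℝ} {F G : ℝ → ℝ≥0∞} (h : ∀ θ, 0 < θ → F θ ≤ G θ) :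
    ∫⁻ θ, F θ ∂angMeasure b ≤ ∫⁻ θ, G θ ∂angMeasure b :=
  lintegral_mono_ae ((ae_angMeasure_pos b).mono fun θ hθ => h θ hθ)

lemma measurable_ite_le_rpow (t p : ℝ) :
    Measurable fun θ : ℝ => if θ ≤ t then ENNReal.ofReal (θ ^ p) else 0 :=
  Measurable.ite measurableSet_Iic (by fun_prop) measurable_const

lemma measurable_ite_ge_rpow (t p : ℝ) :
    Measurable fun θ : ℝ => if t ≤ θ then ENNReal.ofReal (θ ^ p) else 0 :=
  Measurable.ite measurableSet_Ici (by fun_prop) measurable_const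

section AngularKernels

variable {s κ m : ℝ} {b : ℝ → ℝ}

/-- The bound is uniform in `J`: the factor `J^{-κ}` is what the singularity of order `1 + κ` costs
at the angle `1 / (X J)`. -/
lemma IsAngularFactor.exists_lintegral_lower_kernel_le (hb : IsAngularFactor s b)
    (hκ : 0 < κ) (hm : κ < m) (hs : 2 * s ≤ 1 + κ) :
    ∃ C : ℝ, 0 ≤ C ∧ ∀ X J : ℝ, 0 < X → 0 < J →
      ∫⁻ θ, ENNReal.ofReal (θ * X * J ^ (-κ) * min 1 ((θ * X * J) ^ m)) ∂angMeasure b ≤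
        ENNReal.ofReal (C * X ^ (1 + κ)) := by
  obtain ⟨C₁, hC₁, h1⟩ := hb.exists_lintegral_le_small (r := 1 + κ) (p := 1 + m) hs (by linarith)
  obtain ⟨C₂, hC₂, h2⟩ := hb.exists_lintegral_le_large (r := 1 + κ) (p := 1) hs (by linarith)
  refine ⟨C₁ + C₂, by positivity, fun X J hX hJ => ?_⟩
  have ht : 0 < (X * J)⁻¹ := by positivity
  -- The angle at which the minimum changes its value.
  obtain ⟨t, htd⟩ : ∃ t, t = (X * J)⁻¹ := ⟨_, rfl⟩
  rw [← htd] at ht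
  calc ∫⁻ θ, ENNReal.ofReal (θ * X * J ^ (-κ) * min 1 ((θ * X * J) ^ m)) ∂angMeasure b
      ≤ ∫⁻ θ, (ENNReal.ofReal (X ^ (1 + m) * J ^ (m - κ)) *
            (if θ ≤ t then ENNReal.ofReal (θ ^ (1 + m)) else 0) +
          ENNReal.ofReal (X * J ^ (-κ)) * (if t ≤ θ then ENNReal.ofReal (θ ^ (1 : ℝ)) else 0))
            ∂angMeasure b := by
        refine lintegral_angMeasure_mono fun θ hθ => ?_
        rcases le_total θ t with hle | hle
        · refine le_add_right ?_
          rw [if_pos hle, ← ENNReal.ofReal_mul (by positivity)]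
          refine ENNReal.ofReal_le_ofReal ?_
          calc _ ≤ θ * X * J ^ (-κ) * (θ * X * J) ^ m := by gcongr; exact min_le_right _ _
            _ = _ := by
              rw [Real.mul_rpow (by positivity) hJ.le, Real.mul_rpow hθ.le hX.le,
                Real.rpow_add hX, Real.rpow_add hθ, Real.rpow_sub hJ, Real.rpow_neg hJ.le,
                Real.rpow_one, Real.rpow_one]
              ring
        · refine le_add_left ?_
          rw [if_pos hle, ← ENNReal.ofReal_mul (by positivity)]
          refine ENNReal.ofReal_le_ofReal ?_
          calc _ ≤ θ * X * J ^ (-κ) * 1 := by gcongr; exact min_le_left _ _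
            _ = _ := by rw [Real.rpow_one]; ring
    _ ≤ ENNReal.ofReal (X ^ (1 + m) * J ^ (m - κ)) * ENNReal.ofReal (C₁ * t ^ (1 + m - (1 + κ))) +
          ENNReal.ofReal (X * J ^ (-κ)) * ENNReal.ofReal (C₂ * t ^ (1 - (1 + κ))) := by
        rw [lintegral_add_left ((measurable_ite_le_rpow _ _).const_mul _),
          lintegral_const_mul _ (measurable_ite_le_rpow _ _),
          lintegral_const_mul _ (measurable_ite_ge_rpow _ _)]
        gcongr
        · exact h1 t ht
        · exact h2 t ht
    _ = ENNReal.ofReal ((C₁ + C₂) * X ^ (1 + κ)) := by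
        rw [← ENNReal.ofReal_mul (by positivity), ← ENNReal.ofReal_mul (by positivity),
          ← ENNReal.ofReal_add (by positivity) (by positivity)]
        congr 1
        have e1 : t ^ (1 + m - (1 + κ)) = (X ^ (m - κ))⁻¹ * (J ^ (m - κ))⁻¹ := by
          rw [htd, Real.inv_rpow (by positivity), Real.mul_rpow hX.le hJ.le, mul_inv]
          congr 3 <;> ring_nf
        have e2 : t ^ (1 - (1 + κ)) = X ^ κ * J ^ κ := by
          rw [htd, Real.inv_rpow (by positivity), ← Real.rpow_neg (by positivity),
            Real.mul_rpow hX.le hJ.le]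
          congr 2 <;> ring_nf
        have e3 : X ^ (1 + m) = X ^ (1 + κ) * X ^ (m - κ) := by
          rw [← Real.rpow_add hX]; congr 1; ring
        have e4 : X ^ (1 + κ) = X * X ^ κ := by rw [Real.rpow_add hX, Real.rpow_one]
        have p1 : 0 < X ^ (m - κ) := by positivity
        have p2 : 0 < J ^ (m - κ) := by positivity
        have p3 : 0 < J ^ κ := by positivity
        rw [e1, e2, e3, e4, Real.rpow_neg hJ.le]
        field_simp

/-- The kernel that multiplies the integrals of squared increments over balls of radius of order `θ
X J`; it contains the inverse of their volume. -/
def averageKernel (κ m X J θ : ℝ) : ℝ :=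
  θ * X * J ^ (-κ) * (1 + ((θ * X * J) ^ m)⁻¹) * ((θ * X * J) ^ 3)⁻¹

/-- The angular integral of `averageKernel` over the balls that contain a vector of norm `ρ`,
uniformly in `J`. -/
lemma IsAngularFactor.exists_lintegral_averageKernel_le (hb : IsAngularFactor s b)
    (hκ : 0 < κ) (hm : κ < m) (hs : 2 * s ≤ 1 + κ) :
    ∃ C : ℝ, 0 ≤ C ∧ ∀ X J ρ : ℝ, 0 < X → 0 < J → 0 < ρ →
      ∫⁻ θ, (if ρ < 4 * (θ * X * J) then ENNReal.ofReal (averageKernel κ m X J θ) else 0)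
          ∂angMeasure b ≤
        ENNReal.ofReal (C * X ^ (1 + κ) * (ρ ^ (-3 - κ) + ρ ^ (-3 - κ - m))) := by
  obtain ⟨C₁, hC₁, h1⟩ := hb.exists_lintegral_le_large (r := 1 + κ) (p := -2) hs (by linarith)
  obtain ⟨C₂, hC₂, h2⟩ := hb.exists_lintegral_le_large (r := 1 + κ) (p := -2 - m) hs (by linarith)
  refine ⟨C₁ * 4 ^ (3 + κ) + C₂ * 4 ^ (3 + κ + m), by positivity, fun X J ρ hX hJ hρ => ?_⟩
  -- The smallest angle for which the ball contains vectors of norm `ρ`.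
  obtain ⟨t, htd⟩ : ∃ t, t = ρ * (4 * X * J)⁻¹ := ⟨_, rfl⟩
  have ht : 0 < t := by rw [htd]; positivity
  have q1 : X ^ (-2 : ℝ) = (X ^ 2)⁻¹ := by
    rw [Real.rpow_neg hX.le]; norm_cast
  have q2 : J ^ (-κ - 3) = (J ^ κ)⁻¹ * (J ^ 3)⁻¹ := by
    rw [Real.rpow_sub hJ, Real.rpow_neg hJ.le, div_eq_mul_inv]; norm_cast
  have q3 : X ^ (-2 - m) = (X ^ 2)⁻¹ * (X ^ m)⁻¹ := by
    rw [Real.rpow_sub hX, q1, div_eq_mul_inv]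
  have q4 : J ^ (-κ - 3 - m) = (J ^ κ)⁻¹ * (J ^ 3)⁻¹ * (J ^ m)⁻¹ := by
    rw [Real.rpow_sub hJ, q2, div_eq_mul_inv]
  calc _ ≤ ∫⁻ θ, (ENNReal.ofReal (X ^ (-2 : ℝ) * J ^ (-κ - 3)) *
            (if t ≤ θ then ENNReal.ofReal (θ ^ (-2 : ℝ)) else 0) +
          ENNReal.ofReal (X ^ (-2 - m) * J ^ (-κ - 3 - m)) *
            (if t ≤ θ then ENNReal.ofReal (θ ^ (-2 - m)) else 0)) ∂angMeasure b := by
        refine lintegral_angMeasure_mono fun θ hθ => ?_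
        split_ifs with hlt hle hle
        · rw [← ENNReal.ofReal_mul (by positivity), ← ENNReal.ofReal_mul (by positivity),
            ← ENNReal.ofReal_add (by positivity) (by positivity)]
          refine ENNReal.ofReal_le_ofReal (le_of_eq ?_)
          have q5 : θ ^ (-2 : ℝ) = (θ ^ 2)⁻¹ := by rw [Real.rpow_neg hθ.le]; norm_cast
          have q6 : θ ^ (-2 - m) = (θ ^ 2)⁻¹ * (θ ^ m)⁻¹ := by
            rw [Real.rpow_sub hθ, q5, div_eq_mul_inv]
          rw [averageKernel, q1, q2, q3, q4, q5, q6, Real.mul_rpow (by positivity) hJ.le,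
            Real.mul_rpow hθ.le hX.le, Real.rpow_neg hJ.le]
          have p1 : 0 < X ^ m := by positivity
          have p2 : 0 < J ^ m := by positivity
          have p3 : 0 < θ ^ m := by positivity
          have p4 : 0 < J ^ κ := by positivity
          field_simp
        · exfalso
          refine hle ?_
          rw [htd, ← div_eq_mul_inv, div_le_iff₀ (by positivity)]
          linarith
        · simp
        · simp
    _ ≤ ENNReal.ofReal (X ^ (-2 : ℝ) * J ^ (-κ - 3)) *
            ENNReal.ofReal (C₁ * t ^ (-2 - (1 + κ))) +
          ENNReal.ofReal (X ^ (-2 - m) * J ^ (-κ - 3 - m)) *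
            ENNReal.ofReal (C₂ * t ^ (-2 - m - (1 + κ))) := by
        rw [lintegral_add_left ((measurable_ite_ge_rpow _ _).const_mul _),
          lintegral_const_mul _ (measurable_ite_ge_rpow _ _),
          lintegral_const_mul _ (measurable_ite_ge_rpow _ _)]
        gcongr
        · exact h1 t ht
        · exact h2 t ht
    _ = ENNReal.ofReal (C₁ * 4 ^ (3 + κ) * X ^ (1 + κ) * ρ ^ (-3 - κ) +
          C₂ * 4 ^ (3 + κ + m) * X ^ (1 + κ) * ρ ^ (-3 - κ - m)) := by
        rw [← ENNReal.ofReal_mul (by positivity), ← ENNReal.ofReal_mul (by positivity),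
          ← ENNReal.ofReal_add (by positivity) (by positivity)]
        congr 1
        have e1 : t ^ (-2 - (1 + κ)) =
            ρ ^ (-3 - κ) * (4 ^ (3 + κ) * X ^ (3 + κ) * J ^ (3 + κ)) := by
          rw [htd, Real.mul_rpow hρ.le (by positivity), Real.inv_rpow (by positivity),
            ← Real.rpow_neg (by positivity), Real.mul_rpow (by positivity) hJ.le,
            Real.mul_rpow (by norm_num) hX.le]
          congr 2
          · ring
          · congr 2 <;> ring_nf
          · ring_nf
        have e2 : t ^ (-2 - m - (1 + κ)) =
            ρ ^ (-3 - κ - m) * (4 ^ (3 + κ + m) * X ^ (3 + κ + m) * J ^ (3 + κ + m)) := by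
          rw [htd, Real.mul_rpow hρ.le (by positivity), Real.inv_rpow (by positivity),
            ← Real.rpow_neg (by positivity), Real.mul_rpow (by positivity) hJ.le,
            Real.mul_rpow (by norm_num) hX.le]
          congr 2
          · ring
          · congr 2 <;> ring_nf
          · ring_nf
        have e3 : X ^ (-2 : ℝ) * X ^ (3 + κ) = X ^ (1 + κ) := by
          rw [← Real.rpow_add hX]; congr 1; ring
        have e4 : X ^ (-2 - m) * X ^ (3 + κ + m) = X ^ (1 + κ) := by
          rw [← Real.rpow_add hX]; congr 1; ring
        have e5 : J ^ (-κ - 3) * J ^ (3 + κ) = 1 := by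
          rw [← Real.rpow_add hJ, ← Real.rpow_zero J]; congr 1; ring
        have e6 : J ^ (-κ - 3 - m) * J ^ (3 + κ + m) = 1 := by
          rw [← Real.rpow_add hJ, ← Real.rpow_zero J]; congr 1; ring
        rw [e1, e2]
        calc _ = C₁ * 4 ^ (3 + κ) * (X ^ (-2 : ℝ) * X ^ (3 + κ)) * ρ ^ (-3 - κ) *
                (J ^ (-κ - 3) * J ^ (3 + κ)) +
              C₂ * 4 ^ (3 + κ + m) * (X ^ (-2 - m) * X ^ (3 + κ + m)) * ρ ^ (-3 - κ - m) *
                (J ^ (-κ - 3 - m) * J ^ (3 + κ + m)) := by ring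
          _ = _ := by rw [e3, e4, e5, e6, mul_one, mul_one]
    _ ≤ _ := by
        refine ENNReal.ofReal_le_ofReal ?_
        have p1 : 0 ≤ C₁ * 4 ^ (3 + κ) := by positivity
        have p2 : 0 ≤ C₂ * 4 ^ (3 + κ + m) := by positivity
        have p3 : 0 ≤ X ^ (1 + κ) * ρ ^ (-3 - κ) := by positivity
        have p4 : 0 ≤ X ^ (1 + κ) * ρ ^ (-3 - κ - m) := by positivity
        nlinarith [mul_nonneg p1 p4, mul_nonneg p2 p3]

/-- At the origin the integrand is of order `|y|^{-3-κ+m}`, at infinity of order `|y|^{-3-κ}`. -/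
lemma lintegral_increment_kernel_lt_top (hκ : 0 < κ) (hm : κ < m) :
    ∫⁻ y : V, ENNReal.ofReal (‖y‖ ^ (-3 - κ) + ‖y‖ ^ (-3 - κ - m)) *
      ENNReal.ofReal (min 1 (‖y‖ ^ (2 * m))) < ∞ := by
  obtain ⟨G, hG⟩ : ∃ G : ℝ → ℝ, G = fun r =>
    (r ^ (-3 - κ) + r ^ (-3 - κ - m)) * min 1 (r ^ (2 * m)) := ⟨_, rfl⟩
  have hGm : Measurable G := by rw [hG]; fun_prop
  have hint : Integrable (fun y : V => G ‖y‖) volume := by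
    rw [integrable_fun_norm_addHaar (volume : Measure V) (f := G), finrank_V]
    have hmeas : Measurable fun r : ℝ => r ^ (3 - 1) • G r := by fun_prop
    rw [← Set.Ioc_union_Ioi_eq_Ioi (zero_le_one : (0 : ℝ) ≤ 1)]
    refine IntegrableOn.union ?_ ?_
    · have h1 : IntegrableOn (fun r : ℝ => 2 * r ^ (m - κ - 1)) (Set.Ioc 0 1) := by
        have := intervalIntegral.intervalIntegrable_rpow' (a := 0) (b := 1)
          (by linarith : -1 < m - κ - 1)
        rw [intervalIntegrable_iff_integrableOn_Ioc_of_le zero_le_one] at this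
        exact this.const_mul 2
      refine Integrable.mono' h1 hmeas.aestronglyMeasurable ?_
      filter_upwards [ae_restrict_mem measurableSet_Ioc] with r hr
      have h0 := hr.1
      simp only [hG, smul_eq_mul]
      rw [Real.norm_of_nonneg (by positivity)]
      have a1 : r ^ 2 * (r ^ (-3 - κ) * r ^ (2 * m)) = r ^ (2 * m - κ - 1) := by
        rw [← Real.rpow_natCast, ← Real.rpow_add h0, ← Real.rpow_add h0]; congr 1; push_cast; ring
      have a2 : r ^ 2 * (r ^ (-3 - κ - m) * r ^ (2 * m)) = r ^ (m - κ - 1) := by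
        rw [← Real.rpow_natCast, ← Real.rpow_add h0, ← Real.rpow_add h0]; congr 1; push_cast; ring
      have a3 : r ^ (2 * m - κ - 1) ≤ r ^ (m - κ - 1) :=
        Real.rpow_le_rpow_of_exponent_ge h0 hr.2 (by linarith)
      calc _ ≤ r ^ 2 * ((r ^ (-3 - κ) + r ^ (-3 - κ - m)) * r ^ (2 * m)) := by
            gcongr; exact min_le_right _ _
        _ = r ^ (2 * m - κ - 1) + r ^ (m - κ - 1) := by rw [← a1, ← a2]; ring
        _ ≤ _ := by linarith
    · have h1 : IntegrableOn (fun r : ℝ => 2 * r ^ (-1 - κ)) (Set.Ioi 1) :=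
        (integrableOn_Ioi_rpow_of_lt (by linarith) one_pos).const_mul 2
      refine Integrable.mono' h1 hmeas.aestronglyMeasurable ?_
      filter_upwards [ae_restrict_mem measurableSet_Ioi] with r hr
      have hr1 : 1 < r := hr
      have h0 : 0 < r := by linarith
      simp only [hG, smul_eq_mul]
      rw [Real.norm_of_nonneg (by positivity)]
      have a1 : r ^ 2 * r ^ (-3 - κ) = r ^ (-1 - κ) := by
        rw [← Real.rpow_natCast, ← Real.rpow_add h0]; congr 1; push_cast; ring
      have a3 : r ^ (-3 - κ - m) ≤ r ^ (-3 - κ) :=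
        Real.rpow_le_rpow_of_exponent_le hr1.le (by linarith)
      calc _ ≤ r ^ 2 * ((r ^ (-3 - κ) + r ^ (-3 - κ)) * 1) := by
            gcongr; exact min_le_left _ _
        _ = _ := by rw [← a1]; ring
  refine lt_of_le_of_lt (lintegral_mono fun y => ?_) hint.2
  rw [← ENNReal.ofReal_mul (by positivity), ← ofReal_norm, hG, Real.norm_of_nonneg (by positivity)]

end AngularKernels

/-! ### Increments of a function along a collision -/

lemma ennreal_add_sq_le (a c : ℝ≥0∞) : (a + c) ^ 2 ≤ 2 * a ^ 2 + 2 * c ^ 2 := by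
  have h := ENNReal.rpow_add_le_mul_rpow_add_rpow a c (p := 2) (by norm_num)
  norm_num at h
  rwa [mul_add] at h

/-- The squared increment `|F(v') - F(v)|²` is bounded by averages of squared increments of `F` over
balls about `v` and `v'`. -/
lemma enorm_sub_sq_le_average {F : V → ℂ} (hF : Measurable F) {v v' : V} {z : ℝ} (hz : 0 < z)
    (h : ‖v' - v‖ ≤ z) :
    ENNReal.ofReal (z ^ 3) * volume (Metric.ball (0 : V) 1) * ‖F v' - F v‖ₑ ^ 2 ≤
      2 * (∫⁻ y, if ‖y‖ < z then ‖F (v + y) - F v‖ₑ ^ 2 else 0) +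
        2 * ∫⁻ y, if ‖y‖ < 2 * z then ‖F (v' + y) - F v'‖ₑ ^ 2 else 0 := by
  have hvol : ENNReal.ofReal (z ^ 3) * volume (Metric.ball (0 : V) 1) =
      volume (Metric.ball (0 : V) z) := by
    have := Measure.addHaar_ball_mul_of_pos (volume : Measure V) 0 hz 1
    rw [mul_one, finrank_V] at this
    exact this.symm
  have hset : MeasurableSet {y : V | ‖y‖ < z} := measurableSet_lt measurable_norm measurable_const
  have hm1 : Measurable fun y : V => if ‖y‖ < z then ‖F (v + y) - F v‖ₑ ^ 2 else 0 :=
    Measurable.ite hset (by fun_prop) measurable_const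
  have hm2 : Measurable fun y : V => if ‖y‖ < z then ‖F (v + y) - F v'‖ₑ ^ 2 else 0 :=
    Measurable.ite hset (by fun_prop) measurable_const
  have hsecond : ∫⁻ y, (if ‖y‖ < z then ‖F (v + y) - F v'‖ₑ ^ 2 else 0) ≤
      ∫⁻ y, if ‖y‖ < 2 * z then ‖F (v' + y) - F v'‖ₑ ^ 2 else 0 := by
    rw [← lintegral_add_right_eq_self _ (v' - v)]
    refine lintegral_mono fun y => ?_
    simp only
    split_ifs with h1 h2 h2
    · rw [show v + (y + (v' - v)) = v' + y by abel]
    · exfalso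
      have : ‖y‖ ≤ ‖y + (v' - v)‖ + ‖v' - v‖ := by
        have := norm_sub_le (y + (v' - v)) (v' - v)
        rwa [add_sub_cancel_right] at this
      linarith
    · exact zero_le
    · exact zero_le
  have hball : ∀ y : V, y ∈ Metric.ball (0 : V) z ↔ ‖y‖ < z := fun y => mem_ball_zero_iff
  calc _ = ∫⁻ y in Metric.ball (0 : V) z, ‖F v' - F v‖ₑ ^ 2 := by
        rw [setLIntegral_const, hvol, mul_comm]
    _ ≤ ∫⁻ y, (2 * (if ‖y‖ < z then ‖F (v + y) - F v‖ₑ ^ 2 else 0) +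
          2 * (if ‖y‖ < z then ‖F (v + y) - F v'‖ₑ ^ 2 else 0)) := by
        rw [← lintegral_indicator measurableSet_ball]
        refine lintegral_mono fun y => ?_
        by_cases hy : ‖y‖ < z
        · rw [Set.indicator_of_mem ((hball y).mpr hy), if_pos hy, if_pos hy]
          have h1 : ‖F v' - F v‖ₑ ≤ ‖F (v + y) - F v‖ₑ + ‖F (v + y) - F v'‖ₑ := by
            have e : F v' - F v = (F (v + y) - F v) - (F (v + y) - F v') := by ring
            rw [e]; exact enorm_sub_le
          exact (pow_le_pow_left' h1 2).trans (ennreal_add_sq_le _ _)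
        · rw [Set.indicator_of_notMem (mt (hball y).mp hy)]
          exact zero_le
    _ = _ := by
        rw [lintegral_add_left (hm1.const_mul 2), lintegral_const_mul _ hm1,
          lintegral_const_mul _ hm2]
    _ ≤ _ := by gcongr

/-! ### Averaged increments -/

lemma rpow_neg_le_two_mul {κ J J' : ℝ} (hκ : 0 ≤ κ) (hκ1 : κ ≤ 1) (hJ : 0 < J) (hJ' : 0 < J')
    (h : J ≤ 2 * J') : J' ^ (-κ) ≤ 2 * J ^ (-κ) := by
  have e1 : J ^ κ ≤ 2 * J' ^ κ := by
    calc J ^ κ ≤ (2 * J') ^ κ := by gcongr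
      _ = 2 ^ κ * J' ^ κ := Real.mul_rpow (by norm_num) hJ'.le
      _ ≤ 2 ^ (1 : ℝ) * J' ^ κ := by
          gcongr
          norm_num
      _ = _ := by rw [Real.rpow_one]
  rw [Real.rpow_neg hJ.le, Real.rpow_neg hJ'.le, ← div_eq_mul_inv,
    inv_eq_one_div, div_le_div_iff₀ (by positivity) (by positivity)]
  linarith

/-- The function `F` has the `L²` modulus of continuity `N min 1 (|y|^m)`. -/
def HasL2Modulus (m : ℝ) (F : V → ℂ) (N : ℝ≥0∞) : Prop :=
  ∀ y, ∫⁻ v, ‖F (v + y) - F v‖ₑ ^ 2 ≤ N ^ 2 * ENNReal.ofReal (min 1 (‖y‖ ^ (2 * m)))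

/-- The kernel `averageKernel` times the ball average of the squared increments of `F`. -/
def averagedIncrement (κ m X : ℝ) (F : V → ℂ) (u : V) (θ : ℝ) : ℝ≥0∞ :=
  ∫⁻ y, (if ‖y‖ < 4 * (θ * X * jap u) then ENNReal.ofReal (averageKernel κ m X (jap u) θ) else 0) *
    ‖F (u + y) - F u‖ₑ ^ 2

lemma measurable_averageKernel (κ m X : ℝ) :
    Measurable fun p : V × ℝ => averageKernel κ m X (jap p.1) p.2 := by
  have := measurable_jap
  unfold averageKernel
  fun_prop

lemma measurable_averagedIncrement_integrand (κ m X : ℝ) {F : V → ℂ} (hF : Measurable F) :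
    Measurable fun p : (V × ℝ) × V =>
      (if ‖p.2‖ < 4 * (p.1.2 * X * jap p.1.1) then
        ENNReal.ofReal (averageKernel κ m X (jap p.1.1) p.1.2) else 0) *
      ‖F (p.1.1 + p.2) - F p.1.1‖ₑ ^ 2 := by
  have h1 : Measurable fun p : (V × ℝ) × V => jap p.1.1 :=
    measurable_jap.comp (measurable_fst.comp measurable_fst)
  have h2 : Measurable fun p : (V × ℝ) × V => averageKernel κ m X (jap p.1.1) p.1.2 :=
    (measurable_averageKernel κ m X).comp measurable_fst
  have h3 : MeasurableSet {p : (V × ℝ) × V | ‖p.2‖ < 4 * (p.1.2 * X * jap p.1.1)} :=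
    measurableSet_lt (by fun_prop) (by fun_prop)
  have h4 : Measurable fun p : (V × ℝ) × V => ‖F (p.1.1 + p.2) - F p.1.1‖ₑ ^ 2 := by fun_prop
  exact (Measurable.ite h3 h2.ennreal_ofReal measurable_const).mul h4

lemma measurable_averagedIncrement (κ m X : ℝ) {F : V → ℂ} (hF : Measurable F) :
    Measurable (Function.uncurry (averagedIncrement κ m X F)) :=
  (measurable_averagedIncrement_integrand κ m X hF).lintegral_prod_right'

/-- Interchange of the order of integration, with the innermost variable moved to the front. -/
lemma lintegral_rotate {ν : Measure ℝ} [SFinite ν] {T : V → ℝ → V → ℝ≥0∞}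
    (hT : Measurable fun p : (V × ℝ) × V => T p.1.1 p.1.2 p.2) :
    ∫⁻ u, ∫⁻ θ, ∫⁻ y, T u θ y ∂volume ∂ν = ∫⁻ y, ∫⁻ u, ∫⁻ θ, T u θ y ∂ν := by
  have h1 : ∀ u, Measurable fun p : ℝ × V => T u p.1 p.2 := fun u => by
    have h : Measurable fun p : ℝ × V => ((u, p.1), p.2) := by fun_prop
    exact hT.comp h
  have h2 : Measurable fun p : V × V => ∫⁻ θ, T p.1 θ p.2 ∂ν := by
    have h : Measurable fun p : (V × V) × ℝ => ((p.1.1, p.2), p.1.2) := by fun_prop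
    have h3 : Measurable fun p : (V × V) × ℝ => T p.1.1 p.2 p.1.2 := hT.comp h
    exact h3.lintegral_prod_right'
  have h3 : ∀ u, ∫⁻ θ, ∫⁻ y, T u θ y ∂volume ∂ν = ∫⁻ y, ∫⁻ θ, T u θ y ∂ν := fun u =>
    lintegral_lintegral_swap (h1 u).aemeasurable
  rw [lintegral_congr h3]
  exact lintegral_lintegral_swap h2.aemeasurable

/-- Integration over `θ` first leaves the integral over `y` of a power of `|y|` times the squared
`L²` modulus of continuity at `y`. -/
lemma IsAngularFactor.exists_lintegral_averagedIncrement_le {s κ m : ℝ} {b : ℝ → ℝ}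
    (hb : IsAngularFactor s b) (hκ : 0 < κ) (hm : κ < m) (hs : 2 * s ≤ 1 + κ) :
    ∃ C : ℝ, 0 ≤ C ∧ ∀ X : ℝ, 0 < X → ∀ (F : V → ℂ) (N : ℝ≥0∞), Measurable F →
      HasL2Modulus m F N →
      ∫⁻ u, ∫⁻ θ, averagedIncrement κ m X F u θ ∂angMeasure b ≤
        ENNReal.ofReal (C * X ^ (1 + κ)) * N ^ 2 := by
  obtain ⟨C, hC, h⟩ := hb.exists_lintegral_averageKernel_le hκ hm hs
  have hfin := lintegral_increment_kernel_lt_top hκ hm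
  obtain ⟨I, hI⟩ : ∃ I, I = ∫⁻ y : V, ENNReal.ofReal (‖y‖ ^ (-3 - κ) + ‖y‖ ^ (-3 - κ - m)) *
      ENNReal.ofReal (min 1 (‖y‖ ^ (2 * m))) := ⟨_, rfl⟩
  rw [← hI] at hfin
  refine ⟨C * I.toReal, by positivity, fun X hX F N hF hN => ?_⟩
  have hM := measurable_averagedIncrement_integrand κ m X hF
  have hI1 : ∀ u y : V, ∫⁻ θ, (if ‖y‖ < 4 * (θ * X * jap u) then
      ENNReal.ofReal (averageKernel κ m X (jap u) θ) else 0) * ‖F (u + y) - F u‖ₑ ^ 2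
        ∂angMeasure b = (∫⁻ θ, (if ‖y‖ < 4 * (θ * X * jap u) then
      ENNReal.ofReal (averageKernel κ m X (jap u) θ) else 0) ∂angMeasure b) *
        ‖F (u + y) - F u‖ₑ ^ 2 := fun u y => lintegral_mul_const' _ _ (by finiteness)
  have h0 : ∀ᵐ y : V, y ∈ ({0}ᶜ : Set V) := compl_mem_ae_iff.mpr (measure_singleton _)
  refine (lintegral_rotate hM).trans_le ?_
  calc _ ≤ ∫⁻ y : V, ENNReal.ofReal (C * X ^ (1 + κ)) * N ^ 2 *
          (ENNReal.ofReal (‖y‖ ^ (-3 - κ) + ‖y‖ ^ (-3 - κ - m)) *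
            ENNReal.ofReal (min 1 (‖y‖ ^ (2 * m)))) := by
        refine lintegral_mono_ae ?_
        filter_upwards [h0] with y hy
        have hy0 : 0 < ‖y‖ := norm_pos_iff.mpr hy
        calc _ ≤ ∫⁻ u, ENNReal.ofReal (C * X ^ (1 + κ) *
                (‖y‖ ^ (-3 - κ) + ‖y‖ ^ (-3 - κ - m))) * ‖F (u + y) - F u‖ₑ ^ 2 := by
              refine lintegral_mono fun u => ?_
              simp only
              rw [hI1]
              gcongr
              exact h X (jap u) ‖y‖ hX (jap_pos u) hy0
          _ ≤ ENNReal.ofReal (C * X ^ (1 + κ) * (‖y‖ ^ (-3 - κ) + ‖y‖ ^ (-3 - κ - m))) *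
                (N ^ 2 * ENNReal.ofReal (min 1 (‖y‖ ^ (2 * m)))) := by
              rw [lintegral_const_mul' _ _ ENNReal.ofReal_ne_top]
              gcongr
              exact hN y
          _ = _ := by rw [ENNReal.ofReal_mul (by positivity)]; ring
    _ = ENNReal.ofReal (C * X ^ (1 + κ)) * N ^ 2 * I := by
        rw [hI]
        refine lintegral_const_mul _ ?_
        fun_prop
    _ = _ := by
        rw [show C * I.toReal * X ^ (1 + κ) = C * X ^ (1 + κ) * I.toReal by ring,
          ENNReal.ofReal_mul (p := C * X ^ (1 + κ)) (by positivity), ENNReal.ofReal_toReal hfin.ne]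
        ring

/-- The pointwise bound behind the Cauchy-Schwarz inequality for increments: for near-grazing
collisions the squared increment is controlled by the averaged increments at `v` and `v'`. -/
lemma enorm_sub_sq_le_averagedIncrement {κ m : ℝ} (hκ : 0 < κ) (hκm : κ < m) (hm1 : m < 1)
    {F : V → ℂ} (hF : Measurable F) {v w : V} {σ : S2}
    (hnear : deviation v w σ * jap w ≤ 1 / 4) (hθ : 0 < deviation v w σ) :
    volume (Metric.ball (0 : V) 1) * (ENNReal.ofReal (deviation v w σ * jap w * jap v ^ (-κ) *
        (1 + ((deviation v w σ * jap w * jap v) ^ m)⁻¹)) * ‖F (postVel v w σ) - F v‖ₑ ^ 2) ≤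
      64 * (averagedIncrement κ m (jap w) F v (deviation v w σ) +
        averagedIncrement κ m (jap w) F (postVel v w σ) (deviation v w σ)) := by
  have h1 := jap_postVel_le_of_near hnear
  have h2 := jap_le_postVel_of_near hnear
  have hd := norm_postVel_sub_le_jap v w σ
  obtain ⟨θ, hθd⟩ : ∃ θ, θ = deviation v w σ := ⟨_, rfl⟩
  obtain ⟨u, hu⟩ : ∃ u, u = postVel v w σ := ⟨_, rfl⟩
  obtain ⟨X, hXd⟩ : ∃ X, X = jap w := ⟨_, rfl⟩
  have hX : 0 < X := hXd ▸ jap_pos w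
  rw [← hθd, ← hXd] at hnear hd ⊢
  rw [← hθd] at hθ
  rw [← hu] at h1 h2 hd ⊢
  have hJ := jap_pos v
  have hJ' := jap_pos u
  have hz : 0 < θ * X * jap v := by positivity
  have hz' : 0 < θ * X * jap u := by positivity
  have hav := enorm_sub_sq_le_average hF hz hd
  obtain ⟨c, hc⟩ : ∃ c, c = θ * X * jap v ^ (-κ) * (1 + ((θ * X * jap v) ^ m)⁻¹) := ⟨_, rfl⟩
  have hc0 : 0 ≤ c := by rw [hc]; positivity
  have hk : averageKernel κ m X (jap v) θ = c * ((θ * X * jap v) ^ 3)⁻¹ := by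
    rw [averageKernel, hc]
  -- For near-grazing collisions the brackets at `v` and `v'` are comparable: the three factors of
  -- the kernel cost `2`, `2` and `8`.
  have hk' : averageKernel κ m X (jap v) θ ≤ 32 * averageKernel κ m X (jap u) θ := by
    have a1 : jap v ^ (-κ) ≤ 2 * jap u ^ (-κ) :=
      rpow_neg_le_two_mul hκ.le (by linarith) hJ' hJ h1
    have a2 : 1 + ((θ * X * jap v) ^ m)⁻¹ ≤ 2 * (1 + ((θ * X * jap u) ^ m)⁻¹) := by
      have e1 : (θ * X * jap u) ^ m ≤ 2 * (θ * X * jap v) ^ m := by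
        calc (θ * X * jap u) ^ m ≤ (2 * (θ * X * jap v)) ^ m := by
              refine Real.rpow_le_rpow hz'.le ?_ (by linarith)
              nlinarith [mul_pos hθ hX]
          _ = 2 ^ m * (θ * X * jap v) ^ m := Real.mul_rpow (by norm_num) hz.le
          _ ≤ 2 ^ (1 : ℝ) * (θ * X * jap v) ^ m := by
              gcongr
              norm_num
          _ = _ := by rw [Real.rpow_one]
      have e2 : ((θ * X * jap v) ^ m)⁻¹ ≤ 2 * ((θ * X * jap u) ^ m)⁻¹ := by
        rw [← div_eq_mul_inv, inv_eq_one_div, div_le_div_iff₀ (by positivity) (by positivity)]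
        linarith
      linarith
    have a3 : ((θ * X * jap v) ^ 3)⁻¹ ≤ 8 * ((θ * X * jap u) ^ 3)⁻¹ := by
      have e1 : (θ * X * jap u) ^ 3 ≤ (2 * (θ * X * jap v)) ^ 3 := by
        refine pow_le_pow_left₀ hz'.le ?_ 3
        nlinarith [mul_pos hθ hX]
      rw [← div_eq_mul_inv, inv_eq_one_div, div_le_div_iff₀ (by positivity) (by positivity)]
      linarith
    rw [averageKernel, averageKernel]
    calc _ ≤ θ * X * (2 * jap u ^ (-κ)) * (2 * (1 + ((θ * X * jap u) ^ m)⁻¹)) *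
          (8 * ((θ * X * jap u) ^ 3)⁻¹) := by gcongr
      _ = _ := by ring
  have hav2 := mul_le_mul' (le_refl (ENNReal.ofReal (averageKernel κ m X (jap v) θ))) hav
  have hset : ∀ (x : V) (R : ℝ), Measurable fun y : V =>
      if ‖y‖ < R then ‖F (x + y) - F x‖ₑ ^ 2 else 0 := fun x R =>
    Measurable.ite (measurableSet_lt measurable_norm measurable_const) (by fun_prop)
      measurable_const
  have b1 : ENNReal.ofReal (averageKernel κ m X (jap v) θ) *
      (∫⁻ y, if ‖y‖ < θ * X * jap v then ‖F (v + y) - F v‖ₑ ^ 2 else 0) ≤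
        averagedIncrement κ m X F v θ := by
    rw [← lintegral_const_mul _ (hset _ _)]
    refine lintegral_mono fun y => ?_
    by_cases hy : ‖y‖ < θ * X * jap v
    · rw [if_pos hy, if_pos (by linarith)]
    · rw [if_neg hy, mul_zero]; exact zero_le
  have b2 : ENNReal.ofReal (averageKernel κ m X (jap v) θ) *
      (∫⁻ y, if ‖y‖ < 2 * (θ * X * jap v) then ‖F (u + y) - F u‖ₑ ^ 2 else 0) ≤
        32 * averagedIncrement κ m X F u θ := by
    rw [← lintegral_const_mul _ (hset _ _), averagedIncrement,
      ← lintegral_const_mul' _ _ (by norm_num)]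
    refine lintegral_mono fun y => ?_
    by_cases hy : ‖y‖ < 2 * (θ * X * jap v)
    · rw [if_pos hy, if_pos (by nlinarith [mul_pos hθ hX]), ← mul_assoc]
      gcongr
      refine (ENNReal.ofReal_le_ofReal hk').trans ?_
      rw [ENNReal.ofReal_mul (by norm_num), ENNReal.ofReal_ofNat]
    · rw [if_neg hy, mul_zero]; exact zero_le
  have hcz : ENNReal.ofReal (averageKernel κ m X (jap v) θ) * ENNReal.ofReal ((θ * X * jap v) ^ 3) =
      ENNReal.ofReal c := by
    rw [hk, ← ENNReal.ofReal_mul (by positivity)]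
    congr 1
    field_simp
  rw [← hc]
  calc _ = ENNReal.ofReal (averageKernel κ m X (jap v) θ) * (ENNReal.ofReal ((θ * X * jap v) ^ 3) *
        volume (Metric.ball (0 : V) 1) * ‖F u - F v‖ₑ ^ 2) := by rw [← hcz]; ring
    _ ≤ 2 * (ENNReal.ofReal (averageKernel κ m X (jap v) θ) *
          (∫⁻ y, if ‖y‖ < θ * X * jap v then ‖F (v + y) - F v‖ₑ ^ 2 else 0)) +
        2 * (ENNReal.ofReal (averageKernel κ m X (jap v) θ) *
          (∫⁻ y, if ‖y‖ < 2 * (θ * X * jap v) then ‖F (u + y) - F u‖ₑ ^ 2 else 0)) := by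
        refine hav2.trans (le_of_eq (by ring))
    _ ≤ 2 * averagedIncrement κ m X F v θ + 2 * (32 * averagedIncrement κ m X F u θ) := by gcongr
    _ ≤ 64 * averagedIncrement κ m X F v θ + 2 * (32 * averagedIncrement κ m X F u θ) := by
        gcongr; norm_num
    _ = _ := by ring

/-! ### The estimate of the symmetrized factor -/

/-- The velocity `α` of a collision is comparable to `v` for near-grazing collisions. -/
def Comparable (w : V) (α : V × S2 → V) : Prop :=
  ∀ q : V × S2, deviation q.1 w q.2 * jap w ≤ 1 / 4 →
    jap (α q) ≤ 2 * jap q.1 ∧ jap q.1 ≤ 2 * jap (α q)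

lemma comparable_fst (w : V) : Comparable w Prod.fst := fun q _ => by
  have := jap_pos q.1
  constructor <;> linarith

lemma comparable_postVel (w : V) : Comparable w fun q => postVel q.1 w q.2 := fun _ h =>
  ⟨jap_postVel_le_of_near h, jap_le_postVel_of_near h⟩

/-- The coefficient of an increment as a product of a kernel to be integrated against `|a|²` and the
factor that goes to the averaged increments, with comparable brackets `J` and `J'`. -/
lemma le_lower_kernel_mul {κ m θ X J J' : ℝ} (hκ : 0 < κ) (hκm : κ < m) (hm1 : m < 1) (hθ : 0 < θ)
    (hX : 0 < X) (hJ : 0 < J) (hJ' : 0 < J') (h1 : J' ≤ 2 * J) (h2 : J ≤ 2 * J') :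
    θ * X * J ^ (-κ) ≤ 4 * (θ * X * J' ^ (-κ) * min 1 ((θ * X * J') ^ m)) *
      (1 + ((θ * X * J) ^ m)⁻¹) := by
  have a1 : J ^ (-κ) ≤ 2 * J' ^ (-κ) :=
    rpow_neg_le_two_mul hκ.le (by linarith) hJ' hJ h1
  obtain ⟨t, ht⟩ : ∃ t, t = (θ * X * J) ^ m := ⟨_, rfl⟩
  have ht0 : 0 < t := by rw [ht]; positivity
  have a2 : t ≤ 2 * (θ * X * J') ^ m := by
    rw [ht]
    calc (θ * X * J) ^ m ≤ (2 * (θ * X * J')) ^ m := by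
          refine Real.rpow_le_rpow (by positivity) ?_ (by linarith)
          nlinarith [mul_pos hθ hX]
      _ = 2 ^ m * (θ * X * J') ^ m := Real.mul_rpow (by norm_num) (by positivity)
      _ ≤ 2 ^ (1 : ℝ) * (θ * X * J') ^ m := by
          gcongr
          norm_num
      _ = _ := by rw [Real.rpow_one]
  have a3 : 1 ≤ 2 * min 1 ((θ * X * J') ^ m) * (1 + t⁻¹) := by
    have e1 : min 1 t ≤ 2 * min 1 ((θ * X * J') ^ m) := by
      rw [mul_min_of_nonneg _ _ (by norm_num)]
      exact le_min ((min_le_left _ _).trans (by norm_num)) ((min_le_right _ _).trans a2)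
    refine le_trans ?_ (mul_le_mul_of_nonneg_right e1 (by positivity))
    have e2 : 0 < t⁻¹ := by positivity
    rcases le_total t 1 with h | h
    · rw [min_eq_right h, mul_add, mul_inv_cancel₀ ht0.ne']; linarith
    · rw [min_eq_left h]; linarith
  rw [← ht]
  calc θ * X * J ^ (-κ) ≤ θ * X * (2 * J' ^ (-κ)) * 1 := by rw [mul_one]; gcongr
    _ ≤ θ * X * (2 * J' ^ (-κ)) * (2 * min 1 ((θ * X * J') ^ m) * (1 + t⁻¹)) := by gcongr
    _ = _ := by ring

/-- The coefficient `x ⟨v⟩^{-κ}` of an increment, `x = θ ⟨v_*⟩`, for near-grazing collisions. -/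
def nearCoeff (κ : ℝ) (w : V) (q : V × S2) : ℝ≥0∞ :=
  if deviation q.1 w q.2 * jap w ≤ 1 / 4 then
    ENNReal.ofReal (deviation q.1 w q.2 * jap w * jap q.1 ^ (-κ)) else 0

/-- First-order terms that multiply an increment of `F`. Where `θ ⟨v_*⟩ ⟨v⟩` is large the increment
is no better than `F` itself, where it is small the modulus of continuity gains a power of it; the
Cauchy-Schwarz inequality is applied with a kernel that interpolates between the two. -/
theorem IsAngularFactor.exists_lintegral_increment_le {s κ m : ℝ} {b : ℝ → ℝ}
    (hb : IsAngularFactor s b) (hκ : 0 < κ) (hκm : κ < m) (hm1 : m < 1) (hs : 2 * s ≤ 1 + κ) :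
    ∃ C : ℝ, 0 ≤ C ∧ ∀ (w : V) (α : V × S2 → V) (a : V → ℝ≥0∞) (F : V → ℂ) (N : ℝ≥0∞),
      DominatedMarginal b w α → Comparable w α → Measurable a → Measurable F →
      HasL2Modulus m F N →
      ∫⁻ q, nearCoeff κ w q * (a (α q) * ‖F (postVel q.1 w q.2) - F q.1‖ₑ) ∂collAt b w ≤
        ENNReal.ofReal (C * jap w ^ (1 + κ)) * (l2 a * N) := by
  obtain ⟨C₁, hC₁, h1⟩ := hb.exists_lintegral_lower_kernel_le hκ hκm hs
  obtain ⟨C₂, hC₂, h2⟩ := hb.exists_lintegral_averagedIncrement_le hκ hκm hs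
  obtain ⟨c, hc⟩ : ∃ c, c = 4 * ((volume (Metric.ball (0 : V) 1))⁻¹ * 64) := ⟨_, rfl⟩
  have hvol0 : volume (Metric.ball (0 : V) 1) ≠ 0 := (Metric.measure_ball_pos _ _ one_pos).ne'
  have hvolt : volume (Metric.ball (0 : V) 1) ≠ ∞ := measure_ball_lt_top.ne
  have hct : c ≠ ∞ := by rw [hc]; finiteness
  obtain ⟨D₁, hD₁⟩ : ∃ D₁, D₁ = ENNReal.ofReal (8 * Real.pi) * ENNReal.ofReal C₁ := ⟨_, rfl⟩
  obtain ⟨D₂, hD₂⟩ : ∃ D₂, D₂ = c * (2 * ENNReal.ofReal (8 * Real.pi)) * ENNReal.ofReal C₂ :=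
    ⟨_, rfl⟩
  have hD₁t : D₁ ≠ ∞ := by rw [hD₁]; finiteness
  have hD₂t : D₂ ≠ ∞ := by rw [hD₂]; finiteness
  refine ⟨(D₁ + D₂).toReal, ENNReal.toReal_nonneg, fun w α a F N hα hcomp ha hF hN => ?_⟩
  have hX := jap_pos w
  have hdm := measurable_deviation_left w
  have hjap := measurable_jap
  obtain ⟨k, hk⟩ : ∃ k : V → ℝ → ℝ≥0∞, k = fun u θ =>
    ENNReal.ofReal (θ * jap w * jap u ^ (-κ) * min 1 ((θ * jap w * jap u) ^ m)) * a u ^ 2 :=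
    ⟨_, rfl⟩
  have hkm : Measurable (Function.uncurry k) := by
    have : Measurable fun p : V × ℝ => ENNReal.ofReal (p.2 * jap w * jap p.1 ^ (-κ) *
      min 1 ((p.2 * jap w * jap p.1) ^ m)) * a p.1 ^ 2 := by fun_prop
    rw [hk]; exact this
  have hAm := measurable_averagedIncrement κ m (jap w) hF
  have hAv : Measurable fun q : V × S2 =>
      averagedIncrement κ m (jap w) F q.1 (deviation q.1 w q.2) :=
    hAm.comp (measurable_fst.prodMk hdm)
  have hAv' : Measurable fun q : V × S2 =>
      averagedIncrement κ m (jap w) F (postVel q.1 w q.2) (deviation q.1 w q.2) :=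
    hAm.comp ((measurable_postVel_left w).prodMk hdm)
  have hkq : Measurable fun q : V × S2 => k (α q) (deviation q.1 w q.2) :=
    hkm.comp (hα.1.prodMk hdm)
  have hpt : ∀ q : V × S2, (nearCoeff κ w q * (a (α q) * ‖F (postVel q.1 w q.2) - F q.1‖ₑ)) ^ 2 ≤
      k (α q) (deviation q.1 w q.2) *
        (c * (averagedIncrement κ m (jap w) F q.1 (deviation q.1 w q.2) +
          averagedIncrement κ m (jap w) F (postVel q.1 w q.2) (deviation q.1 w q.2))) := by
    intro q
    by_cases hnear : deviation q.1 w q.2 * jap w ≤ 1 / 4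
    swap
    · rw [nearCoeff, if_neg hnear]; simp
    rcases (deviation_nonneg q.1 w q.2).eq_or_lt with hθ | hθ
    · rw [nearCoeff, if_pos hnear, ← hθ]; simp
    have hJ := jap_pos q.1
    have hJ' := jap_pos (α q)
    have e1 := le_lower_kernel_mul hκ hκm hm1 hθ hX hJ hJ' (hcomp q hnear).1 (hcomp q hnear).2
    have e2 := enorm_sub_sq_le_averagedIncrement hκ hκm hm1 hF hnear hθ
    rw [nearCoeff, if_pos hnear, hk]
    simp only
    obtain ⟨θ, hθd⟩ : ∃ θ, θ = deviation q.1 w q.2 := ⟨_, rfl⟩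
    rw [← hθd] at e1 e2 hθ ⊢
    obtain ⟨k0, hk0⟩ : ∃ k0, k0 = θ * jap w * jap q.1 ^ (-κ) := ⟨_, rfl⟩
    obtain ⟨k1, hk1⟩ : ∃ k1, k1 = θ * jap w * jap (α q) ^ (-κ) *
      min 1 ((θ * jap w * jap (α q)) ^ m) := ⟨_, rfl⟩
    obtain ⟨φ, hφ⟩ : ∃ φ, φ = 1 + ((θ * jap w * jap q.1) ^ m)⁻¹ := ⟨_, rfl⟩
    rw [← hk0, ← hφ] at e1 e2
    rw [← hk1] at e1
    rw [← hk0, ← hk1]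
    have hk00 : 0 ≤ k0 := by rw [hk0]; positivity
    have hk10 : 0 ≤ k1 := by rw [hk1]; positivity
    -- The coefficient `k0` of the increment is split as `k0 ≤ 4 k1 φ`: one factor `k0` of its
    -- square pairs with `φ` and the increment, and the other one is replaced by `k1` and pairs with
    -- `a`.
    have e3 : ENNReal.ofReal k0 ^ 2 ≤ 4 * ENNReal.ofReal k1 * ENNReal.ofReal (k0 * φ) := by
      rw [← ENNReal.ofReal_pow hk00, ← ENNReal.ofReal_ofNat 4, ← ENNReal.ofReal_mul (by norm_num),
        ← ENNReal.ofReal_mul (by positivity)]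
      refine ENNReal.ofReal_le_ofReal ?_
      calc k0 ^ 2 = k0 * k0 := sq k0
        _ ≤ k0 * (4 * k1 * φ) := by gcongr
        _ = _ := by ring
    have e4 : ENNReal.ofReal (k0 * φ) * ‖F (postVel q.1 w q.2) - F q.1‖ₑ ^ 2 ≤
        (volume (Metric.ball (0 : V) 1))⁻¹ * (64 * (averagedIncrement κ m (jap w) F q.1 θ +
          averagedIncrement κ m (jap w) F (postVel q.1 w q.2) θ)) := by
      rw [← ENNReal.mul_le_iff_le_inv hvol0 hvolt]
      exact e2
    calc _ = ENNReal.ofReal k0 ^ 2 * (a (α q) ^ 2 * ‖F (postVel q.1 w q.2) - F q.1‖ₑ ^ 2) := by ring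
      _ ≤ 4 * ENNReal.ofReal k1 * ENNReal.ofReal (k0 * φ) *
          (a (α q) ^ 2 * ‖F (postVel q.1 w q.2) - F q.1‖ₑ ^ 2) := by gcongr
      _ = 4 * ENNReal.ofReal k1 * a (α q) ^ 2 *
          (ENNReal.ofReal (k0 * φ) * ‖F (postVel q.1 w q.2) - F q.1‖ₑ ^ 2) := by ring
      _ ≤ 4 * ENNReal.ofReal k1 * a (α q) ^ 2 * ((volume (Metric.ball (0 : V) 1))⁻¹ *
          (64 * (averagedIncrement κ m (jap w) F q.1 θ +
          averagedIncrement κ m (jap w) F (postVel q.1 w q.2) θ))) := by gcongr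
      _ = _ := by rw [hc]; ring
  have hI1 : ∫⁻ q, k (α q) (deviation q.1 w q.2) ∂collAt b w ≤
      D₁ * ENNReal.ofReal (jap w ^ (1 + κ)) * l2 a ^ 2 := by
    refine (hα.2 k hkm).trans ?_
    have e1 : ∀ u, ∫⁻ θ, k u θ ∂angMeasure b ≤
        ENNReal.ofReal C₁ * ENNReal.ofReal (jap w ^ (1 + κ)) * a u ^ 2 := fun u => by
      rw [hk, ← ENNReal.ofReal_mul hC₁]
      simp only
      rw [lintegral_mul_const _ (by fun_prop)]
      gcongr
      exact h1 (jap w) (jap u) hX (jap_pos u)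
    refine (mul_le_mul' le_rfl (lintegral_mono e1)).trans (le_of_eq ?_)
    rw [lintegral_const_mul _ (ha.pow_const 2), l2_sq, hD₁]
    ring
  have hI2 : ∫⁻ q, (c * (averagedIncrement κ m (jap w) F q.1 (deviation q.1 w q.2) +
          averagedIncrement κ m (jap w) F (postVel q.1 w q.2) (deviation q.1 w q.2))) ∂collAt b w ≤
      D₂ * ENNReal.ofReal (jap w ^ (1 + κ)) * N ^ 2 := by
    have hsum : Measurable fun q : V × S2 =>
        averagedIncrement κ m (jap w) F q.1 (deviation q.1 w q.2) +
          averagedIncrement κ m (jap w) F (postVel q.1 w q.2) (deviation q.1 w q.2) := hAv.add hAv'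
    rw [lintegral_const_mul _ hsum, lintegral_add_left hAv]
    have h3 := h2 (jap w) hX F N hF hN
    rw [ENNReal.ofReal_mul hC₂] at h3
    have h4 := ((dominatedMarginal_fst hb.measurable w).2 _ hAm).trans (mul_le_mul' le_rfl h3)
    have h5 := ((dominatedMarginal_postVel hb.measurable hb.eq_zero_of_neg w).2 _ hAm).trans
      (mul_le_mul' le_rfl h3)
    refine (mul_le_mul' le_rfl (add_le_add h4 h5)).trans (le_of_eq ?_)
    rw [hD₂]; ring
  refine le_of_sq_le_sq ?_
  refine (sq_lintegral_le_of_sq_le hkq.aemeasurable ((hAv.add hAv').const_mul c).aemeasurable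
    (ae_of_all _ hpt)).trans ((mul_le_mul' hI1 hI2).trans ?_)
  rw [ENNReal.ofReal_mul ENNReal.toReal_nonneg, ENNReal.ofReal_toReal (by finiteness)]
  calc _ = D₁ * D₂ * (ENNReal.ofReal (jap w ^ (1 + κ)) * (l2 a * N)) ^ 2 := by ring
    _ ≤ (D₁ + D₂) * (D₁ + D₂) * (ENNReal.ofReal (jap w ^ (1 + κ)) * (l2 a * N)) ^ 2 := by
        gcongr
        · exact le_self_add
        · exact le_add_self
    _ = _ := by ring

/-- The coefficient `x²` for near-grazing collisions and `x` for the others, `x = θ ⟨v_*⟩`. -/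
def remainderCoeff (X θ : ℝ) : ℝ≥0∞ :=
  if θ * X ≤ 1 / 4 then ENNReal.ofReal ((θ * X) ^ 2) else ENNReal.ofReal (θ * X)

lemma measurable_remainderCoeff (X : ℝ) : Measurable (remainderCoeff X) :=
  Measurable.ite (measurableSet_le (by fun_prop) measurable_const) (by fun_prop) (by fun_prop)

/-- Second-order terms converge at `θ = 0` because `2 > 2s`, and the angles beyond `1 / (4 X)`
contribute the same power of `X`. -/
lemma IsAngularFactor.exists_lintegral_remainderCoeff_le {s κ : ℝ} {b : ℝ → ℝ}
    (hb : IsAngularFactor s b) (hκ : 0 < κ) (hκ1 : κ < 1) (hs : 2 * s ≤ 1 + κ) :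
    ∃ C : ℝ, 0 ≤ C ∧ ∀ X : ℝ, 0 < X →
      ∫⁻ θ, remainderCoeff X θ ∂angMeasure b ≤ ENNReal.ofReal (C * X ^ (1 + κ)) := by
  obtain ⟨C₁, hC₁, h1⟩ := hb.exists_lintegral_le_small (r := 1 + κ) (p := 2) hs (by linarith)
  obtain ⟨C₂, hC₂, h2⟩ := hb.exists_lintegral_le_large (r := 1 + κ) (p := 1) hs (by linarith)
  refine ⟨C₁ * 4 ^ (κ - 1) + C₂ * 4 ^ κ, by positivity, fun X hX => ?_⟩
  -- The angle that separates the two cases of `remainderCoeff`.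
  obtain ⟨t, htd⟩ : ∃ t, t = (4 * X)⁻¹ := ⟨_, rfl⟩
  have ht : 0 < t := by rw [htd]; positivity
  have hiff : ∀ θ : ℝ, θ * X ≤ 1 / 4 ↔ θ ≤ t := fun θ => by
    rw [htd, inv_eq_one_div, le_div_iff₀ (by norm_num), le_div_iff₀ (by positivity)]
    constructor <;> intro h <;> linarith
  calc _ ≤ ∫⁻ θ, (ENNReal.ofReal (X ^ 2) * (if θ ≤ t then ENNReal.ofReal (θ ^ (2 : ℝ)) else 0) +
          ENNReal.ofReal X * (if t ≤ θ then ENNReal.ofReal (θ ^ (1 : ℝ)) else 0))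
            ∂angMeasure b := by
        refine lintegral_angMeasure_mono fun θ hθ => ?_
        rw [remainderCoeff]
        simp only [hiff]
        by_cases hle : θ ≤ t
        · refine le_add_right ?_
          rw [if_pos hle, if_pos hle, ← ENNReal.ofReal_mul (by positivity), Real.rpow_two, mul_pow,
            mul_comm]
        · refine le_add_left ?_
          rw [if_neg hle, if_pos (le_of_not_ge hle), ← ENNReal.ofReal_mul (by positivity),
            Real.rpow_one, mul_comm]
    _ ≤ ENNReal.ofReal (X ^ 2) * ENNReal.ofReal (C₁ * t ^ (2 - (1 + κ))) +
          ENNReal.ofReal X * ENNReal.ofReal (C₂ * t ^ (1 - (1 + κ))) := by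
        rw [lintegral_add_left ((measurable_ite_le_rpow _ _).const_mul _),
          lintegral_const_mul _ (measurable_ite_le_rpow _ _),
          lintegral_const_mul _ (measurable_ite_ge_rpow _ _)]
        gcongr
        · exact h1 t ht
        · exact h2 t ht
    _ = _ := by
        rw [← ENNReal.ofReal_mul (by positivity), ← ENNReal.ofReal_mul (by positivity),
          ← ENNReal.ofReal_add (by positivity) (by positivity)]
        congr 1
        have e1 : t ^ (2 - (1 + κ)) = 4 ^ (κ - 1) * X ^ (κ - 1) := by
          rw [htd, Real.inv_rpow (by positivity), ← Real.rpow_neg (by positivity),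
            Real.mul_rpow (by norm_num) hX.le]
          congr 2 <;> ring
        have e2 : t ^ (1 - (1 + κ)) = 4 ^ κ * X ^ κ := by
          rw [htd, Real.inv_rpow (by positivity), ← Real.rpow_neg (by positivity),
            Real.mul_rpow (by norm_num) hX.le]
          congr 2 <;> ring
        have e3 : X ^ (1 + κ) = X ^ 2 * X ^ (κ - 1) := by
          rw [← Real.rpow_natCast, ← Real.rpow_add hX]; congr 1; push_cast; ring
        have e4 : X ^ (1 + κ) = X * X ^ κ := by rw [Real.rpow_add hX, Real.rpow_one]
        rw [e1, e2, add_mul]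
        congr 1
        · rw [e3]; ring
        · rw [e4]; ring

/-- What remains of the kernel after symmetrization: the second-order terms and the collisions that
are not near-grazing, and the first-order terms with an increment of `U`. -/
def symmFactor (κ : ℝ) (U : V → ℂ) (w : V) (q : V × S2) : ℝ≥0∞ :=
  remainderCoeff (jap w) (deviation q.1 w q.2) * (‖U q.1‖ₑ + ‖U (postVel q.1 w q.2)‖ₑ) +
    nearCoeff κ w q * ‖U (postVel q.1 w q.2) - U q.1‖ₑ

theorem IsAngularFactor.exists_lintegral_symmFactor_le {s κ m : ℝ} {b : ℝ → ℝ}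
    (hb : IsAngularFactor s b) (hκ : 0 < κ) (hκm : κ < m) (hm1 : m < 1) (hs : 2 * s ≤ 1 + κ) :
    ∃ C : ℝ, 0 ≤ C ∧ ∀ (w : V) (α : V × S2 → V) (a : V → ℝ≥0∞) (U : V → ℂ) (N : ℝ≥0∞),
      DominatedMarginal b w α → Comparable w α → Measurable a → Measurable U →
      l2 (fun v => ‖U v‖ₑ) ≤ N → HasL2Modulus m U N →
      ∫⁻ q, a (α q) * symmFactor κ U w q ∂collAt b w ≤
        ENNReal.ofReal (C * jap w ^ (1 + κ)) * (l2 a * N) := by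
  obtain ⟨C₁, hC₁, h1⟩ := hb.exists_lintegral_increment_le hκ hκm hm1 hs
  obtain ⟨C₂, hC₂, h2⟩ := hb.exists_lintegral_remainderCoeff_le hκ (hκm.trans hm1) hs
  refine ⟨C₁ + 2 * (8 * Real.pi) * C₂, by positivity, fun w α a U N hα hcomp ha hU hUN hN => ?_⟩
  have hX := jap_pos w
  have hdm := measurable_deviation_left w
  have hpv := measurable_postVel_left w
  have hUm : Measurable fun v => ‖U v‖ₑ := hU.enorm
  have hr := measurable_remainderCoeff (jap w)
  have hrq : Measurable fun q : V × S2 => remainderCoeff (jap w) (deviation q.1 w q.2) :=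
    hr.comp hdm
  have haq : Measurable fun q => a (α q) := ha.comp hα.1
  have hU1 : Measurable fun q : V × S2 => ‖U q.1‖ₑ := hUm.comp measurable_fst
  have hU2 : Measurable fun q : V × S2 => ‖U (postVel q.1 w q.2)‖ₑ := hUm.comp hpv
  have e : ∀ q : V × S2, a (α q) * symmFactor κ U w q =
      (remainderCoeff (jap w) (deviation q.1 w q.2) * (a (α q) * ‖U q.1‖ₑ) +
        remainderCoeff (jap w) (deviation q.1 w q.2) * (a (α q) * ‖U (postVel q.1 w q.2)‖ₑ)) +
        nearCoeff κ w q * (a (α q) * ‖U (postVel q.1 w q.2) - U q.1‖ₑ) := fun q => by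
    rw [symmFactor]; ring
  have m1 : Measurable fun q : V × S2 =>
      remainderCoeff (jap w) (deviation q.1 w q.2) * (a (α q) * ‖U q.1‖ₑ) := hrq.mul (haq.mul hU1)
  have m2 : Measurable fun q : V × S2 => remainderCoeff (jap w) (deviation q.1 w q.2) *
      (a (α q) * ‖U (postVel q.1 w q.2)‖ₑ) := hrq.mul (haq.mul hU2)
  have m12 : Measurable fun q : V × S2 =>
      remainderCoeff (jap w) (deviation q.1 w q.2) * (a (α q) * ‖U q.1‖ₑ) +
      remainderCoeff (jap w) (deviation q.1 w q.2) * (a (α q) * ‖U (postVel q.1 w q.2)‖ₑ) :=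
    m1.add m2
  simp only [e]
  rw [lintegral_add_left m12, lintegral_add_left m1]
  have b1 := hα.lintegral_mul_le (dominatedMarginal_fst hb.measurable w) hr ha hUm
  have b2 := hα.lintegral_mul_le (dominatedMarginal_postVel hb.measurable hb.eq_zero_of_neg w)
    hr ha hUm
  have b3 := h1 w α a U N hα hcomp ha hU hN
  have b4 := h2 (jap w) hX
  calc _ ≤ (ENNReal.ofReal (8 * Real.pi) * ENNReal.ofReal (C₂ * jap w ^ (1 + κ)) * (l2 a * N) +
        ENNReal.ofReal (8 * Real.pi) * ENNReal.ofReal (C₂ * jap w ^ (1 + κ)) * (l2 a * N)) +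
        ENNReal.ofReal (C₁ * jap w ^ (1 + κ)) * (l2 a * N) := by
        refine add_le_add (add_le_add (b1.trans ?_) (b2.trans ?_)) b3 <;> gcongr
    _ = _ := by
        rw [← ENNReal.ofReal_mul (by positivity), ← add_mul, ← add_mul,
          ← ENNReal.ofReal_add (by positivity) (by positivity),
          ← ENNReal.ofReal_add (by positivity) (by positivity)]
        congr 2
        ring

/-! ### First-order bounds of the kernel -/

lemma norm_weighted (l : ℝ) (g : V → ℂ) (v : V) : ‖weighted l g v‖ = jap v ^ l * ‖g v‖ := by
  rw [weighted, norm_mul, Complex.norm_real, Real.norm_of_nonneg (weight_pos l v).le, weight_eq]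

lemma norm_weighted_le {l m : ℝ} (h : l ≤ m) (g : V → ℂ) (v : V) :
    ‖weighted l g v‖ ≤ ‖weighted m g v‖ := by
  rw [norm_weighted, norm_weighted]
  gcongr
  exact one_le_jap v

lemma enorm_weighted_le {l m : ℝ} (h : l ≤ m) (g : V → ℂ) (v : V) :
    ‖weighted l g v‖ₑ ≤ ‖weighted m g v‖ₑ := by
  rw [← ofReal_norm, ← ofReal_norm]
  exact ENNReal.ofReal_le_ofReal (norm_weighted_le h g v)

lemma weighted_zero (g : V → ℂ) : weighted 0 g = g := by
  ext v; simp [weighted, weight]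

lemma weighted_weighted (l m : ℝ) (g : V → ℂ) : weighted l (weighted m g) = weighted (l + m) g := by
  ext v
  rw [weighted, weighted, weighted, ← mul_assoc, ← Complex.ofReal_mul, weight_mul]

lemma measurable_weighted {l : ℝ} {g : V → ℂ} (hg : Measurable g) : Measurable (weighted l g) := by
  have := measurable_weight l
  unfold weighted
  fun_prop

lemma norm_kern {γ l : ℝ} {b : ℝ → ℝ} (hb : ∀ x, 0 ≤ b x) (f g h : V → ℂ) (v w : V) (σ : S2) :
    ‖kern γ b l f g h (v, w, σ)‖ = b (Real.cos (deviation v w σ)) * ((1 + ‖v - w‖ ^ 2) ^ (γ / 2) *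
      ‖f w‖ * ‖g v‖ * ‖h (postVel v w σ)‖ * |weight l (postVel v w σ) - weight l v|) := by
  have e : ‖(crossSection γ b v w σ : ℂ)‖ =
      (1 + ‖v - w‖ ^ 2) ^ (γ / 2) * b (Real.cos (deviation v w σ)) := by
    rw [Complex.norm_real, crossSection, Real.norm_of_nonneg (mul_nonneg (by positivity) (hb _))]
  simp only [kern]
  rw [norm_mul, e, norm_mul, norm_mul, norm_mul, RCLike.norm_conj, Complex.norm_real,
    Real.norm_eq_abs]
  ring

/-- Beyond `θ = π / 2` the angular factor vanishes. -/
lemma kern_eq_zero {γ l : ℝ} {b : ℝ → ℝ} (hb0 : ∀ x, x < 0 → b x = 0) (f g h : V → ℂ) {v w : V}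
    {σ : S2} (hd : Real.pi / 2 < deviation v w σ) : kern γ b l f g h (v, w, σ) = 0 := by
  have h1 : b (Real.cos (deviation v w σ)) = 0 := hb0 _ <| by
    refine Real.cos_neg_of_pi_div_two_lt_of_lt hd ?_
    have := InnerProductGeometry.angle_le_pi (v - w) (σ : V)
    unfold deviation
    linarith [Real.pi_pos]
  simp [kern, crossSection, h1]

/-- The kernel bound that uses only the first-order smallness of the weight difference. -/
lemma norm_kern_le (γ : ℝ) (l : ℕ) {b : ℝ → ℝ} (hb : ∀ x, 0 ≤ b x) (f g h : V → ℂ)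
    {v w : V} {σ : S2} (hd : deviation v w σ ≤ Real.pi / 2) :
    ‖kern γ b l f g h (v, w, σ)‖ ≤ b (Real.cos (deviation v w σ)) *
      (2 ^ max γ 0 * (l * 3 ^ l) * ‖weighted (l + max γ 0) f w‖ * (deviation v w σ *
        (‖weighted (l + max γ 0) g v‖ * ‖h (postVel v w σ)‖))) := by
  rw [norm_kern hb, norm_weighted, norm_weighted, Real.rpow_add (jap_pos v),
    Real.rpow_add (jap_pos w), Real.rpow_natCast, Real.rpow_natCast]
  have h1 := kinetic_le γ v w
  have h2 := abs_weight_sub_le l hd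
  have h3 := jap_pos v
  have h4 := jap_pos w
  have h5 := deviation_nonneg v w σ
  refine mul_le_mul_of_nonneg_left ?_ (hb _)
  calc _ ≤ 2 ^ max γ 0 * (jap v ^ max γ 0 * jap w ^ max γ 0) * ‖f w‖ * ‖g v‖ *
        ‖h (postVel v w σ)‖ * (l * 3 ^ l * (jap v ^ l * jap w ^ l * deviation v w σ)) := by gcongr
    _ = _ := by ring

lemma enorm_kern_le (γ : ℝ) (l : ℕ) {b : ℝ → ℝ} (hb : ∀ x, 0 ≤ b x) (hb0 : ∀ x, x < 0 → b x = 0)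
    (f g h : V → ℂ) (v w : V) (σ : S2) :
    ‖kern γ b l f g h (v, w, σ)‖ₑ ≤ angFactor b v w σ *
      (ENNReal.ofReal (2 ^ max γ 0 * (l * 3 ^ l)) * ‖weighted (l + max γ 0) f w‖ₑ *
        (ENNReal.ofReal (deviation v w σ) *
          (‖weighted (l + max γ 0) g v‖ₑ * ‖h (postVel v w σ)‖ₑ))) := by
  rcases lt_or_ge (Real.pi / 2) (deviation v w σ) with hd | hd
  · rw [kern_eq_zero hb0 f g h hd, enorm_zero]; exact zero_le
  have h1 := ENNReal.ofReal_le_ofReal (norm_kern_le γ l hb f g h hd)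
  have h5 := deviation_nonneg v w σ
  rw [ofReal_norm, ENNReal.ofReal_mul (hb _), ENNReal.ofReal_mul (by positivity),
    ENNReal.ofReal_mul (by positivity), ENNReal.ofReal_mul h5, ENNReal.ofReal_mul (norm_nonneg _),
    ofReal_norm, ofReal_norm, ofReal_norm] at h1
  exact h1

/-- A function of `v_*` times a function of `θ` times functions of `v` and `v'`. -/
lemma lintegral_angFactor_mul_le {s : ℝ} {b : ℝ → ℝ} (hb : IsAngularFactor s b) {ω : ℝ → ℝ≥0∞}
    (hω : Measurable ω) {φ a c : V → ℝ≥0∞} (hφ : Measurable φ) (ha : Measurable a)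
    (hc : Measurable c) :
    ∫⁻ p : V × V × S2, angFactor b p.1 p.2.1 p.2.2 * (φ p.2.1 *
      (ω (deviation p.1 p.2.1 p.2.2) * (a p.1 * c (postVel p.1 p.2.1 p.2.2)))) ∂collMeasure ≤
      ENNReal.ofReal (8 * Real.pi) * (∫⁻ θ, ω θ ∂angMeasure b) * (∫⁻ w, φ w) * (l2 a * l2 c) := by
  have h1 : Measurable fun p : V × V × S2 => ω (deviation p.1 p.2.1 p.2.2) :=
    hω.comp measurable_deviation
  have h2 : Measurable fun p : V × V × S2 => a p.1 := ha.comp measurable_fst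
  have h3 : Measurable fun p : V × V × S2 => φ p.2.1 :=
    hφ.comp (measurable_fst.comp measurable_snd)
  have h4 : Measurable fun p : V × V × S2 => c (postVel p.1 p.2.1 p.2.2) :=
    hc.comp measurable_postVel
  have h5 : Measurable fun p : V × V × S2 => ω (deviation p.1 p.2.1 p.2.2) *
    (a p.1 * c (postVel p.1 p.2.1 p.2.2)) := h1.mul (h2.mul h4)
  calc _ = _ := lintegral_collMeasure_angFactor hb.measurable (h3.mul h5)
    _ ≤ ∫⁻ w, φ w * (ENNReal.ofReal (8 * Real.pi) * (∫⁻ θ, ω θ ∂angMeasure b) *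
        (l2 a * l2 c)) := by
        refine lintegral_mono fun w => ?_
        have h6 := measurable_insert h5 w
        simp only [Pi.mul_apply]
        rw [lintegral_const_mul _ h6]
        gcongr
        exact (dominatedMarginal_fst hb.measurable w).lintegral_mul_le
          (dominatedMarginal_postVel hb.measurable hb.eq_zero_of_neg w) hω ha hc
    _ = _ := by
        rw [lintegral_mul_const _ hφ]
        ring

lemma lintegral_enorm_kern_le (γ : ℝ) (l : ℕ) {s : ℝ} {b : ℝ → ℝ} (hb : IsAngularFactor s b)
    {ω : ℝ → ℝ≥0∞} (hω : Measurable ω) {f g h : V → ℂ} (hf : Measurable f) (hg : Measurable g)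
    (hh : Measurable h) :
    ∫⁻ p : V × V × S2, ω (deviation p.1 p.2.1 p.2.2) * ‖kern γ b l f g h p‖ₑ ∂collMeasure ≤
      ENNReal.ofReal (2 ^ max γ 0 * (l * 3 ^ l)) * (ENNReal.ofReal (8 * Real.pi) *
        ∫⁻ θ, ω θ * ENNReal.ofReal θ ∂angMeasure b) * (∫⁻ w, ‖weighted (l + max γ 0) f w‖ₑ) *
          (l2 (fun v => ‖weighted (l + max γ 0) g v‖ₑ) * l2 fun v => ‖h v‖ₑ) := by
  have hfm : Measurable fun v => ‖weighted (l + max γ 0) f v‖ₑ := (measurable_weighted hf).enorm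
  have hgm : Measurable fun v => ‖weighted (l + max γ 0) g v‖ₑ := (measurable_weighted hg).enorm
  obtain ⟨c, hc⟩ : ∃ c, c = ENNReal.ofReal (2 ^ max γ 0 * (l * 3 ^ l)) := ⟨_, rfl⟩
  have h1 := lintegral_angFactor_mul_le hb (ω := fun θ => ω θ * ENNReal.ofReal θ)
    (hω.mul ENNReal.measurable_ofReal) (hfm.const_mul c) hgm hh.enorm
  refine le_trans (lintegral_mono fun p => ?_) (h1.trans (le_of_eq ?_))
  · refine (mul_le_mul' le_rfl
      (enorm_kern_le γ l hb.nonneg hb.eq_zero_of_neg f g h p.1 p.2.1 p.2.2)).trans (le_of_eq ?_)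
    rw [hc]; ring
  · rw [lintegral_const_mul _ hfm, hc]
    ring

lemma IsAngularFactor.lintegral_rpow_lt_top {s : ℝ} {b : ℝ → ℝ} (hb : IsAngularFactor s b) {p : ℝ}
    (hp : 2 * s < p) : ∫⁻ θ, ENNReal.ofReal (θ ^ p) ∂angMeasure b < ∞ := by
  obtain ⟨C, hC, h⟩ := hb.exists_lintegral_le_small le_rfl hp
  refine lt_of_le_of_lt ?_ (ENNReal.ofReal_lt_top (r := C * Real.pi ^ (p - 2 * s)))
  refine le_trans (lintegral_mono_ae ?_) (h Real.pi Real.pi_pos)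
  refine (withDensity_absolutelyContinuous _ _).ae_le ?_
  filter_upwards [ae_restrict_mem measurableSet_Ioo] with θ hθ
  rw [if_pos hθ.2.le]

lemma lintegral_weighted_le {l m : ℝ} (h : l ≤ m) (f : V → ℂ) :
    ∫⁻ w, ‖weighted l f w‖ₑ ≤ ∫⁻ w, ‖weighted m f w‖ₑ :=
  lintegral_mono fun w => enorm_weighted_le h f w

lemma l2_mono {a c : V → ℝ≥0∞} (h : ∀ v, a v ≤ c v) : l2 a ≤ l2 c := by
  unfold l2
  gcongr
  exact h _

/-- Away from grazing collisions any first-order bound is integrable. -/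
lemma integrable_truncKern (γ : ℝ) (l : ℕ) {s δ : ℝ} {b : ℝ → ℝ} (hb : IsAngularFactor s b)
    (hδ : 0 < δ) {f g h : V → ℂ} (hf : Measurable f) (hg : Measurable g) (hh : Measurable h)
    (hf1 : ∫⁻ w, ‖weighted (l + max γ 0) f w‖ₑ < ∞)
    (hg2 : l2 (fun v => ‖weighted (l + max γ 0) g v‖ₑ) < ∞) (hh2 : l2 (fun v => ‖h v‖ₑ) < ∞) :
    Integrable (truncKern γ b l δ f g h) collMeasure := by
  classical
  refine ⟨(measurable_truncKern hb.measurable hf hg hh).aestronglyMeasurable, ?_⟩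
  have hω : Measurable fun θ : ℝ => if δ ≤ θ then (1 : ℝ≥0∞) else 0 :=
    Measurable.ite measurableSet_Ici measurable_const measurable_const
  have h1 := lintegral_enorm_kern_le γ l hb hω hf hg hh
  have h2 : ∫⁻ θ, (if δ ≤ θ then (1 : ℝ≥0∞) else 0) * ENNReal.ofReal θ ∂angMeasure b < ∞ := by
    have h3 := hb.lintegral_away_lt_top hδ
    have h4 := ENNReal.mul_lt_top h3 (ENNReal.ofReal_lt_top (r := Real.pi))
    rw [← lintegral_mul_const _ hω] at h4
    refine lt_of_le_of_lt (lintegral_mono_ae ?_) h4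
    refine (withDensity_absolutelyContinuous _ _).ae_le ?_
    filter_upwards [ae_restrict_mem measurableSet_Ioo] with θ hθ
    gcongr
    exact hθ.2.le
  refine lt_of_le_of_lt (lintegral_mono fun p => ?_) (h1.trans_lt (by finiteness))
  rw [truncKern]
  split_ifs <;> simp

/-- The estimate for `s < 1 / 2` with `f` in a weighted `L¹` space, on a measurable
representative. -/
lemma lintegral_enorm_kern_le_of_lt_half (γ : ℝ) (l : ℕ) {s : ℝ} {b : ℝ → ℝ}
    (hb : IsAngularFactor s b) (hs : s < 1 / 2) : ∃ C : ℝ, 0 ≤ C ∧ ∀ f g h : V → ℂ,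
      Measurable f → Measurable g → Measurable h →
      ∫⁻ p : V × V × S2, ‖kern γ b l f g h p‖ₑ ∂collMeasure ≤
        ENNReal.ofReal C * (∫⁻ w, ‖weighted (l + max γ 0) f w‖ₑ) *
          (l2 (fun v => ‖weighted (l + max γ 0) g v‖ₑ) * l2 fun v => ‖h v‖ₑ) := by
  have h1 := hb.lintegral_rpow_lt_top (p := 1) (by linarith)
  simp only [Real.rpow_one] at h1
  obtain ⟨D, hD⟩ : ∃ D, D = ENNReal.ofReal (2 ^ max γ 0 * (l * 3 ^ l)) *
      (ENNReal.ofReal (8 * Real.pi) * ∫⁻ θ, ENNReal.ofReal θ ∂angMeasure b) := ⟨_, rfl⟩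
  have hDt : D ≠ ∞ := by rw [hD]; finiteness
  refine ⟨D.toReal, ENNReal.toReal_nonneg, fun f g h hf hg hh => ?_⟩
  have h2 := lintegral_enorm_kern_le γ l hb (measurable_const (a := (1 : ℝ≥0∞))) hf hg hh
  simp only [one_mul] at h2
  rwa [ENNReal.ofReal_toReal hDt, hD]

/-! ### Symmetrization by the half turn -/

/-- The real number `symmFactor`, as a function of `v`, `v'` and `x = θ ⟨v_*⟩`. -/
def symmBound (κ : ℝ) (U : V → ℂ) (v v' : V) (x : ℝ) : ℝ :=
  if x ≤ 1 / 4 then x ^ 2 * (‖U v‖ + ‖U v'‖) + x * jap v ^ (-κ) * ‖U v' - U v‖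
  else x * (‖U v‖ + ‖U v'‖)

lemma symmBound_nonneg (κ : ℝ) (U : V → ℂ) (v v' : V) {x : ℝ} (hx : 0 ≤ x) :
    0 ≤ symmBound κ U v v' x := by
  have := jap_pos v
  unfold symmBound
  split_ifs <;> positivity

lemma symmFactor_eq (κ : ℝ) (U : V → ℂ) (w : V) (q : V × S2) :
    symmFactor κ U w q = ENNReal.ofReal
      (symmBound κ U q.1 (postVel q.1 w q.2) (deviation q.1 w q.2 * jap w)) := by
  have h1 := jap_pos q.1
  have h2 := jap_pos w
  have h3 := deviation_nonneg q.1 w q.2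
  rw [symmFactor, symmBound, remainderCoeff, nearCoeff]
  split_ifs
  · rw [ENNReal.ofReal_add (by positivity) (by positivity),
      ENNReal.ofReal_mul (p := (deviation q.1 w q.2 * jap w) ^ 2) (by positivity),
      ENNReal.ofReal_mul (p := deviation q.1 w q.2 * jap w * jap q.1 ^ (-κ)) (by positivity),
      ENNReal.ofReal_add (norm_nonneg _) (norm_nonneg _), ofReal_norm, ofReal_norm, ofReal_norm]
  · rw [ENNReal.ofReal_mul (p := deviation q.1 w q.2 * jap w)
        (q := ‖U q.1‖ + ‖U (postVel q.1 w q.2)‖) (by positivity),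
      ENNReal.ofReal_add (norm_nonneg _) (norm_nonneg _), ofReal_norm, ofReal_norm, zero_mul,
      add_zero]

/-- The increment of a product with a weight whose differences are of first order in `x`. -/
lemma norm_weighted_sub_le {e c x : ℝ} (U : V → ℂ) {v₀ v₁ : V}
    (h : |weight e v₁ - weight e v₀| ≤ c * (x * weight e v₀)) :
    ‖weighted e U v₁ - weighted e U v₀‖ ≤ weight e v₀ * (‖U v₁ - U v₀‖ + c * x * ‖U v₁‖) := by
  have e1 : weighted e U v₁ - weighted e U v₀ =
      (weight e v₀ : ℂ) * (U v₁ - U v₀) + ((weight e v₁ - weight e v₀ : ℝ) : ℂ) * U v₁ := by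
    rw [weighted, weighted]; push_cast; ring
  rw [e1]
  refine (norm_add_le _ _).trans ?_
  rw [norm_mul, norm_mul, Complex.norm_real, Complex.norm_real,
    Real.norm_of_nonneg (weight_pos e v₀).le, Real.norm_eq_abs]
  calc _ ≤ weight e v₀ * ‖U v₁ - U v₀‖ + c * (x * weight e v₀) * ‖U v₁‖ := by gcongr
    _ = _ := by ring

/-- The three parts of a symmetrized kernel, of second order (`D₀`) and of first order times an
increment (`D₁`, `D₂`), added up. -/
lemma near_sum_le {D₀ D₁ D₂ P c₁ c₂ c₃ x m₀ m₁ m₂ δ₁ δ₂ : ℝ} (hP : 0 ≤ P) (hc₁ : 0 ≤ c₁)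
    (hc₂ : 0 ≤ c₂) (hc₃ : 0 ≤ c₃) (hx : 0 ≤ x) (hm₀ : 0 ≤ m₀) (hm₁ : 0 ≤ m₁) (hm₂ : 0 ≤ m₂)
    (hδ₁ : 0 ≤ δ₁) (hδ₂ : 0 ≤ δ₂) (h₀ : D₀ ≤ P * c₁ * x ^ 2 * m₀)
    (h₁ : D₁ ≤ P * c₂ * (x * (δ₁ + c₃ * x * m₁))) (h₂ : D₂ ≤ P * c₂ * (x * (δ₂ + c₃ * x * m₂))) :
    D₀ + D₁ + D₂ ≤ P * (c₁ + c₂ * (1 + c₃)) *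
      ((x ^ 2 * (m₀ + m₁) + x * δ₁) + (x ^ 2 * (m₀ + m₂) + x * δ₂)) := by
  have e : P * (c₁ + c₂ * (1 + c₃)) *
      ((x ^ 2 * (m₀ + m₁) + x * δ₁) + (x ^ 2 * (m₀ + m₂) + x * δ₂)) -
      (P * c₁ * x ^ 2 * m₀ + P * c₂ * (x * (δ₁ + c₃ * x * m₁)) +
        P * c₂ * (x * (δ₂ + c₃ * x * m₂))) =
      P * c₁ * x ^ 2 * (m₀ + m₁ + m₂) + P * c₁ * x * (δ₁ + δ₂) +
      P * c₂ * x ^ 2 * (2 * m₀ + m₁ + m₂) + P * c₂ * c₃ * x ^ 2 * (2 * m₀) +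
        P * c₂ * c₃ * x * (δ₁ + δ₂) := by ring
  have p : 0 ≤ P * c₁ * x ^ 2 * (m₀ + m₁ + m₂) + P * c₁ * x * (δ₁ + δ₂) +
      P * c₂ * x ^ 2 * (2 * m₀ + m₁ + m₂) + P * c₂ * c₃ * x ^ 2 * (2 * m₀) +
        P * c₂ * c₃ * x * (δ₁ + δ₂) := by positivity
  linarith

lemma natCast_mul_le_mul_rpow (l : ℕ) {X : ℝ} (hX : 1 ≤ X) : (l : ℝ) ≤ l * X ^ ((l : ℝ) - 1) := by
  rcases l.eq_zero_or_pos with rfl | hl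
  · simp
  · have : (1 : ℝ) ≤ l := by exact_mod_cast hl
    exact le_mul_of_one_le_right (by positivity) (Real.one_le_rpow hX (by linarith))

lemma pow_mul_eq_rpow_sub_one_mul (l : ℕ) {X : ℝ} (hX : 0 < X) (θ : ℝ) :
    X ^ l * θ = X ^ ((l : ℝ) - 1) * (θ * X) := by
  rw [← Real.rpow_natCast, Real.rpow_sub_one hX.ne']
  field_simp

/-- The part of the collisions that are not near-grazing. -/
lemma norm_kern_le_of_far (γ : ℝ) (l : ℕ) {b : ℝ → ℝ} (hb : ∀ x, 0 ≤ b x) (f g h : V → ℂ) {v w : V}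
    {σ : S2} (hd : deviation v w σ ≤ Real.pi / 2) :
    ‖kern γ b l f g h (v, w, σ)‖ ≤ b (Real.cos (deviation v w σ)) *
      (2 ^ max γ 0 * (l * 3 ^ l) * (jap w ^ ((l : ℝ) - 1 + max γ 0) * ‖f w‖) *
        (‖weighted (l + max γ 0) g v‖ * ‖h (postVel v w σ)‖ * (deviation v w σ * jap w))) := by
  refine (norm_kern_le γ l hb f g h hd).trans (le_of_eq ?_)
  have h1 := jap_pos w
  rw [norm_weighted (l + max γ 0) f, Real.rpow_add h1, Real.rpow_add h1, Real.rpow_natCast]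
  have h2 := pow_mul_eq_rpow_sub_one_mul l h1 (deviation v w σ)
  linear_combination b (Real.cos (deviation v w σ)) * (2 ^ max γ 0 * (l * 3 ^ l)) *
    jap w ^ max γ 0 * ‖f w‖ * ‖weighted (l + max γ 0) g v‖ * ‖h (postVel v w σ)‖ * h2

/-- Symmetrization by the half turn about `v - v_*`: the increments fall on `W_l h`. -/
lemma exists_norm_kern_add_turnPost_le (γ : ℝ) (l : ℕ) {κ κ' : ℝ} (hκ' : 0 < κ') (hκ : κ' ≤ κ)
    {b : ℝ → ℝ} (hb : ∀ x, 0 ≤ b x) : ∃ K : ℝ, 0 ≤ K ∧ ∀ (f g h : V → ℂ) (v w : V) (σ : S2),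
      deviation v w σ ≤ Real.pi / 2 →
      ‖kern γ b l f g h (v, w, σ) + kern γ b l f g h (turnPost (v, w, σ))‖ ≤
        b (Real.cos (deviation v w σ)) * (K * (jap w ^ ((l : ℝ) - 1 + max γ 0) * ‖f w‖) *
          (‖weighted (l + κ + max γ 0) g v‖ *
            (symmBound κ' (weighted l h) v (postVel v w σ) (deviation v w σ * jap w) +
              symmBound κ' (weighted l h) v (postVel v w (halfTurn (dir (v - w)) σ))
                (deviation v w σ * jap w)))) := by
  obtain ⟨c₁, hc₁⟩ : ∃ c₁ : ℝ, c₁ = l * (9 + 8 * 3 ^ l) := ⟨_, rfl⟩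
  obtain ⟨c₂, hc₂⟩ : ∃ c₂ : ℝ, c₂ = l * 3 ^ l := ⟨_, rfl⟩
  obtain ⟨c₃, hc₃⟩ : ∃ c₃ : ℝ, c₃ = (l : ℝ) * 2 ^ ((l : ℝ) + 2) := ⟨_, rfl⟩
  have hc₁0 : 0 ≤ c₁ := by rw [hc₁]; positivity
  have hc₂0 : 0 ≤ c₂ := by rw [hc₂]; positivity
  have hc₃0 : 0 ≤ c₃ := by rw [hc₃]; positivity
  refine ⟨2 ^ max γ 0 * (c₁ + c₂ * (1 + c₃)), by positivity, fun f g h v w σ hd => ?_⟩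
  obtain ⟨τ, hτ⟩ : ∃ τ, τ = halfTurn (dir (v - w)) σ := ⟨_, rfl⟩
  have hdev : deviation v w τ = deviation v w σ := hτ ▸ deviation_turnPost v w σ
  have hturn : turnPost (v, w, σ) = (v, w, τ) := by rw [hτ]; rfl
  rw [hturn, ← hτ]
  have hJ := jap_pos v
  have hX := jap_pos w
  have hX1 := one_le_jap w
  have hθ := deviation_nonneg v w σ
  obtain ⟨x, hx⟩ : ∃ x, x = deviation v w σ * jap w := ⟨_, rfl⟩
  have hx0 : 0 ≤ x := by rw [hx]; positivity
  have hGle : ‖weighted (l + max γ 0) g v‖ ≤ ‖weighted (l + κ + max γ 0) g v‖ :=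
    norm_weighted_le (by linarith) g v
  have hhle : ∀ u, ‖h u‖ ≤ ‖weighted l h u‖ := fun u => by
    have := norm_weighted_le (Nat.cast_nonneg l) h u
    rwa [weighted_zero] at this
  rcases le_or_gt x (1 / 4) with hnear | hfar
  swap
  · have k1 := norm_kern_le_of_far γ l hb f g h hd
    have k2 := norm_kern_le_of_far γ l hb f g h (hdev.le.trans hd)
    rw [hdev] at k2
    rw [← hx, ← hc₂] at k1 k2
    rw [← hx, symmBound, if_neg hfar.not_ge, symmBound, if_neg hfar.not_ge]
    refine (norm_add_le _ _).trans ((add_le_add k1 k2).trans ?_)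
    rw [← mul_add, ← mul_add]
    refine mul_le_mul_of_nonneg_left ?_ (hb _)
    have hcc : c₂ ≤ c₁ + c₂ * (1 + c₃) := by nlinarith [mul_nonneg hc₂0 hc₃0]
    rw [← add_mul, ← mul_add]
    gcongr 2 ^ max γ 0 * ?_ * (_ * _) * ?_
    calc ‖weighted (l + max γ 0) g v‖ * (‖h (postVel v w σ)‖ + ‖h (postVel v w τ)‖) * x
        ≤ ‖weighted (l + κ + max γ 0) g v‖ *
          (‖weighted l h (postVel v w σ)‖ + ‖weighted l h (postVel v w τ)‖) * x := by
          gcongr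
          · exact hhle _
          · exact hhle _
      _ ≤ _ := by
          rw [mul_assoc]
          refine mul_le_mul_of_nonneg_left ?_ (norm_nonneg _)
          nlinarith [mul_nonneg hx0 (norm_nonneg (weighted l h v))]
  rw [hx] at hnear
  have hnear' : deviation v w τ * jap w ≤ 1 / 4 := hdev ▸ hnear
  have w0 := abs_weight_postVel_add_halfTurn_sub_le l hnear
  have w1 := abs_weight_sub_le l hd
  have w2 := abs_weight_sub_le l (hdev.le.trans hd)
  have n1 := norm_weighted_sub_le (weighted l h)
    (abs_weight_neg_sub_le (Nat.cast_nonneg l) hnear)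
  have n2 := norm_weighted_sub_le (weighted l h)
    (abs_weight_neg_sub_le (Nat.cast_nonneg l) hnear')
  simp only [weighted_weighted, neg_add_cancel, weighted_zero] at n1 n2
  rw [mul_assoc (jap v ^ l), pow_mul_eq_rpow_sub_one_mul l hX] at w1 w2
  rw [hdev] at w2 n2
  rw [← hτ] at w0
  rw [← hx, ← hc₁] at w0
  rw [← hx, ← hc₂] at w1 w2
  rw [← hx, ← hc₃] at n1 n2
  rw [← hx] at hnear
  have hh0 : ‖h v‖ = weight (-l) v * ‖weighted l h v‖ := by
    rw [weight_eq, norm_weighted, ← mul_assoc, ← Real.rpow_add hJ, neg_add_cancel, Real.rpow_zero,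
      one_mul]
  have hJl : weight (-l) v * jap v ^ l = 1 := by
    rw [weight_eq, ← Real.rpow_natCast, ← Real.rpow_add hJ, neg_add_cancel, Real.rpow_zero]
  obtain ⟨P, hP⟩ : ∃ P, P = jap w ^ ((l : ℝ) - 1) := ⟨_, rfl⟩
  have hP0 : 0 ≤ P := by rw [hP]; positivity
  have hc₁P : c₁ ≤ P * c₁ := by
    have := natCast_mul_le_mul_rpow l hX1
    rw [hc₁, hP]
    calc _ ≤ l * jap w ^ ((l : ℝ) - 1) * (9 + 8 * 3 ^ l) := by gcongr
      _ = _ := by ring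
  rw [← hP] at w1 w2
  have hwt := weight_pos (-l) v
  have d0 : ‖h v‖ * |weight l (postVel v w σ) + weight l (postVel v w τ) - 2 * weight l v| ≤
      P * c₁ * x ^ 2 * ‖weighted l h v‖ := by
    calc _ ≤ weight (-l) v * ‖weighted l h v‖ * (c₁ * (jap v ^ l * x ^ 2)) := by
          rw [hh0]; gcongr
      _ = (weight (-l) v * jap v ^ l) * (c₁ * x ^ 2 * ‖weighted l h v‖) := by ring
      _ = c₁ * (x ^ 2 * ‖weighted l h v‖) := by rw [hJl]; ring
      _ ≤ (P * c₁) * (x ^ 2 * ‖weighted l h v‖) := by gcongr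
      _ = _ := by ring
  have d1 : ‖h (postVel v w σ) - h v‖ * |weight l (postVel v w σ) - weight l v| ≤
      P * c₂ * (x * (‖weighted l h (postVel v w σ) - weighted l h v‖ +
        c₃ * x * ‖weighted l h (postVel v w σ)‖)) := by
    refine (mul_le_mul n1 w1 (abs_nonneg _) (by positivity)).trans (le_of_eq ?_)
    linear_combination (‖weighted l h (postVel v w σ) - weighted l h v‖ +
        c₃ * x * ‖weighted l h (postVel v w σ)‖) * P * c₂ * x * hJl
  have d2 : ‖h (postVel v w τ) - h v‖ * |weight l (postVel v w τ) - weight l v| ≤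
      P * c₂ * (x * (‖weighted l h (postVel v w τ) - weighted l h v‖ +
        c₃ * x * ‖weighted l h (postVel v w τ)‖)) := by
    refine (mul_le_mul n2 w2 (abs_nonneg _) (by positivity)).trans (le_of_eq ?_)
    linear_combination (‖weighted l h (postVel v w τ) - weighted l h v‖ +
        c₃ * x * ‖weighted l h (postVel v w τ)‖) * P * c₂ * x * hJl
  have hsum := near_sum_le hP0 hc₁0 hc₂0 hc₃0 hx0 (norm_nonneg _) (norm_nonneg _) (norm_nonneg _)
    (norm_nonneg _) (norm_nonneg _) d0 d1 d2
  -- Both values of `conj h` are expanded about `conj (h v)`, which leaves the second-order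
  -- difference of the weights and two increments of `h`.
  have hk : kern γ b l f g h (v, w, σ) + kern γ b l f g h (v, w, τ) =
      (crossSection γ b v w σ : ℂ) * (f w * g v) *
        (conj (h v) * ((weight l (postVel v w σ) + weight l (postVel v w τ) -
            2 * weight l v : ℝ) : ℂ) +
          conj (h (postVel v w σ) - h v) * ((weight l (postVel v w σ) - weight l v : ℝ) : ℂ) +
          conj (h (postVel v w τ) - h v) * ((weight l (postVel v w τ) - weight l v : ℝ) : ℂ)) := by
    have hc : crossSection γ b v w τ = crossSection γ b v w σ := by
      rw [crossSection, crossSection, hdev]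
    simp only [kern, hc, map_sub]
    push_cast
    ring
  have hbr : ‖conj (h v) * ((weight l (postVel v w σ) + weight l (postVel v w τ) -
            2 * weight l v : ℝ) : ℂ) +
          conj (h (postVel v w σ) - h v) * ((weight l (postVel v w σ) - weight l v : ℝ) : ℂ) +
          conj (h (postVel v w τ) - h v) * ((weight l (postVel v w τ) - weight l v : ℝ) : ℂ)‖ ≤
      _ := (norm_add₃_le.trans (le_of_eq (by
        rw [norm_mul, norm_mul, norm_mul, RCLike.norm_conj, RCLike.norm_conj, RCLike.norm_conj,
          Complex.norm_real, Complex.norm_real, Complex.norm_real, Real.norm_eq_abs,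
          Real.norm_eq_abs, Real.norm_eq_abs]))).trans hsum
  have hcs : ‖(crossSection γ b v w σ : ℂ)‖ =
      b (Real.cos (deviation v w σ)) * (1 + ‖v - w‖ ^ 2) ^ (γ / 2) := by
    rw [Complex.norm_real, crossSection, Real.norm_of_nonneg (mul_nonneg (by positivity) (hb _)),
      mul_comm]
  have hg1 : (1 + ‖v - w‖ ^ 2) ^ (γ / 2) * ‖g v‖ ≤
      2 ^ max γ 0 * jap w ^ max γ 0 * (jap v ^ (-κ') * ‖weighted (l + κ + max γ 0) g v‖) := by
    have a1 : jap v ^ max γ 0 ≤ jap v ^ (-κ') * jap v ^ (l + κ + max γ 0) := by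
      rw [← Real.rpow_add hJ]
      refine Real.rpow_le_rpow_of_exponent_le (one_le_jap v) ?_
      have : (0 : ℝ) ≤ l := Nat.cast_nonneg l
      linarith
    calc _ ≤ 2 ^ max γ 0 * (jap v ^ max γ 0 * jap w ^ max γ 0) * ‖g v‖ := by
          gcongr; exact kinetic_le γ v w
      _ ≤ 2 ^ max γ 0 * ((jap v ^ (-κ') * jap v ^ (l + κ + max γ 0)) * jap w ^ max γ 0) *
          ‖g v‖ := by
          gcongr
      _ = _ := by rw [norm_weighted]; ring
  have hJκ : jap v ^ (-κ') ≤ 1 :=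
    Real.rpow_le_one_of_one_le_of_nonpos (one_le_jap v) (by linarith)
  rw [hk, norm_mul, norm_mul, norm_mul, hcs, ← hx, symmBound, if_pos hnear, symmBound, if_pos hnear,
    Real.rpow_add hX, ← hP]
  obtain ⟨H₀, hH₀⟩ : ∃ r, r = ‖weighted l h v‖ := ⟨_, rfl⟩
  obtain ⟨H₁, hH₁⟩ : ∃ r, r = ‖weighted l h (postVel v w σ)‖ := ⟨_, rfl⟩
  obtain ⟨H₂, hH₂⟩ : ∃ r, r = ‖weighted l h (postVel v w τ)‖ := ⟨_, rfl⟩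
  obtain ⟨δ₁, hδ₁⟩ : ∃ r, r = ‖weighted l h (postVel v w σ) - weighted l h v‖ := ⟨_, rfl⟩
  obtain ⟨δ₂, hδ₂⟩ : ∃ r, r = ‖weighted l h (postVel v w τ) - weighted l h v‖ := ⟨_, rfl⟩
  rw [← hH₀, ← hH₁, ← hH₂, ← hδ₁, ← hδ₂] at hbr ⊢
  have p0 : 0 ≤ H₀ := hH₀ ▸ norm_nonneg _
  have p1 : 0 ≤ H₁ := hH₁ ▸ norm_nonneg _
  have p2 : 0 ≤ H₂ := hH₂ ▸ norm_nonneg _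
  have p3 : 0 ≤ δ₁ := hδ₁ ▸ norm_nonneg _
  have p4 : 0 ≤ δ₂ := hδ₂ ▸ norm_nonneg _
  have hbc := hb (Real.cos (deviation v w σ))
  calc _ ≤ b (Real.cos (deviation v w σ)) * (1 + ‖v - w‖ ^ 2) ^ (γ / 2) * (‖f w‖ * ‖g v‖) *
        (P * (c₁ + c₂ * (1 + c₃)) *
          ((x ^ 2 * (H₀ + H₁) + x * δ₁) + (x ^ 2 * (H₀ + H₂) + x * δ₂))) := by gcongr
    _ = b (Real.cos (deviation v w σ)) * (((1 + ‖v - w‖ ^ 2) ^ (γ / 2) * ‖g v‖) * ‖f w‖ *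
        (P * (c₁ + c₂ * (1 + c₃)) *
          ((x ^ 2 * (H₀ + H₁) + x * δ₁) + (x ^ 2 * (H₀ + H₂) + x * δ₂)))) := by ring
    _ ≤ b (Real.cos (deviation v w σ)) * ((2 ^ max γ 0 * jap w ^ max γ 0 *
        (jap v ^ (-κ') * ‖weighted (l + κ + max γ 0) g v‖)) * ‖f w‖ *
        (P * (c₁ + c₂ * (1 + c₃)) *
          ((x ^ 2 * (H₀ + H₁) + x * δ₁) + (x ^ 2 * (H₀ + H₂) + x * δ₂)))) := by gcongr
    _ = b (Real.cos (deviation v w σ)) * (2 ^ max γ 0 * (c₁ + c₂ * (1 + c₃)) *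
        (P * jap w ^ max γ 0 * ‖f w‖) * (‖weighted (l + κ + max γ 0) g v‖ *
          ((jap v ^ (-κ') * (x ^ 2 * (H₀ + H₁)) + x * jap v ^ (-κ') * δ₁) +
            (jap v ^ (-κ') * (x ^ 2 * (H₀ + H₂)) + x * jap v ^ (-κ') * δ₂)))) := by ring
    _ ≤ _ := by
        have m1 : jap v ^ (-κ') * (x ^ 2 * (H₀ + H₁)) ≤ x ^ 2 * (H₀ + H₁) :=
          mul_le_of_le_one_left (by positivity) hJκ
        have m2 : jap v ^ (-κ') * (x ^ 2 * (H₀ + H₂)) ≤ x ^ 2 * (H₀ + H₂) :=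
          mul_le_of_le_one_left (by positivity) hJκ
        refine mul_le_mul_of_nonneg_left (mul_le_mul_of_nonneg_left (mul_le_mul_of_nonneg_left ?_
          (norm_nonneg _)) (by positivity)) hbc
        linarith

/-! ### Symmetrization by the exchange of the incoming velocities -/

/-- Symmetrization by the exchange of the two velocities that lead to the same `v'`: the increments
fall on `W_q g`. -/
lemma exists_norm_kern_add_swapPre_le (γ : ℝ) (l : ℕ) {κ κ' : ℝ} (hκ' : 0 < κ') (hκ1 : κ' ≤ 1)
    (hκ : κ' ≤ κ)
    {b : ℝ → ℝ} (hb : ∀ x, 0 ≤ b x) : ∃ K : ℝ, 0 ≤ K ∧ ∀ (f g h : V → ℂ) (v w : V) (σ : S2),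
      deviation v w σ ≤ Real.pi / 2 →
      ‖kern γ b l f g h (v, w, σ) + kern γ b l f g h (swapPre (v, w, σ))‖ ≤
        b (Real.cos (deviation v w σ)) * (K * (jap w ^ ((l : ℝ) - 1 + max γ 0) * ‖f w‖) *
          (‖h (postVel v w σ)‖ *
            (symmBound κ' (weighted (l + κ + max γ 0) g) v (postVel v w σ)
                (deviation v w σ * jap w) +
              symmBound κ' (weighted (l + κ + max γ 0) g) (w + ‖v - w‖ • (σ : V)) (postVel v w σ)
                (deviation v w σ * jap w)))) := by
  obtain ⟨q, hq⟩ : ∃ q : ℝ, q = l + κ + max γ 0 := ⟨_, rfl⟩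
  have hκ0 : 0 ≤ κ := by linarith
  have hq0 : 0 ≤ q := by rw [hq]; positivity
  rw [← hq]
  obtain ⟨c₁, hc₁⟩ : ∃ c₁ : ℝ, c₁ = l * (9 + 8 * 3 ^ l) := ⟨_, rfl⟩
  obtain ⟨c₂, hc₂⟩ : ∃ c₂ : ℝ, c₂ = l * 5 ^ l := ⟨_, rfl⟩
  obtain ⟨c₃, hc₃⟩ : ∃ c₃ : ℝ, c₃ = q * 2 ^ (q + 2) := ⟨_, rfl⟩
  have hc₁0 : 0 ≤ c₁ := by rw [hc₁]; positivity
  have hc₂0 : 0 ≤ c₂ := by rw [hc₂]; positivity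
  have hc₃0 : 0 ≤ c₃ := by rw [hc₃]; positivity
  refine ⟨2 * 2 ^ max γ 0 * (c₁ + c₂ * (1 + c₃)), by positivity, fun f g h v w σ hd => ?_⟩
  obtain ⟨u, hu⟩ : ∃ u, u = w + ‖v - w‖ • (σ : V) := ⟨_, rfl⟩
  obtain ⟨τ, hτ⟩ : ∃ τ, τ = dir (v - w) := ⟨_, rfl⟩
  have hdev : deviation u w τ = deviation v w σ := hu ▸ hτ ▸ deviation_swapPre v w σ
  have hpost : postVel u w τ = postVel v w σ := hu ▸ hτ ▸ postVel_swapPre v w σ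
  have hnorm : ‖u - w‖ = ‖v - w‖ := hu ▸ norm_swapPre v w σ
  have hswap : swapPre (v, w, σ) = (u, w, τ) := by rw [hτ, hu]; rfl
  rw [hswap, ← hu]
  obtain ⟨y, hy⟩ : ∃ y, y = postVel v w σ := ⟨_, rfl⟩
  have hJ := jap_pos v
  have hJu := jap_pos u
  have hJy := jap_pos y
  have hX := jap_pos w
  have hX1 := one_le_jap w
  have hθ := deviation_nonneg v w σ
  obtain ⟨x, hx⟩ : ∃ x, x = deviation v w σ * jap w := ⟨_, rfl⟩
  have hx0 : 0 ≤ x := by rw [hx]; positivity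
  have hGle : ∀ z, ‖weighted (l + max γ 0) g z‖ ≤ ‖weighted q g z‖ := fun z =>
    norm_weighted_le (by rw [hq]; linarith) g z
  rw [← hy]
  rcases le_or_gt x (1 / 4) with hnear | hfar
  swap
  · have k1 := norm_kern_le_of_far γ l hb f g h hd
    have k2 := norm_kern_le_of_far γ l hb f g h (hdev.le.trans hd)
    rw [hdev, hpost] at k2
    rw [← hx, ← hy] at k1 k2
    rw [← hx, symmBound, if_neg hfar.not_ge, symmBound, if_neg hfar.not_ge]
    refine (norm_add_le _ _).trans ((add_le_add k1 k2).trans ?_)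
    rw [← mul_add, ← mul_add]
    refine mul_le_mul_of_nonneg_left ?_ (hb _)
    have hcc : (l : ℝ) * 3 ^ l ≤ 2 * (c₁ + c₂ * (1 + c₃)) := by
      have e1 : (l : ℝ) * 3 ^ l ≤ c₂ := by
        rw [hc₂]
        gcongr
        norm_num
      nlinarith [mul_nonneg hc₂0 hc₃0]
    have hA : 0 ≤ jap w ^ ((l : ℝ) - 1 + max γ 0) * ‖f w‖ := by positivity
    have hB : ‖weighted (l + max γ 0) g v‖ * ‖h y‖ * x + ‖weighted (l + max γ 0) g u‖ * ‖h y‖ * x ≤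
        ‖h y‖ * (x * (‖weighted q g v‖ + ‖weighted q g y‖) +
          x * (‖weighted q g u‖ + ‖weighted q g y‖)) := by
      calc _ ≤ ‖weighted q g v‖ * ‖h y‖ * x + ‖weighted q g u‖ * ‖h y‖ * x := by
            gcongr
            · exact hGle v
            · exact hGle u
        _ ≤ ‖weighted q g v‖ * ‖h y‖ * x + ‖weighted q g u‖ * ‖h y‖ * x +
            2 * (‖h y‖ * x * ‖weighted q g y‖) := by
            have : 0 ≤ ‖h y‖ * x * ‖weighted q g y‖ := by positivity
            linarith
        _ = _ := by ring
    calc _ ≤ 2 ^ max γ 0 * (2 * (c₁ + c₂ * (1 + c₃))) *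
          (jap w ^ ((l : ℝ) - 1 + max γ 0) * ‖f w‖) *
          (‖weighted (l + max γ 0) g v‖ * ‖h y‖ * x +
            ‖weighted (l + max γ 0) g u‖ * ‖h y‖ * x) := by gcongr
      _ ≤ _ := by
        refine (mul_le_mul_of_nonneg_left hB (by positivity)).trans (le_of_eq (by ring))
  rw [hx] at hnear
  have hnear' : deviation u w τ * jap w ≤ 1 / 4 := hdev ▸ hnear
  have w0 := abs_weight_add_swapPre_sub_le l hnear
  have w1 := abs_weight_sub_le_postVel l hd
  have w2 := abs_weight_sub_le_postVel l (hdev.le.trans hd)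
  have n1 := norm_weighted_sub_le (weighted q g) (abs_weight_neg_sub_le_postVel hq0 hnear)
  have n2 := norm_weighted_sub_le (weighted q g) (abs_weight_neg_sub_le_postVel hq0 hnear')
  have j1 := rpow_neg_le_two_mul hκ'.le hκ1 hJ (hy ▸ hJy) (jap_le_postVel_of_near hnear)
  have j2 := rpow_neg_le_two_mul hκ'.le hκ1 hJu (hpost ▸ hy ▸ hJy) (jap_le_postVel_of_near hnear')
  simp only [weighted_weighted, neg_add_cancel, weighted_zero] at n1 n2
  rw [hpost, hdev] at w2 n2
  rw [hpost] at j2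
  rw [← hy, mul_assoc (jap y ^ l), pow_mul_eq_rpow_sub_one_mul l hX] at w1 w2
  rw [← hu] at w0
  rw [← hx, ← hy, ← hc₁] at w0
  rw [← hx, ← hc₂] at w1 w2
  rw [← hx, ← hy, ← hc₃] at n1 n2
  rw [← hy] at j1 j2
  rw [← hx] at hnear
  have hh0 : ‖g y‖ = weight (-q) y * ‖weighted q g y‖ := by
    rw [weight_eq, norm_weighted, ← mul_assoc, ← Real.rpow_add hJy, neg_add_cancel, Real.rpow_zero,
      one_mul]
  obtain ⟨T, hT⟩ : ∃ T, T = weight (-q) y * jap y ^ l := ⟨_, rfl⟩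
  have hwt := weight_pos (-q) y
  have hT0 : 0 ≤ T := by rw [hT]; positivity
  obtain ⟨P, hP⟩ : ∃ P, P = jap w ^ ((l : ℝ) - 1) := ⟨_, rfl⟩
  have hP0 : 0 ≤ P := by rw [hP]; positivity
  have hc₁P : c₁ ≤ P * c₁ := by
    have := natCast_mul_le_mul_rpow l hX1
    rw [hc₁, hP]
    calc _ ≤ l * jap w ^ ((l : ℝ) - 1) * (9 + 8 * 3 ^ l) := by gcongr
      _ = _ := by ring
  rw [← hP] at w1 w2
  have d0 : ‖g y‖ * |weight l v + weight l u - 2 * weight l y| ≤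
      (P * T) * c₁ * x ^ 2 * ‖weighted q g y‖ := by
    calc _ ≤ weight (-q) y * ‖weighted q g y‖ * (c₁ * (jap y ^ l * x ^ 2)) := by
          rw [hh0]; gcongr
      _ = T * c₁ * x ^ 2 * ‖weighted q g y‖ := by rw [hT]; ring
      _ ≤ T * (P * c₁) * x ^ 2 * ‖weighted q g y‖ := by gcongr
      _ = _ := by ring
  have d1 : ‖g v - g y‖ * |weight l y - weight l v| ≤ (P * T) * c₂ *
      (x * (‖weighted q g v - weighted q g y‖ + c₃ * x * ‖weighted q g v‖)) := by
    calc _ ≤ (weight (-q) y * (‖weighted q g v - weighted q g y‖ + c₃ * x * ‖weighted q g v‖)) *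
          (c₂ * (jap y ^ l * (P * x))) := by gcongr
      _ = _ := by rw [hT]; ring
  have d2 : ‖g u - g y‖ * |weight l y - weight l u| ≤ (P * T) * c₂ *
      (x * (‖weighted q g u - weighted q g y‖ + c₃ * x * ‖weighted q g u‖)) := by
    calc _ ≤ (weight (-q) y * (‖weighted q g u - weighted q g y‖ + c₃ * x * ‖weighted q g u‖)) *
          (c₂ * (jap y ^ l * (P * x))) := by gcongr
      _ = _ := by rw [hT]; ring
  have hPT : 0 ≤ P * T := mul_nonneg hP0 hT0
  have hsum := near_sum_le hPT hc₁0 hc₂0 hc₃0 hx0 (norm_nonneg _) (norm_nonneg _) (norm_nonneg _)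
    (norm_nonneg _) (norm_nonneg _) d0 d1 d2
  -- The two collisions have the same `v' = y`, and `v`, `u` are symmetric about `y`. Both values of
  -- `g` are expanded about `g y`.
  have hk : kern γ b l f g h (v, w, σ) + kern γ b l f g h (u, w, τ) =
      (crossSection γ b v w σ : ℂ) * (f w * conj (h y)) *
        (g y * ((-(weight l v + weight l u - 2 * weight l y) : ℝ) : ℂ) +
          (g v - g y) * ((weight l y - weight l v : ℝ) : ℂ) +
          (g u - g y) * ((weight l y - weight l u : ℝ) : ℂ)) := by
    have hc : crossSection γ b u w τ = crossSection γ b v w σ := by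
      rw [crossSection, crossSection, hdev, hnorm]
    simp only [kern, hc, hpost, ← hy]
    push_cast
    ring
  have hbr : ‖g y * ((-(weight l v + weight l u - 2 * weight l y) : ℝ) : ℂ) +
          (g v - g y) * ((weight l y - weight l v : ℝ) : ℂ) +
          (g u - g y) * ((weight l y - weight l u : ℝ) : ℂ)‖ ≤
      _ := (norm_add₃_le.trans (le_of_eq (by
        rw [norm_mul, norm_mul, norm_mul,
          Complex.norm_real, Complex.norm_real, Complex.norm_real, Real.norm_eq_abs,
          Real.norm_eq_abs, Real.norm_eq_abs, abs_neg]))).trans hsum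
  have hcs : ‖(crossSection γ b v w σ : ℂ)‖ =
      b (Real.cos (deviation v w σ)) * (1 + ‖v - w‖ ^ 2) ^ (γ / 2) := by
    rw [Complex.norm_real, crossSection, Real.norm_of_nonneg (mul_nonneg (by positivity) (hb _)),
      mul_comm]
  have hg1 : (1 + ‖v - w‖ ^ 2) ^ (γ / 2) * T ≤
      2 ^ max γ 0 * jap w ^ max γ 0 * jap y ^ (-κ') := by
    have a1 : jap y ^ max γ 0 * T ≤ jap y ^ (-κ') := by
      rw [hT, weight_eq, ← Real.rpow_natCast, ← Real.rpow_add hJy, ← Real.rpow_add hJy]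
      refine Real.rpow_le_rpow_of_exponent_le (one_le_jap y) ?_
      rw [hq]
      linarith
    have a2 := kinetic_le_postVel γ hd
    rw [← hy] at a2
    calc _ ≤ 2 ^ max γ 0 * (jap y ^ max γ 0 * jap w ^ max γ 0) * T := by gcongr
      _ = 2 ^ max γ 0 * jap w ^ max γ 0 * (jap y ^ max γ 0 * T) := by ring
      _ ≤ _ := by gcongr
  have hJκ : jap y ^ (-κ') ≤ 1 :=
    Real.rpow_le_one_of_one_le_of_nonpos (one_le_jap y) (by linarith)
  rw [hk, norm_mul, norm_mul, norm_mul, RCLike.norm_conj, hcs, ← hx, symmBound, if_pos hnear,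
    symmBound, if_pos hnear, Real.rpow_add hX, ← hP, norm_sub_rev (weighted q g y),
    norm_sub_rev (weighted q g y)]
  obtain ⟨H₀, hH₀⟩ : ∃ r, r = ‖weighted q g y‖ := ⟨_, rfl⟩
  obtain ⟨H₁, hH₁⟩ : ∃ r, r = ‖weighted q g v‖ := ⟨_, rfl⟩
  obtain ⟨H₂, hH₂⟩ : ∃ r, r = ‖weighted q g u‖ := ⟨_, rfl⟩
  obtain ⟨δ₁, hδ₁⟩ : ∃ r, r = ‖weighted q g v - weighted q g y‖ := ⟨_, rfl⟩
  obtain ⟨δ₂, hδ₂⟩ : ∃ r, r = ‖weighted q g u - weighted q g y‖ := ⟨_, rfl⟩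
  rw [← hH₀, ← hH₁, ← hH₂, ← hδ₁, ← hδ₂] at hbr ⊢
  have p0 : 0 ≤ H₀ := hH₀ ▸ norm_nonneg _
  have p1 : 0 ≤ H₁ := hH₁ ▸ norm_nonneg _
  have p2 : 0 ≤ H₂ := hH₂ ▸ norm_nonneg _
  have p3 : 0 ≤ δ₁ := hδ₁ ▸ norm_nonneg _
  have p4 : 0 ≤ δ₂ := hδ₂ ▸ norm_nonneg _
  have hbc := hb (Real.cos (deviation v w σ))
  calc _ ≤ b (Real.cos (deviation v w σ)) * (1 + ‖v - w‖ ^ 2) ^ (γ / 2) * (‖f w‖ * ‖h y‖) *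
        (P * T * (c₁ + c₂ * (1 + c₃)) *
          ((x ^ 2 * (H₀ + H₁) + x * δ₁) + (x ^ 2 * (H₀ + H₂) + x * δ₂))) := by gcongr
    _ = b (Real.cos (deviation v w σ)) * (((1 + ‖v - w‖ ^ 2) ^ (γ / 2) * T) * (‖f w‖ * ‖h y‖) *
        (P * (c₁ + c₂ * (1 + c₃)) *
          ((x ^ 2 * (H₀ + H₁) + x * δ₁) + (x ^ 2 * (H₀ + H₂) + x * δ₂)))) := by ring
    _ ≤ b (Real.cos (deviation v w σ)) * ((2 ^ max γ 0 * jap w ^ max γ 0 * jap y ^ (-κ')) *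
        (‖f w‖ * ‖h y‖) * (P * (c₁ + c₂ * (1 + c₃)) *
          ((x ^ 2 * (H₀ + H₁) + x * δ₁) + (x ^ 2 * (H₀ + H₂) + x * δ₂)))) := by gcongr
    _ = b (Real.cos (deviation v w σ)) * (2 ^ max γ 0 * (c₁ + c₂ * (1 + c₃)) *
        (P * jap w ^ max γ 0 * ‖f w‖) * (‖h y‖ *
          ((jap y ^ (-κ') * (x ^ 2 * (H₀ + H₁)) + jap y ^ (-κ') * (x * δ₁)) +
            (jap y ^ (-κ') * (x ^ 2 * (H₀ + H₂)) + jap y ^ (-κ') * (x * δ₂))))) := by ring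
    _ ≤ b (Real.cos (deviation v w σ)) * (2 ^ max γ 0 * (c₁ + c₂ * (1 + c₃)) *
        (P * jap w ^ max γ 0 * ‖f w‖) * (‖h y‖ *
          (2 * ((x ^ 2 * (H₁ + H₀) + x * jap v ^ (-κ') * δ₁) +
            (x ^ 2 * (H₂ + H₀) + x * jap u ^ (-κ') * δ₂))))) := by
        have m1 : jap y ^ (-κ') * (x ^ 2 * (H₀ + H₁)) ≤ x ^ 2 * (H₀ + H₁) :=
          mul_le_of_le_one_left (by positivity) hJκ
        have m2 : jap y ^ (-κ') * (x ^ 2 * (H₀ + H₂)) ≤ x ^ 2 * (H₀ + H₂) :=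
          mul_le_of_le_one_left (by positivity) hJκ
        have m3 := mul_le_mul_of_nonneg_right j1 (mul_nonneg hx0 p3)
        have m4 := mul_le_mul_of_nonneg_right j2 (mul_nonneg hx0 p4)
        have m5 : 0 ≤ x ^ 2 * (H₀ + H₁) := by positivity
        have m6 : 0 ≤ x ^ 2 * (H₀ + H₂) := by positivity
        refine mul_le_mul_of_nonneg_left (mul_le_mul_of_nonneg_left (mul_le_mul_of_nonneg_left ?_
          (norm_nonneg _)) (by positivity)) hbc
        linarith
    _ = _ := by ring

/-! ### Integration of the symmetrized kernel -/

lemma enorm_le_of_norm_le_symm {z : ℂ} {B K X F A s₁ s₂ : ℝ} (hB : 0 ≤ B) (hK : 0 ≤ K)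
    (hX : 0 ≤ X) (hF : 0 ≤ F) (hA : 0 ≤ A) (hs₁ : 0 ≤ s₁) (hs₂ : 0 ≤ s₂)
    (h : ‖z‖ ≤ B * (K * (X * F) * (A * (s₁ + s₂)))) :
    ‖z‖ₑ ≤ ENNReal.ofReal B * (ENNReal.ofReal (K * X) * ENNReal.ofReal F *
        (ENNReal.ofReal A * ENNReal.ofReal s₁)) +
      ENNReal.ofReal B * (ENNReal.ofReal (K * X) * ENNReal.ofReal F *
        (ENNReal.ofReal A * ENNReal.ofReal s₂)) := by
  have e : B * (K * (X * F) * (A * (s₁ + s₂))) =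
      B * (K * X * F * (A * s₁)) + B * (K * X * F * (A * s₂)) := by ring
  rw [e] at h
  have h2 := ENNReal.ofReal_le_ofReal h
  rw [ofReal_norm, ENNReal.ofReal_add (by positivity) (by positivity), ENNReal.ofReal_mul hB,
    ENNReal.ofReal_mul hB, ENNReal.ofReal_mul (p := K * X * F) (by positivity),
    ENNReal.ofReal_mul (p := K * X * F) (by positivity),
    ENNReal.ofReal_mul (p := K * X) (by positivity), ENNReal.ofReal_mul hA,
    ENNReal.ofReal_mul hA] at h2
  exact h2

/-- The bound of the symmetrized kernel: `A` is the size of the function that is not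
differentiated, `U` the function on which the increments fall. -/
def symmKern (γ : ℝ) (b : ℝ → ℝ) (l : ℝ) (K κ : ℝ) (f U : V → ℂ) (A : V × V × S2 → ℝ≥0∞)
    (p : V × V × S2) : ℝ≥0∞ :=
  angFactor b p.1 p.2.1 p.2.2 * (ENNReal.ofReal (K * jap p.2.1 ^ (l - 1 + max γ 0)) *
    ‖f p.2.1‖ₑ * (A p * symmFactor κ U p.2.1 (p.1, p.2.2)))

lemma measurable_symmFactor (κ : ℝ) {U : V → ℂ} (hU : Measurable U) :
    Measurable fun p : V × V × S2 => symmFactor κ U p.2.1 (p.1, p.2.2) := by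
  simp only [symmFactor_eq]
  have h1 := measurable_jap
  have h2 : Measurable fun p : V × V × S2 => U (postVel p.1 p.2.1 p.2.2) :=
    hU.comp measurable_postVel
  have h3 : Measurable fun p : V × V × S2 => deviation p.1 p.2.1 p.2.2 * jap p.2.1 :=
    measurable_deviation.mul (by fun_prop)
  have h4 : Measurable fun p : V × V × S2 => U p.1 := by fun_prop
  have h5 : Measurable fun p : V × V × S2 => jap p.1 ^ (-κ) := by fun_prop
  unfold symmBound
  refine (Measurable.ite (measurableSet_le h3 measurable_const) ?_ ?_).ennreal_ofReal
  · exact ((h3.pow_const 2).mul (h4.norm.add h2.norm)).add ((h3.mul h5).mul (h2.sub h4).norm)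
  · exact h3.mul (h4.norm.add h2.norm)

lemma measurable_symmKern {γ l K κ : ℝ} {b : ℝ → ℝ} (hb : Measurable b) {f U : V → ℂ}
    (hf : Measurable f) (hU : Measurable U) {A : V × V × S2 → ℝ≥0∞} (hA : Measurable A) :
    Measurable (symmKern γ b l K κ f U A) := by
  have h1 := measurable_jap
  have h2 : Measurable fun p : V × V × S2 => ENNReal.ofReal (K * jap p.2.1 ^ (l - 1 + max γ 0)) *
    ‖f p.2.1‖ₑ := by fun_prop
  exact (measurable_angFactor hb).mul (h2.mul (hA.mul (measurable_symmFactor κ hU)))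

/-- The power `⟨v_*⟩^{1+κ}` from the angular integral and `⟨v_*⟩^{l-1}` from the weight differences
add up to the weight `l + κ` of `f`. -/
theorem IsAngularFactor.exists_lintegral_symmKern_le {s κ κ' m : ℝ} {b : ℝ → ℝ}
    (hb : IsAngularFactor s b) (hκ' : 0 < κ') (hκ : κ' ≤ κ) (hκm : κ' < m) (hm1 : m < 1)
    (hs : 2 * s ≤ 1 + κ') (γ l : ℝ) {K : ℝ} (hK : 0 ≤ K) :
    ∃ C : ℝ, 0 ≤ C ∧ ∀ (f U : V → ℂ) (α : V → V × S2 → V) (a : V → ℝ≥0∞) (N : ℝ≥0∞),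
      (∀ w, DominatedMarginal b w (α w)) → (∀ w, Comparable w (α w)) →
      Measurable (fun p : V × V × S2 => a (α p.2.1 (p.1, p.2.2))) →
      Measurable a → Measurable f → Measurable U →
      l2 (fun v => ‖U v‖ₑ) ≤ N → HasL2Modulus m U N →
      ∫⁻ p, symmKern γ b l K κ' f U (fun p => a (α p.2.1 (p.1, p.2.2))) p ∂collMeasure ≤
        ENNReal.ofReal C * (∫⁻ w, ‖weighted (l + κ + max γ 0) f w‖ₑ) * (l2 a * N) := by
  obtain ⟨C, hC, H⟩ := hb.exists_lintegral_symmFactor_le hκ' hκm hm1 hs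
  refine ⟨K * C, by positivity, fun f U α a N hα hcomp hA ha hf hU hUN hN => ?_⟩
  have hjap := measurable_jap
  have hm : Measurable fun p : V × V × S2 =>
      ENNReal.ofReal (K * jap p.2.1 ^ (l - 1 + max γ 0)) *
        ‖f p.2.1‖ₑ * (a (α p.2.1 (p.1, p.2.2)) * symmFactor κ' U p.2.1 (p.1, p.2.2)) := by
    have h2 : Measurable fun p : V × V × S2 =>
      ENNReal.ofReal (K * jap p.2.1 ^ (l - 1 + max γ 0)) * ‖f p.2.1‖ₑ := by fun_prop
    exact h2.mul (hA.mul (measurable_symmFactor κ' hU))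
  have h1 := lintegral_collMeasure_angFactor hb.measurable hm
  have hwf : Measurable fun w => ‖weighted (l + κ + max γ 0) f w‖ₑ := (measurable_weighted hf).enorm
  calc _ = _ := h1
    _ ≤ ∫⁻ w, ENNReal.ofReal (K * C) * ‖weighted (l + κ + max γ 0) f w‖ₑ * (l2 a * N) := by
        refine lintegral_mono fun w => ?_
        have hq : Measurable fun q : V × S2 => a (α w q) * symmFactor κ' U w q :=
          measurable_insert (hA.mul (measurable_symmFactor κ' hU)) w
        have hX := jap_pos w
        simp only
        rw [lintegral_const_mul _ hq]
        calc _ ≤ ENNReal.ofReal (K * jap w ^ (l - 1 + max γ 0)) * ‖f w‖ₑ *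
              (ENNReal.ofReal (C * jap w ^ (1 + κ')) * (l2 a * N)) :=
              mul_le_mul_right (H w (α w) a U N (hα w) (hcomp w) ha hU hUN hN) _
          _ = (ENNReal.ofReal (K * jap w ^ (l - 1 + max γ 0)) *
              ENNReal.ofReal (C * jap w ^ (1 + κ')) * ‖f w‖ₑ) * (l2 a * N) := by ring
          _ ≤ _ := by
            refine mul_le_mul_left ?_ _
            rw [← ofReal_norm, ← ofReal_norm, norm_weighted, ← ENNReal.ofReal_mul (by positivity),
              ← ENNReal.ofReal_mul (by positivity), ← ENNReal.ofReal_mul (by positivity)]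
            refine ENNReal.ofReal_le_ofReal ?_
            have e : jap w ^ (l - 1 + max γ 0) * jap w ^ (1 + κ') ≤ jap w ^ (l + κ + max γ 0) := by
              rw [← Real.rpow_add hX]
              exact Real.rpow_le_rpow_of_exponent_le (one_le_jap w) (by linarith)
            calc _ = K * C * (jap w ^ (l - 1 + max γ 0) * jap w ^ (1 + κ')) * ‖f w‖ := by ring
              _ ≤ K * C * jap w ^ (l + κ + max γ 0) * ‖f w‖ := by gcongr
              _ = _ := by ring
    _ = _ := by
        have hc : Measurable fun w => ENNReal.ofReal (K * C) * ‖weighted (l + κ + max γ 0) f w‖ₑ :=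
          hwf.const_mul _
        rw [lintegral_mul_const _ hc, lintegral_const_mul _ hwf]

/-- The commutator product exists, with a bound, if the symmetrized kernel is integrable. -/
theorem exists_hasCommutatorPairing_of_symm (γ : ℝ) (l : ℕ) {s : ℝ} {b : ℝ → ℝ}
    (hb : IsAngularFactor s b) {f g h : V → ℂ} (hf : Measurable f) (hg : Measurable g)
    (hh : Measurable h) (hf0 : ∫⁻ w, ‖weighted (max γ 0) f w‖ₑ < ∞)
    (hg2 : l2 (fun v => ‖weighted (l + max γ 0) g v‖ₑ) < ∞)
    (hA : ∀ δ : ℝ, 0 < δ → Integrable (truncKern γ b l δ f g h) collMeasure)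
    {S : V × V × S2 → V × V × S2} (hS : MeasurePreserving S collMeasure collMeasure)
    (hSd : ∀ p, deviation (S p).1 (S p).2.1 (S p).2.2 = deviation p.1 p.2.1 p.2.2)
    {M : ℝ≥0∞} (hM : M ≠ ∞) {R : V × V × S2 → ℝ≥0∞} (hRm : Measurable R)
    (hle : ∀ p, ‖kern γ b l f g h p + kern γ b l f g h (S p)‖ₑ ≤ R p + R (S p))
    (hR : ∫⁻ p, R p ∂collMeasure ≤ M) :
    ∃ L : ℂ, HasCommutatorPairing γ b l f g h L ∧ ‖L‖ₑ ≤ M := by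
  have hg0 : l2 (fun v => ‖weighted (max γ 0) g v‖ₑ) < ∞ :=
    (l2_mono fun v => enorm_weighted_le (by simp) g v).trans_lt hg2
  have hg0' : ∫⁻ v, ‖weighted (max γ 0) g v‖ₑ ^ 2 < ∞ := by
    rw [← l2_sq]; exact ENNReal.pow_lt_top hg0
  have hg1' : ∫⁻ v, ‖weighted (max γ 0) (weighted l g) v‖ₑ ^ 2 < ∞ := by
    rw [weighted_weighted, add_comm, ← l2_sq]; exact ENNReal.pow_lt_top hg2
  refine exists_hasCommutatorPairing hb.measurable hf hg hh
    (fun δ hδ => ae_integrable_collisionIntegrand hb hδ hf hg hf0 hg0')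
    (fun δ hδ => ae_integrable_collisionIntegrand hb hδ hf (measurable_weighted hg) hf0 hg1')
    hA hS hSd hM ?_
  calc _ ≤ ∫⁻ p, (R p + R (S p)) ∂collMeasure := lintegral_mono hle
    _ = ∫⁻ p, R p ∂collMeasure + ∫⁻ p, R p ∂collMeasure := by
        rw [lintegral_add_left hRm, hS.lintegral_comp hRm]
    _ ≤ 2 * M := by rw [two_mul]; exact add_le_add hR hR

/-- The case `s < 1 / 2` with `f` in a weighted `L¹` space: `kern` itself is integrable. -/
theorem exists_pairing_of_lt_half (γ : ℝ) (l : ℕ) {s : ℝ} {b : ℝ → ℝ}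
    (hb : IsAngularFactor s b) (hs : s < 1 / 2) : ∃ C : ℝ, 0 ≤ C ∧ ∀ f g h : V → ℂ,
      Measurable f → Measurable g → Measurable h →
      ∫⁻ w, ‖weighted (l + max γ 0) f w‖ₑ < ∞ →
      l2 (fun v => ‖weighted (l + max γ 0) g v‖ₑ) < ∞ → l2 (fun v => ‖h v‖ₑ) < ∞ →
      ∃ L : ℂ, HasCommutatorPairing γ b l f g h L ∧
        ‖L‖ₑ ≤ ENNReal.ofReal C * (∫⁻ w, ‖weighted (l + max γ 0) f w‖ₑ) *
          (l2 (fun v => ‖weighted (l + max γ 0) g v‖ₑ) * l2 fun v => ‖h v‖ₑ) := by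
  obtain ⟨C, hC, H⟩ := lintegral_enorm_kern_le_of_lt_half γ l hb hs
  refine ⟨C, hC, fun f g h hf hg hh hf1 hg2 hh2 => ?_⟩
  exact exists_hasCommutatorPairing_of_symm γ l hb hf hg hh
    ((lintegral_weighted_le (by simp) f).trans_lt hf1) hg2
    (fun δ hδ => integrable_truncKern γ l hb hδ hf hg hh hf1 hg2 hh2) (MeasurePreserving.id _)
    (fun _ => rfl) (by finiteness) (measurable_kern hb.measurable hf hg hh).enorm
    (fun p => enorm_add_le _ _) (H f g h hf hg hh)

lemma angFactor_eq_ofReal (b : ℝ → ℝ) (v w : V) (σ : S2) :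
    angFactor b v w σ = ENNReal.ofReal (b (Real.cos (deviation v w σ))) := rfl

/-- Increments on `h`: half turns of `σ` about `v - v_*`. -/
theorem exists_pairing_increments_right (γ : ℝ) (l : ℕ) {s κ κ' m : ℝ} {b : ℝ → ℝ}
    (hb : IsAngularFactor s b) (hκ' : 0 < κ') (hκ : κ' ≤ κ) (hκm : κ' < m) (hm1 : m < 1)
    (hs : 2 * s ≤ 1 + κ') : ∃ C : ℝ, 0 ≤ C ∧ ∀ (f g h : V → ℂ) (N : ℝ≥0∞),
      Measurable f → Measurable g → Measurable h →
      ∫⁻ w, ‖weighted (l + κ + max γ 0) f w‖ₑ < ∞ →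
      l2 (fun v => ‖weighted (l + κ + max γ 0) g v‖ₑ) < ∞ →
      l2 (fun v => ‖weighted l h v‖ₑ) ≤ N → HasL2Modulus m (weighted l h) N → N < ∞ →
      ∃ L : ℂ, HasCommutatorPairing γ b l f g h L ∧
        ‖L‖ₑ ≤ ENNReal.ofReal C * (∫⁻ w, ‖weighted (l + κ + max γ 0) f w‖ₑ) *
          (l2 (fun v => ‖weighted (l + κ + max γ 0) g v‖ₑ) * N) := by
  obtain ⟨K, hK, hpt⟩ := exists_norm_kern_add_turnPost_le γ l hκ' hκ hb.nonneg
  obtain ⟨C, hC, H⟩ := hb.exists_lintegral_symmKern_le hκ' hκ hκm hm1 hs γ l hK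
  refine ⟨C, hC, fun f g h N hf hg hh hf1 hg2 hhN hN hNt => ?_⟩
  have hgm : Measurable (weighted (l + κ + max γ 0) g) := measurable_weighted hg
  have hhm : Measurable (weighted l h) := measurable_weighted hh
  have hle : (l : ℝ) + max γ 0 ≤ l + κ + max γ 0 := by linarith
  have hf1' := (lintegral_weighted_le hle f).trans_lt hf1
  have hg2' := (l2_mono fun v => enorm_weighted_le hle g v).trans_lt hg2
  have hh2 : l2 (fun v => ‖h v‖ₑ) < ∞ := by
    refine (l2_mono fun v => ?_).trans_lt (hhN.trans_lt hNt)
    have := enorm_weighted_le (Nat.cast_nonneg l) h v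
    rwa [weighted_zero] at this
  have hA : Measurable fun p : V × V × S2 => ‖weighted (l + κ + max γ 0) g p.1‖ₑ := by fun_prop
  refine exists_hasCommutatorPairing_of_symm γ l hb hf hg hh
    ((lintegral_weighted_le (by simp) f).trans_lt hf1') hg2'
    (fun δ hδ => integrable_truncKern γ l hb hδ hf hg hh hf1' hg2' hh2) measurePreserving_turnPost
    (fun p => deviation_turnPost _ _ _) (by finiteness)
    (measurable_symmKern hb.measurable hf hhm hA) (fun p => ?_)
    (H f (weighted l h) (fun _ q => q.1) (fun v => ‖weighted (l + κ + max γ 0) g v‖ₑ) N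
      (fun w => dominatedMarginal_fst hb.measurable w) comparable_fst hA hgm.enorm hf hhm hhN hN)
  obtain ⟨v, w, σ⟩ := p
  rcases le_or_gt (deviation v w σ) (Real.pi / 2) with hd | hd
  · have hx : 0 ≤ deviation v w σ * jap w := mul_nonneg (deviation_nonneg v w σ) (jap_pos w).le
    have := enorm_le_of_norm_le_symm (hb.nonneg _) hK (Real.rpow_nonneg (jap_pos w).le _)
      (norm_nonneg _) (norm_nonneg _) (symmBound_nonneg _ _ _ _ hx) (symmBound_nonneg _ _ _ _ hx)
      (hpt f g h v w σ hd)
    simp only [symmKern, turnPost, symmFactor_eq, angFactor_eq_ofReal, deviation_turnPost]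
    simp only [ofReal_norm] at this
    exact this
  · rw [kern_eq_zero hb.eq_zero_of_neg f g h hd]
    have hd' : Real.pi / 2 < deviation v w (halfTurn (dir (v - w)) σ) := by
      rwa [deviation_turnPost]
    have : kern γ b l f g h (turnPost (v, w, σ)) = 0 := kern_eq_zero hb.eq_zero_of_neg f g h hd'
    rw [this]
    simp

/-- Increments on `g`: exchange of the two velocities that lead to the same `v'`. -/
theorem exists_pairing_increments_left (γ : ℝ) (l : ℕ) {s κ κ' m : ℝ} {b : ℝ → ℝ}
    (hb : IsAngularFactor s b) (hκ' : 0 < κ') (hκ : κ' ≤ κ) (hκm : κ' < m) (hm1 : m < 1)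
    (hs : 2 * s ≤ 1 + κ') : ∃ C : ℝ, 0 ≤ C ∧ ∀ (f g h : V → ℂ) (N : ℝ≥0∞),
      Measurable f → Measurable g → Measurable h →
      ∫⁻ w, ‖weighted (l + κ + max γ 0) f w‖ₑ < ∞ → l2 (fun v => ‖h v‖ₑ) < ∞ →
      l2 (fun v => ‖weighted (l + κ + max γ 0) g v‖ₑ) ≤ N →
      HasL2Modulus m (weighted (l + κ + max γ 0) g) N → N < ∞ →
      ∃ L : ℂ, HasCommutatorPairing γ b l f g h L ∧
        ‖L‖ₑ ≤ ENNReal.ofReal C * (∫⁻ w, ‖weighted (l + κ + max γ 0) f w‖ₑ) *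
          (l2 (fun v => ‖h v‖ₑ) * N) := by
  obtain ⟨K, hK, hpt⟩ :=
    exists_norm_kern_add_swapPre_le γ l hκ' (hκm.trans hm1).le hκ hb.nonneg
  obtain ⟨C, hC, H⟩ := hb.exists_lintegral_symmKern_le hκ' hκ hκm hm1 hs γ l hK
  refine ⟨C, hC, fun f g h N hf hg hh hf1 hh2 hgN hN hNt => ?_⟩
  have hgm : Measurable (weighted (l + κ + max γ 0) g) := measurable_weighted hg
  have hle : (l : ℝ) + max γ 0 ≤ l + κ + max γ 0 := by linarith
  have hf1' := (lintegral_weighted_le hle f).trans_lt hf1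
  have hg2' := (l2_mono fun v => enorm_weighted_le hle g v).trans_lt (hgN.trans_lt hNt)
  have hA : Measurable fun p : V × V × S2 => ‖h (postVel p.1 p.2.1 p.2.2)‖ₑ :=
    (hh.comp measurable_postVel).enorm
  refine exists_hasCommutatorPairing_of_symm γ l hb hf hg hh
    ((lintegral_weighted_le (by simp) f).trans_lt hf1') hg2'
    (fun δ hδ => integrable_truncKern γ l hb hδ hf hg hh hf1' hg2' hh2)
    measurePreserving_swapPre
    (fun p => deviation_swapPre _ _ _) (by finiteness)
    (measurable_symmKern hb.measurable hf hgm hA) (fun p => ?_)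
    (H f (weighted (l + κ + max γ 0) g) (fun w q => postVel q.1 w q.2) (fun v => ‖h v‖ₑ) N
      (fun w => dominatedMarginal_postVel hb.measurable hb.eq_zero_of_neg w) comparable_postVel hA
      hh.enorm hf hgm hgN hN)
  obtain ⟨v, w, σ⟩ := p
  rcases le_or_gt (deviation v w σ) (Real.pi / 2) with hd | hd
  · have hx : 0 ≤ deviation v w σ * jap w := mul_nonneg (deviation_nonneg v w σ) (jap_pos w).le
    have := enorm_le_of_norm_le_symm (hb.nonneg _) hK (Real.rpow_nonneg (jap_pos w).le _)
      (norm_nonneg _) (norm_nonneg _) (symmBound_nonneg _ _ _ _ hx) (symmBound_nonneg _ _ _ _ hx)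
      (hpt f g h v w σ hd)
    simp only [symmKern, swapPre, symmFactor_eq, angFactor_eq_ofReal, deviation_swapPre,
      postVel_swapPre]
    simp only [ofReal_norm] at this
    exact this
  · rw [kern_eq_zero hb.eq_zero_of_neg f g h hd]
    have hd' : Real.pi / 2 < deviation (w + ‖v - w‖ • (σ : V)) w (dir (v - w)) := by
      rwa [deviation_swapPre]
    have : kern γ b l f g h (swapPre (v, w, σ)) = 0 := kern_eq_zero hb.eq_zero_of_neg f g h hd'
    rw [this]
    simp

/-! ### The case of `f` in a weighted `L²` space -/

lemma displacement_le_of_le {θ X J d β : ℝ} (hθ : 0 ≤ θ) (hθ2 : θ ≤ 2) (hX : 1 ≤ X) (hJ : 1 ≤ J)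
    (hβ : 0 < β) (hβ1 : β ≤ 1) (hd : d ≤ θ * (J + X) / 2) (h : θ * X ≤ J) :
    d ≤ 2 * ((θ * X) ^ β * J) := by
  have a1 : θ ≤ 2 * (θ * X) ^ β := by
    have e1 : θ ≤ 2 * θ ^ β := by
      rcases le_total θ 1 with h1 | h1
      · have := Real.rpow_le_rpow_of_exponent_ge' hθ h1 hβ.le hβ1
        rw [Real.rpow_one] at this
        have := Real.rpow_nonneg hθ β
        linarith
      · have := Real.one_le_rpow h1 hβ.le
        linarith
    refine e1.trans ?_
    have : θ ^ β ≤ (θ * X) ^ β := by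
      refine Real.rpow_le_rpow hθ ?_ hβ.le
      nlinarith
    linarith
  have a2 : θ * X ≤ (θ * X) ^ β * J := by
    have hx : 0 ≤ θ * X := by positivity
    have hpos := Real.rpow_nonneg hx β
    rcases le_total (θ * X) 1 with h1 | h1
    · have := Real.rpow_le_rpow_of_exponent_ge' hx h1 hβ.le hβ1
      rw [Real.rpow_one] at this
      nlinarith
    · have := Real.one_le_rpow h1 hβ.le
      nlinarith
  nlinarith

/-- Up to the angle `θ ~ ⟨v⟩ / ⟨v_*⟩` the difference of the weights is of order `⟨v⟩^l`, and beyond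
it of order `(θ ⟨v_*⟩)^l`. -/
lemma abs_weight_sub_le_add (l : ℕ) {β : ℝ} (hβ : 0 < β) (hβ1 : β ≤ 1) {v w : V} {σ : S2}
    (h : deviation v w σ ≤ Real.pi / 2) :
    |weight l (postVel v w σ) - weight l v| ≤ l * 3 ^ l *
      (jap v ^ l * (deviation v w σ * jap w) ^ β + (deviation v w σ * jap w) ^ l) := by
  rcases l with _ | l
  · simp [weight]
  rw [weight_natCast, weight_natCast]
  have hX := one_le_jap w
  have hJ := one_le_jap v
  have hθ := deviation_nonneg v w σ
  have hθ2 : deviation v w σ ≤ 2 := by linarith [Real.pi_le_four]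
  obtain ⟨d, hd⟩ : ∃ d, d = ‖postVel v w σ - v‖ := ⟨_, rfl⟩
  have hd0 : 0 ≤ d := hd ▸ norm_nonneg _
  have hdle : d ≤ deviation v w σ * (jap v + jap w) / 2 := by
    have h1 := norm_postVel_sub_le v w σ
    have h2 := norm_sub_le v w
    have h3 := norm_le_jap v
    have h4 := norm_le_jap w
    rw [hd]
    nlinarith
  have hjd := abs_jap_sub_le (postVel v w σ) v
  have hj' : jap (postVel v w σ) ≤ jap v + d := by
    rw [hd]; linarith [(abs_le.mp hjd).2]
  rw [← hd] at hjd
  have key := abs_pow_sub_pow_le_of_le (jap_pos (postVel v w σ)).le (jap_pos v).le hj'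
    (by linarith) (l + 1)
  rw [Nat.add_sub_cancel] at key
  have key2 : |jap (postVel v w σ) ^ (l + 1) - jap v ^ (l + 1)| ≤
      d * (l + 1 : ℕ) * (jap v + d) ^ l := by
    refine key.trans ?_
    gcongr
  refine key2.trans ?_
  obtain ⟨x, hx⟩ : ∃ x, x = deviation v w σ * jap w := ⟨_, rfl⟩
  have hx0 : 0 ≤ x := by rw [hx]; positivity
  have hxβ := Real.rpow_nonneg hx0 β
  have hJ0 := jap_pos v
  rcases le_total x (jap v) with hc | hc
  · have e1 := displacement_le_of_le hθ hθ2 hX hJ hβ hβ1 hdle (hx ▸ hc)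
    rw [← hx] at e1 ⊢
    have e2 : jap v + d ≤ 3 * jap v := by
      have : d ≤ (2 * jap v + x) / 2 := by rw [hx]; nlinarith
      linarith
    calc _ ≤ 2 * (x ^ β * jap v) * (l + 1 : ℕ) * (3 * jap v) ^ l := by gcongr
      _ = (l + 1 : ℕ) * (2 * 3 ^ l) * (jap v ^ (l + 1) * x ^ β) := by
          rw [mul_pow]; ring
      _ ≤ (l + 1 : ℕ) * 3 ^ (l + 1) * (jap v ^ (l + 1) * x ^ β + x ^ (l + 1)) := by
          gcongr
          · rw [pow_succ]; nlinarith [pow_pos (by norm_num : (0 : ℝ) < 3) l]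
          · exact le_add_of_nonneg_right (by positivity)
  · have e1 : d ≤ 3 / 2 * x := by
      have : deviation v w σ * jap v ≤ 2 * x := by
        calc _ ≤ 2 * jap v := by gcongr
          _ ≤ _ := by linarith
      rw [mul_add, ← hx] at hdle
      linarith
    rw [← hx]
    calc _ ≤ 3 * x * (l + 1 : ℕ) * (3 * x) ^ l := by
          gcongr
          · linarith
          · linarith
      _ = (l + 1 : ℕ) * 3 ^ (l + 1) * x ^ (l + 1) := by
          rw [mul_pow]; ring
      _ ≤ _ := by
          gcongr
          exact le_add_of_nonneg_left (by positivity)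

/-- The two terms of the weight difference: the first one leaves the weight `l` on `g`, the second
one moves it to `f`. -/
lemma norm_kern_le_add (γ : ℝ) (l : ℕ) {β : ℝ} (hβ : 0 < β) (hβ1 : β ≤ 1) {b : ℝ → ℝ}
    (hb : ∀ x, 0 ≤ b x) (f g h : V → ℂ) {v w : V} {σ : S2} (hd : deviation v w σ ≤ Real.pi / 2) :
    ‖kern γ b l f g h (v, w, σ)‖ ≤ b (Real.cos (deviation v w σ)) *
        (2 ^ max γ 0 * (l * 3 ^ l) * ‖weighted (β + max γ 0) f w‖ * (deviation v w σ ^ β *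
          (‖weighted (l + max γ 0) g v‖ * ‖h (postVel v w σ)‖))) +
      b (Real.cos (deviation v w σ)) *
        (2 ^ max γ 0 * (l * 3 ^ l) * ‖weighted (max γ 0) g v‖ * (‖weighted (l + max γ 0) f w‖ *
          (deviation v w σ ^ (l : ℝ) * ‖h (postVel v w σ)‖))) := by
  have h3 := jap_pos v
  have h4 := jap_pos w
  have h5 := deviation_nonneg v w σ
  rw [norm_kern hb, norm_weighted, norm_weighted, norm_weighted, norm_weighted, Real.rpow_add h3,
    Real.rpow_add h4, Real.rpow_add h4, Real.rpow_natCast, Real.rpow_natCast, Real.rpow_natCast]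
  have h1 := kinetic_le γ v w
  have h2 := abs_weight_sub_le_add l hβ hβ1 hd
  rw [Real.mul_rpow h5 h4.le, mul_pow] at h2
  rw [← mul_add]
  refine mul_le_mul_of_nonneg_left ?_ (hb _)
  calc _ ≤ 2 ^ max γ 0 * (jap v ^ max γ 0 * jap w ^ max γ 0) * ‖f w‖ * ‖g v‖ *
        ‖h (postVel v w σ)‖ * (l * 3 ^ l * (jap v ^ l * (deviation v w σ ^ β * jap w ^ β) +
          deviation v w σ ^ l * jap w ^ l)) := by gcongr
    _ = _ := by ring

lemma enorm_kern_le_add (γ : ℝ) (l : ℕ) {β : ℝ} (hβ : 0 < β) (hβ1 : β ≤ 1) {b : ℝ → ℝ}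
    (hb : ∀ x, 0 ≤ b x) (hb0 : ∀ x, x < 0 → b x = 0) (f g h : V → ℂ) (v w : V) (σ : S2) :
    ‖kern γ b l f g h (v, w, σ)‖ₑ ≤ angFactor b v w σ *
        (ENNReal.ofReal (2 ^ max γ 0 * (l * 3 ^ l)) * ‖weighted (β + max γ 0) f w‖ₑ *
          (ENNReal.ofReal (deviation v w σ ^ β) *
          (‖weighted (l + max γ 0) g v‖ₑ * ‖h (postVel v w σ)‖ₑ))) +
      angFactor b v w σ *
        (ENNReal.ofReal (2 ^ max γ 0 * (l * 3 ^ l)) * ‖weighted (max γ 0) g v‖ₑ *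
          (‖weighted (l + max γ 0) f w‖ₑ *
          (ENNReal.ofReal (deviation v w σ ^ (l : ℝ)) * ‖h (postVel v w σ)‖ₑ))) := by
  rcases lt_or_ge (Real.pi / 2) (deviation v w σ) with hd | hd
  · rw [kern_eq_zero hb0 f g h hd, enorm_zero]; exact zero_le
  have h1 := ENNReal.ofReal_le_ofReal (norm_kern_le_add γ l hβ hβ1 hb f g h hd)
  have h5 := deviation_nonneg v w σ
  have hbn := hb (Real.cos (deviation v w σ))
  obtain ⟨k, hk⟩ : ∃ k : ℝ, k = 2 ^ max γ 0 * (l * 3 ^ l) := ⟨_, rfl⟩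
  have hk0 : 0 ≤ k := by rw [hk]; positivity
  rw [← hk] at h1 ⊢
  rw [ofReal_norm, ENNReal.ofReal_add (by positivity) (by positivity), ENNReal.ofReal_mul hbn,
    ENNReal.ofReal_mul hbn] at h1
  rw [ENNReal.ofReal_mul (p := k * ‖weighted (β + max γ 0) f w‖) (by positivity),
    ENNReal.ofReal_mul (p := k * ‖weighted (max γ 0) g v‖) (by positivity),
    ENNReal.ofReal_mul hk0, ENNReal.ofReal_mul hk0,
    ENNReal.ofReal_mul (p := deviation v w σ ^ β) (by positivity),
    ENNReal.ofReal_mul (p := ‖weighted (l + max γ 0) f w‖) (by positivity),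
    ENNReal.ofReal_mul (p := deviation v w σ ^ (l : ℝ)) (by positivity),
    ENNReal.ofReal_mul (norm_nonneg _), ofReal_norm, ofReal_norm, ofReal_norm, ofReal_norm,
    ofReal_norm] at h1
  exact h1

section Partner

variable {b : ℝ → ℝ} {p : ℝ} {φ c : V → ℝ≥0∞}

lemma measurable_at_left {β : Type*} [MeasurableSpace β] {F : V × V × S2 → β} (hF : Measurable F)
    (v : V) : Measurable fun q : V × S2 => F (v, q) := by
  have h : Measurable fun q : V × S2 => (v, q) := measurable_prodMk_left
  exact hF.comp h

lemma measurable_angFactor_right (hb : Measurable b) (v : V) :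
    Measurable fun q : V × S2 => angFactor b v q.1 q.2 := by
  have h := measurable_at_left (measurable_angFactor hb) v
  exact h

lemma measurable_deviation_rpow_right (v : V) (p : ℝ) :
    Measurable fun q : V × S2 => ENNReal.ofReal (deviation v q.1 q.2 ^ p) := by
  have hd := measurable_at_left measurable_deviation v
  have h := (hd.pow_const p).ennreal_ofReal
  exact h

lemma measurable_postVel_right (v : V) : Measurable fun q : V × S2 => postVel v q.1 q.2 := by
  have h := measurable_at_left measurable_postVel v
  exact h

/-- The function of `v_*` in the Cauchy-Schwarz inequality at a fixed `v`. -/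
lemma lintegral_partner_sq_le (hb : Measurable b) (v : V) (hφ : Measurable φ) :
    ∫⁻ q : V × S2, angFactor b v q.1 q.2 * (ENNReal.ofReal (deviation v q.1 q.2 ^ p) * φ q.1 ^ 2)
        ∂(volume : Measure V).prod sphereMeasure ≤
      ENNReal.ofReal (2 * Real.pi ^ 4) * (∫⁻ θ, ENNReal.ofReal (θ ^ p) ∂angMeasure b) *
        l2 φ ^ 2 := by
  have ha := measurable_angFactor_right hb v
  have hd := measurable_deviation_rpow_right v p
  have hF : Measurable fun q : V × S2 => angFactor b v q.1 q.2 *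
      (ENNReal.ofReal (deviation v q.1 q.2 ^ p) * φ q.1 ^ 2) :=
    ha.mul (hd.mul ((hφ.comp measurable_fst).pow_const 2))
  rw [lintegral_prod _ hF.aemeasurable, l2_sq, ← lintegral_const_mul _ (hφ.pow_const 2)]
  have hne : ∀ᵐ w : V, w ≠ v := Measure.ae_ne volume v
  refine lintegral_mono_ae ?_
  filter_upwards [hne] with w hw
  have e1 := lintegral_angFactor hb hw.symm (F := fun θ => ENNReal.ofReal (θ ^ p)) (by fun_prop)
  have hm : Measurable fun σ : S2 =>
      angFactor b v w σ * ENNReal.ofReal (deviation v w σ ^ p) := by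
    have hq : Measurable fun q : V × S2 =>
      angFactor b v q.1 q.2 * ENNReal.ofReal (deviation v q.1 q.2 ^ p) := ha.mul hd
    have hs : Measurable fun σ : S2 => (w, σ) := measurable_prodMk_left
    have h := hq.comp hs
    exact h
  simp only [← mul_assoc]
  rw [lintegral_mul_const _ hm, e1]
  gcongr
  have := Real.pi_gt_three
  exact le_self_pow₀ (by linarith) (by norm_num)

/-- The function of `v'` in the Cauchy-Schwarz inequality at a fixed `v`, where the Jacobian costs
`θ^{-3}`. The condition on `p` makes the integrand vanish at `θ = 0`. -/
lemma lintegral_partner_postVel_sq_le (hp : -3 < p) (hb : Measurable b)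
    (hb0 : ∀ x, x < 0 → b x = 0) (v : V) (hc : Measurable c) :
    ∫⁻ q : V × S2, angFactor b v q.1 q.2 *
      (ENNReal.ofReal (deviation v q.1 q.2 ^ (p + 3)) * c (postVel v q.1 q.2) ^ 2)
        ∂(volume : Measure V).prod sphereMeasure ≤
      ENNReal.ofReal (2 * Real.pi ^ 4) * (∫⁻ θ, ENNReal.ofReal (θ ^ p) ∂angMeasure b) *
        l2 c ^ 2 := by
  have hr : ∀ e : ℝ, Measurable fun θ : ℝ => ENNReal.ofReal (θ ^ e) := fun e => by fun_prop
  have hG : Measurable fun q : V × S2 => angFactor b v q.1 q.2 *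
      (ENNReal.ofReal (deviation v q.1 q.2 ^ (p + 3)) * c (postVel v q.1 q.2) ^ 2) :=
    (measurable_angFactor_right hb v).mul ((measurable_deviation_rpow_right v _).mul
      ((hc.comp (measurable_postVel_right v)).pow_const 2))
  rw [lintegral_prod _ hG.aemeasurable]
  have hK : Measurable (Function.uncurry fun (y : V) (θ : ℝ) =>
      ENNReal.ofReal (θ ^ (p + 3)) * c y ^ 2) :=
    Measurable.mul (f := fun q : V × ℝ => ENNReal.ofReal (q.2 ^ (p + 3)))
      (g := fun q => c q.1 ^ 2) ((hr _).comp measurable_snd)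
      ((hc.comp measurable_fst).pow_const 2)
  refine (lintegral_post_singular_le hb hb0 v _ hK fun y => ?_).trans ?_
  · rw [Real.zero_rpow (by linarith)]; simp
  rw [mul_assoc, l2_sq, ← lintegral_const_mul _ (hc.pow_const 2)]
  gcongr with y
  rw [← lintegral_mul_const _ (hr _)]
  refine lintegral_angMeasure_mono fun θ hθ => le_of_eq ?_
  rw [← mul_assoc, ← ENNReal.ofReal_mul (by positivity), ← Real.rpow_add hθ]
  congr 3
  ring

/-- For a fixed velocity `v`, a function of `v_*` times a function of `v'`: the Jacobian `θ^{-3}` of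
`v_* ↦ v'` is compensated by half of the angular weight. -/
lemma lintegral_partner_mul_le (hp : 3 / 2 < p) (hb : Measurable b)
    (hb0 : ∀ x, x < 0 → b x = 0) (v : V) (hφ : Measurable φ) (hc : Measurable c) :
    ∫⁻ q : V × S2, angFactor b v q.1 q.2 * (φ q.1 *
        (ENNReal.ofReal (deviation v q.1 q.2 ^ p) * c (postVel v q.1 q.2)))
          ∂(volume : Measure V).prod sphereMeasure ≤
      ENNReal.ofReal (2 * Real.pi ^ 4) *
        (∫⁻ θ, ENNReal.ofReal (θ ^ (p - 3 / 2)) ∂angMeasure b) * (l2 φ * l2 c) := by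
  have ha := measurable_angFactor_right hb v
  have hF : Measurable fun q : V × S2 => angFactor b v q.1 q.2 *
      (ENNReal.ofReal (deviation v q.1 q.2 ^ (p - 3 / 2)) * φ q.1 ^ 2) :=
    ha.mul ((measurable_deviation_rpow_right v _).mul ((hφ.comp measurable_fst).pow_const 2))
  have hG : Measurable fun q : V × S2 => angFactor b v q.1 q.2 *
      (ENNReal.ofReal (deviation v q.1 q.2 ^ (p - 3 / 2 + 3)) * c (postVel v q.1 q.2) ^ 2) :=
    ha.mul ((measurable_deviation_rpow_right v _).mul
      ((hc.comp (measurable_postVel_right v)).pow_const 2))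
  have hpt : ∀ q : V × S2, (angFactor b v q.1 q.2 * (φ q.1 *
        (ENNReal.ofReal (deviation v q.1 q.2 ^ p) * c (postVel v q.1 q.2)))) ^ 2 ≤
      (angFactor b v q.1 q.2 * (ENNReal.ofReal (deviation v q.1 q.2 ^ (p - 3 / 2)) * φ q.1 ^ 2)) *
      (angFactor b v q.1 q.2 * (ENNReal.ofReal (deviation v q.1 q.2 ^ (p - 3 / 2 + 3)) *
        c (postVel v q.1 q.2) ^ 2)) := fun q => by
    have h0 := deviation_nonneg v q.1 q.2
    have e : ENNReal.ofReal (deviation v q.1 q.2 ^ p) ^ 2 =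
        ENNReal.ofReal (deviation v q.1 q.2 ^ (p - 3 / 2)) *
          ENNReal.ofReal (deviation v q.1 q.2 ^ (p - 3 / 2 + 3)) := by
      rw [← ENNReal.ofReal_pow (by positivity), ← ENNReal.ofReal_mul (by positivity),
        ← Real.rpow_natCast, ← Real.rpow_mul h0,
        ← Real.rpow_add_of_nonneg h0 (by linarith) (by linarith)]
      congr 2
      push_cast
      ring
    rw [mul_pow, mul_pow, mul_pow, e]
    exact le_of_eq (by ring)
  have h2 := lintegral_partner_sq_le (p := p - 3 / 2) hb v hφ
  have h3 := lintegral_partner_postVel_sq_le (p := p - 3 / 2) (by linarith) hb hb0 v hc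
  refine le_of_sq_le_sq ((sq_lintegral_le_of_sq_le hF.aemeasurable hG.aemeasurable
    (ae_of_all _ hpt)).trans ((mul_le_mul' h2 h3).trans (le_of_eq (by ring))))

end Partner

/-- A weighted `L¹` norm is dominated by an `L²` norm with more than `3 / 2` additional powers of
the weight. -/
lemma exists_lintegral_weighted_le_l2 {m m' : ℝ} (h : m + 3 / 2 < m') : ∃ C : ℝ, 0 ≤ C ∧
    ∀ f : V → ℂ, Measurable f →
      ∫⁻ w, ‖weighted m f w‖ₑ ≤ ENNReal.ofReal C * l2 fun w => ‖weighted m' f w‖ₑ := by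
  obtain ⟨a, ha⟩ : ∃ a : V → ℝ≥0∞, a = fun v => ENNReal.ofReal (weight (m - m') v) := ⟨_, rfl⟩
  have ham : Measurable a := by rw [ha]; exact (measurable_weight _).ennreal_ofReal
  have hfin : l2 a ≠ ∞ := by
    have h1 := integrable_rpow_neg_one_add_norm_sq (E := V) (μ := volume) (r := 2 * (m' - m))
      (by rw [finrank_V]; push_cast; linarith)
    have h2 : ∫⁻ v, a v ^ 2 < ∞ := by
      refine lt_of_le_of_lt (lintegral_mono fun v => ?_) h1.2
      rw [ha]
      simp only
      rw [← ENNReal.ofReal_pow (weight_pos _ _).le, ← ofReal_norm,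
        Real.norm_of_nonneg (by positivity), sq, weight_mul, weight]
      refine ENNReal.ofReal_le_ofReal (le_of_eq ?_)
      congr 1
      ring
    rw [← l2_sq] at h2
    intro h3
    simp [h3] at h2
  refine ⟨(l2 a).toReal, ENNReal.toReal_nonneg, fun f hf => ?_⟩
  rw [ENNReal.ofReal_toReal hfin]
  refine le_trans (lintegral_mono fun w => ?_)
    (lintegral_mul_le_l2 ham (measurable_weighted (l := m') hf).enorm)
  rw [ha]
  simp only
  rw [← ofReal_norm, ← ofReal_norm, norm_weighted, norm_weighted, weight_eq,
    ← ENNReal.ofReal_mul (by have := jap_pos w; positivity), ← mul_assoc,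
    ← Real.rpow_add (jap_pos w)]
  simp

/-- In the first term `f` costs `3 / 2 + β` powers of the weight, with `θ^β` integrable for `β >
2s`. In the second one `f` carries the full weight `l` in `L²`, and `g` pays for the `L¹` norm;
there `θ^{l-3/2}` has to be integrable. Both are the condition `l > 3 / 2 + 2s`. -/
lemma exists_lintegral_enorm_kern_le_l2 (γ : ℝ) (l : ℕ) {s : ℝ} {b : ℝ → ℝ}
    (hb : IsAngularFactor s b) (hs0 : 0 < s) (hs : s < 1 / 2) (hl : 3 / 2 + 2 * s < l) :
    ∃ C : ℝ, 0 ≤ C ∧ ∀ f g h : V → ℂ, Measurable f → Measurable g → Measurable h →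
      ∫⁻ p : V × V × S2, ‖kern γ b l f g h p‖ₑ ∂collMeasure ≤
        ENNReal.ofReal C * l2 (fun v => ‖weighted (l + max γ 0) f v‖ₑ) *
          (l2 (fun v => ‖weighted (l + max γ 0) g v‖ₑ) * l2 fun v => ‖h v‖ₑ) := by
  -- Any exponent between `2s` and `l - 3 / 2` does, and `2s < 1` allows `β ≤ 1`.
  obtain ⟨β, hβs, hβl, hβ1⟩ : ∃ β, 2 * s < β ∧ β + 3 / 2 < l ∧ β ≤ 1 := by
    refine ⟨min 1 ((2 * s + (l - 3 / 2)) / 2), lt_min (by linarith) (by linarith), ?_,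
      min_le_left _ _⟩
    have := min_le_right 1 ((2 * s + ((l : ℝ) - 3 / 2)) / 2)
    linarith
  obtain ⟨C₁, hC₁, e1⟩ := exists_lintegral_weighted_le_l2 (m := β + max γ 0) (m' := l + max γ 0)
    (by linarith)
  obtain ⟨C₂, hC₂, e2⟩ := exists_lintegral_weighted_le_l2 (m := max γ 0) (m' := l + max γ 0)
    (by linarith)
  have i1 := hb.lintegral_rpow_lt_top hβs
  have i2 := hb.lintegral_rpow_lt_top (p := l - 3 / 2) (by linarith)
  obtain ⟨k, hk⟩ : ∃ k, k = ENNReal.ofReal (2 ^ max γ 0 * (l * 3 ^ l)) := ⟨_, rfl⟩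
  have hkt : k ≠ ∞ := by rw [hk]; exact ENNReal.ofReal_ne_top
  obtain ⟨D₁, hD₁⟩ : ∃ D₁, D₁ = ENNReal.ofReal (8 * Real.pi) *
    (∫⁻ θ, ENNReal.ofReal (θ ^ β) ∂angMeasure b) := ⟨_, rfl⟩
  obtain ⟨D₂, hD₂⟩ : ∃ D₂, D₂ = ENNReal.ofReal (2 * Real.pi ^ 4) *
    (∫⁻ θ, ENNReal.ofReal (θ ^ ((l : ℝ) - 3 / 2)) ∂angMeasure b) := ⟨_, rfl⟩
  have hD₁t : D₁ ≠ ∞ := by rw [hD₁]; finiteness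
  have hD₂t : D₂ ≠ ∞ := by rw [hD₂]; finiteness
  obtain ⟨D, hD⟩ : ∃ D, D = D₁ * k * ENNReal.ofReal C₁ + k * ENNReal.ofReal C₂ * D₂ := ⟨_, rfl⟩
  have hDt : D ≠ ∞ := by rw [hD]; finiteness
  refine ⟨D.toReal, ENNReal.toReal_nonneg, fun f g h hf hg hh => ?_⟩
  rw [ENNReal.ofReal_toReal hDt]
  have hf1 : Measurable fun v => ‖weighted (β + max γ 0) f v‖ₑ := (measurable_weighted hf).enorm
  have hf2 : Measurable fun v => ‖weighted (l + max γ 0) f v‖ₑ := (measurable_weighted hf).enorm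
  have hg1 : Measurable fun v => ‖weighted (l + max γ 0) g v‖ₑ := (measurable_weighted hg).enorm
  have hg2 : Measurable fun v => ‖weighted (max γ 0) g v‖ₑ := (measurable_weighted hg).enorm
  have hhm : Measurable fun v => ‖h v‖ₑ := hh.enorm
  have hr : ∀ e : ℝ, Measurable fun θ : ℝ => ENNReal.ofReal (θ ^ e) := fun e => by fun_prop
  have t1 := lintegral_angFactor_mul_le hb (hr β) (hf1.const_mul k) hg1 hhm
  obtain ⟨Ψ, hΨ⟩ : ∃ Ψ : V × V × S2 → ℝ≥0∞, Ψ = fun p => angFactor b p.1 p.2.1 p.2.2 *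
      (‖weighted (l + max γ 0) f p.2.1‖ₑ * (ENNReal.ofReal (deviation p.1 p.2.1 p.2.2 ^ (l : ℝ)) *
        ‖h (postVel p.1 p.2.1 p.2.2)‖ₑ)) := ⟨_, rfl⟩
  have hΨm : Measurable Ψ := by
    have m1 : Measurable fun p : V × V × S2 => ‖weighted (l + max γ 0) f p.2.1‖ₑ :=
      hf2.comp (measurable_fst.comp measurable_snd)
    have m2 : Measurable fun p : V × V × S2 =>
      ENNReal.ofReal (deviation p.1 p.2.1 p.2.2 ^ (l : ℝ)) := (hr l).comp measurable_deviation
    have m3 : Measurable fun p : V × V × S2 => ‖h (postVel p.1 p.2.1 p.2.2)‖ₑ :=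
      hhm.comp measurable_postVel
    rw [hΨ]
    exact (measurable_angFactor hb.measurable).mul (m1.mul (m2.mul m3))
  have hgk : Measurable fun p : V × V × S2 => k * ‖weighted (max γ 0) g p.1‖ₑ :=
    (hg2.const_mul k).comp measurable_fst
  have hΨ2 : Measurable fun p : V × V × S2 => k * ‖weighted (max γ 0) g p.1‖ₑ * Ψ p := hgk.mul hΨm
  have t2 : ∫⁻ p, k * ‖weighted (max γ 0) g p.1‖ₑ * Ψ p ∂collMeasure ≤
      k * (∫⁻ v, ‖weighted (max γ 0) g v‖ₑ) *
        (D₂ * (l2 (fun v => ‖weighted (l + max γ 0) f v‖ₑ) * l2 fun v => ‖h v‖ₑ)) := by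
    rw [collMeasure, lintegral_prod _ hΨ2.aemeasurable]
    rw [← lintegral_const_mul _ hg2, ← lintegral_mul_const _ (hg2.const_mul k)]
    refine lintegral_mono fun v => ?_
    simp only
    have hΨv : Measurable fun q : V × S2 => Ψ (v, q) := hΨm.comp measurable_prodMk_left
    rw [lintegral_const_mul _ hΨv, hΨ, hD₂]
    gcongr
    exact lintegral_partner_mul_le (by linarith) hb.measurable hb.eq_zero_of_neg v hf2 hhm
  have hpt : ∀ p : V × V × S2, ‖kern γ b l f g h p‖ₑ ≤ angFactor b p.1 p.2.1 p.2.2 *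
      (k * ‖weighted (β + max γ 0) f p.2.1‖ₑ * (ENNReal.ofReal (deviation p.1 p.2.1 p.2.2 ^ β) *
        (‖weighted (l + max γ 0) g p.1‖ₑ * ‖h (postVel p.1 p.2.1 p.2.2)‖ₑ))) +
      k * ‖weighted (max γ 0) g p.1‖ₑ * Ψ p := fun p => by
    refine (enorm_kern_le_add γ l (by linarith) hβ1 hb.nonneg hb.eq_zero_of_neg f g h p.1 p.2.1
      p.2.2).trans (le_of_eq ?_)
    rw [hΨ, hk]
    ring
  rw [lintegral_const_mul _ hf1, ← hD₁] at t1
  calc _ ≤ _ := lintegral_mono hpt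
    _ = _ := lintegral_add_right _ hΨ2
    _ ≤ _ := add_le_add
      (t1.trans (mul_le_mul_left (mul_le_mul_right (mul_le_mul_right (e1 f hf) _) _) _))
      (t2.trans (mul_le_mul_left (mul_le_mul_right (e2 g hg) _) _))
    _ = _ := by rw [hD]; ring

/-- The case `s < 1 / 2` with `f` in a weighted `L²` space. -/
theorem exists_pairing_of_lt_half_l2 (γ : ℝ) (l : ℕ) {s : ℝ} {b : ℝ → ℝ}
    (hb : IsAngularFactor s b) (hs0 : 0 < s) (hs : s < 1 / 2) (hl : 3 / 2 + 2 * s < l) :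
    ∃ C : ℝ, 0 ≤ C ∧ ∀ f g h : V → ℂ, Measurable f → Measurable g → Measurable h →
      l2 (fun v => ‖weighted (l + max γ 0) f v‖ₑ) < ∞ →
      l2 (fun v => ‖weighted (l + max γ 0) g v‖ₑ) < ∞ → l2 (fun v => ‖h v‖ₑ) < ∞ →
      ∃ L : ℂ, HasCommutatorPairing γ b l f g h L ∧
        ‖L‖ₑ ≤ ENNReal.ofReal C * l2 (fun v => ‖weighted (l + max γ 0) f v‖ₑ) *
          (l2 (fun v => ‖weighted (l + max γ 0) g v‖ₑ) * l2 fun v => ‖h v‖ₑ) := by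
  obtain ⟨C, hC, H⟩ := exists_lintegral_enorm_kern_le_l2 γ l hb hs0 hs hl
  obtain ⟨C₂, hC₂, e2⟩ := exists_lintegral_weighted_le_l2 (m := max γ 0) (m' := l + max γ 0)
    (by linarith)
  refine ⟨C, hC, fun f g h hf hg hh hf2 hg2 hh2 => ?_⟩
  have hf0 : ∫⁻ w, ‖weighted (max γ 0) f w‖ₑ < ∞ := (e2 f hf).trans_lt (by finiteness)
  have hkern := H f g h hf hg hh
  refine exists_hasCommutatorPairing_of_symm γ l hb hf hg hh hf0 hg2 (fun δ hδ => ?_)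
    (MeasurePreserving.id _) (fun _ => rfl) (by finiteness)
    (measurable_kern hb.measurable hf hg hh).enorm (fun p => enorm_add_le _ _) hkern
  classical
  refine ⟨(measurable_truncKern hb.measurable hf hg hh).aestronglyMeasurable, ?_⟩
  refine lt_of_le_of_lt (lintegral_mono fun p => ?_) (hkern.trans_lt (by finiteness))
  rw [truncKern]
  split_ifs <;> simp

/-! ### Measurable representatives and norms -/

lemma exists_measurable_of_weighted {q : ℝ} {f : V → ℂ}
    (hf : AEStronglyMeasurable (weighted q f) volume) :
    ∃ f₀ : V → ℂ, Measurable f₀ ∧ f =ᵐ[volume] f₀ := by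
  have h1 : AEStronglyMeasurable f volume := by
    have h2 : f = fun v => (weight (-q) v : ℂ) * weighted q f v := by
      funext v
      have h3 := weighted_weighted (-q) q f
      rw [neg_add_cancel, weighted_zero] at h3
      exact (congrFun h3 v).symm
    rw [h2]
    have h4 : Measurable fun v => (weight (-q) v : ℂ) :=
      Complex.measurable_ofReal.comp (measurable_weight _)
    exact h4.aestronglyMeasurable.mul hf
  exact ⟨h1.mk f, h1.stronglyMeasurable_mk.measurable, h1.ae_eq_mk⟩

lemma normLpW_nonneg (p : ℝ≥0∞) (q : ℝ) (f : V → ℂ) : 0 ≤ normLpW p q f := ENNReal.toReal_nonneg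

lemma normHW_nonneg (m q : ℝ) (f : V → ℂ) : 0 ≤ normHW m q f := ENNReal.toReal_nonneg

lemma MemLpW.exists_measurable_one {q : ℝ} {f : V → ℂ} (hf : MemLpW 1 q f) :
    ∃ f₀ : V → ℂ, Measurable f₀ ∧ f =ᵐ[volume] f₀ ∧
      ∫⁻ v, ‖weighted q f₀ v‖ₑ = ENNReal.ofReal (normLpW 1 q f) := by
  obtain ⟨f₀, hm, he⟩ := exists_measurable_of_weighted hf.1
  refine ⟨f₀, hm, he, ?_⟩
  rw [normLpW, ENNReal.ofReal_toReal hf.2.ne, eLpNorm_one_eq_lintegral_enorm]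
  exact lintegral_congr_ae ((weighted_ae_eq q he).mono fun v hv => by simp only [hv])

lemma eLpNorm_two_eq_l2 (f : V → ℂ) : eLpNorm f 2 volume = l2 fun v => ‖f v‖ₑ := by
  rw [eLpNorm_eq_lintegral_rpow_enorm_toReal (by simp) (by simp), l2]
  simp

lemma MemLpW.exists_measurable_two {q : ℝ} {f : V → ℂ} (hf : MemLpW 2 q f) :
    ∃ f₀ : V → ℂ, Measurable f₀ ∧ f =ᵐ[volume] f₀ ∧
      l2 (fun v => ‖weighted q f₀ v‖ₑ) = ENNReal.ofReal (normLpW 2 q f) := by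
  obtain ⟨f₀, hm, he⟩ := exists_measurable_of_weighted hf.1
  refine ⟨f₀, hm, he, ?_⟩
  rw [normLpW, ENNReal.ofReal_toReal hf.2.ne, ← eLpNorm_two_eq_l2]
  exact eLpNorm_congr_ae (weighted_ae_eq q he).symm

/-- The infimum in the definition of the Sobolev norm is attained at the only admissible `G`. -/
lemma enormHW_eq {m q : ℝ} {g : V → ℂ} {u G : Lp ℂ 2 (volume : Measure V)}
    (hu : u =ᵐ[volume] weighted q g)
    (h : TemperedDistribution.besselPotential V ℂ m (u : 𝓢'(V, ℂ)) = (G : 𝓢'(V, ℂ))) :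
    enormHW m q g = ‖G‖ₑ := by
  refine le_antisymm (iInf_le_of_le u (iInf_le_of_le hu (iInf_le_of_le G (iInf_le _ h)))) ?_
  refine le_iInf fun u' => le_iInf fun hu' => le_iInf fun G' => le_iInf fun h' => ?_
  obtain rfl : u' = u := Lp.ext (hu'.trans hu.symm)
  have hG : (G : 𝓢'(V, ℂ)) = (G' : 𝓢'(V, ℂ)) := h.symm.trans h'
  have hinj := LinearMap.ker_eq_bot.mp
    (Lp.ker_toTemperedDistributionCLM_eq_bot (F := ℂ) (μ := (volume : Measure V)) (p := 2))
  rw [hinj hG]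

/-- A finite Sobolev norm enters the estimates through the `L²` norm and the `L²` modulus of
continuity only. -/
lemma MemHW.exists_measurable {m m' q : ℝ} (hm : 0 < m) (hm1 : m ≤ 1) (hmm : m ≤ m') {g : V → ℂ}
    (hg : MemHW m' q g) : ∃ g₀ : V → ℂ, Measurable g₀ ∧ g =ᵐ[volume] g₀ ∧
      l2 (fun v => ‖weighted q g₀ v‖ₑ) ≤ ENNReal.ofReal (7 * normHW m' q g) ∧
      HasL2Modulus m (weighted q g₀) (ENNReal.ofReal (7 * normHW m' q g)) := by
  have hg' := hg
  simp only [MemHW, enormHW, iInf_lt_iff] at hg'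
  obtain ⟨u, hu, G, hG, -⟩ := hg'
  have hN : ENNReal.ofReal (7 * normHW m' q g) = 7 * ‖G‖ₑ := by
    rw [normHW, ENNReal.ofReal_mul (by norm_num), ENNReal.ofReal_toReal hg.ne, enormHW_eq hu hG]
    norm_num
  obtain ⟨g₀, hm₀, he⟩ := exists_measurable_of_weighted ((Lp.aestronglyMeasurable u).congr hu)
  have hu₀ := hu.trans (weighted_ae_eq q he)
  refine ⟨g₀, hm₀, he, ?_, fun y => ?_⟩
  · refine le_of_sq_le_sq ?_
    rw [l2_sq, lintegral_enorm_sq_eq u hu₀, hN]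
    have h1 := norm_le_of_besselPotential_eq (hm.le.trans hmm) hG
    have h2 : ‖u‖ₑ ≤ ‖G‖ₑ := by
      rw [← ofReal_norm, ← ofReal_norm]; exact ENNReal.ofReal_le_ofReal h1
    have h3 : ‖u‖ₑ ≤ 7 * ‖G‖ₑ :=
      h2.trans (le_mul_of_one_le_left zero_le (by norm_num))
    gcongr
  · refine (lintegral_translate_sub_le hm hm1 hmm hG hu₀ y).trans (le_of_eq ?_)
    rw [hN, mul_pow]
    norm_num

lemma norm_le_of_enorm_le {L : ℂ} {C A B D : ℝ} (hC : 0 ≤ C) (hA : 0 ≤ A) (hB : 0 ≤ B) (hD : 0 ≤ D)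
    (h : ‖L‖ₑ ≤ ENNReal.ofReal C * ENNReal.ofReal A * (ENNReal.ofReal B * ENNReal.ofReal D)) :
    ‖L‖ ≤ C * A * B * D := by
  rw [← ENNReal.ofReal_mul hC, ← ENNReal.ofReal_mul hB, ← ENNReal.ofReal_mul (by positivity),
    ← ofReal_norm, ENNReal.ofReal_le_ofReal_iff (by positivity)] at h
  linarith

/-! ### The estimates for arbitrary representatives -/

theorem exists_commutator_bound_l1 (γ : ℝ) (l : ℕ) {s : ℝ} {b : ℝ → ℝ}
    (hb : IsAngularFactor s b) (hs : s < 1 / 2) : ∃ C : ℝ, 0 < C ∧ ∀ f g h : V → ℂ,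
      MemLpW 1 (l + max γ 0) f → MemLpW 2 (l + max γ 0) g → MemLpW 2 0 h →
      ∃ L : ℂ, HasCommutatorPairing γ b l f g h L ∧
        ‖L‖ ≤ C * normLpW 1 (l + max γ 0) f * normLpW 2 (l + max γ 0) g * normLpW 2 0 h := by
  obtain ⟨C, hC, H⟩ := exists_pairing_of_lt_half γ l hb hs
  refine ⟨C + 1, by positivity, fun f g h hf hg hh => ?_⟩
  obtain ⟨f₀, hfm, hfe, hfN⟩ := hf.exists_measurable_one
  obtain ⟨g₀, hgm, hge, hgN⟩ := hg.exists_measurable_two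
  obtain ⟨h₀, hhm, hhe, hhN⟩ := hh.exists_measurable_two
  rw [weighted_zero] at hhN
  obtain ⟨L, hL, hLN⟩ := H f₀ g₀ h₀ hfm hgm hhm (by rw [hfN]; finiteness) (by rw [hgN]; finiteness)
    (by rw [hhN]; finiteness)
  rw [hfN, hgN, hhN] at hLN
  refine ⟨L, hL.congr hfe hge hhe, ?_⟩
  have n1 := normLpW_nonneg 1 (l + max γ 0) f
  have n2 := normLpW_nonneg 2 (l + max γ 0) g
  have n3 := normLpW_nonneg 2 0 h
  refine (norm_le_of_enorm_le hC n1 n2 n3 hLN).trans ?_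
  gcongr
  linarith

theorem exists_commutator_bound_l2 (γ : ℝ) (l : ℕ) {s : ℝ} {b : ℝ → ℝ}
    (hb : IsAngularFactor s b) (hs0 : 0 < s) (hs : s < 1 / 2) (hl : 3 / 2 + 2 * s < l) :
    ∃ C : ℝ, 0 < C ∧ ∀ f g h : V → ℂ,
      MemLpW 2 (l + max γ 0) f → MemLpW 2 (l + max γ 0) g → MemLpW 2 0 h →
      ∃ L : ℂ, HasCommutatorPairing γ b l f g h L ∧
        ‖L‖ ≤ C * normLpW 2 (l + max γ 0) f * normLpW 2 (l + max γ 0) g * normLpW 2 0 h := by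
  obtain ⟨C, hC, H⟩ := exists_pairing_of_lt_half_l2 γ l hb hs0 hs hl
  refine ⟨C + 1, by positivity, fun f g h hf hg hh => ?_⟩
  obtain ⟨f₀, hfm, hfe, hfN⟩ := hf.exists_measurable_two
  obtain ⟨g₀, hgm, hge, hgN⟩ := hg.exists_measurable_two
  obtain ⟨h₀, hhm, hhe, hhN⟩ := hh.exists_measurable_two
  rw [weighted_zero] at hhN
  obtain ⟨L, hL, hLN⟩ := H f₀ g₀ h₀ hfm hgm hhm (by rw [hfN]; finiteness) (by rw [hgN]; finiteness)
    (by rw [hhN]; finiteness)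
  rw [hfN, hgN, hhN] at hLN
  refine ⟨L, hL.congr hfe hge hhe, ?_⟩
  have n1 := normLpW_nonneg 2 (l + max γ 0) f
  have n2 := normLpW_nonneg 2 (l + max γ 0) g
  have n3 := normLpW_nonneg 2 0 h
  refine (norm_le_of_enorm_le hC n1 n2 n3 hLN).trans ?_
  gcongr
  linarith

/-- The exponent `κ'` measures the singularity and may be smaller than the exponent `κ` of the
norms, which need not be below `1`. -/
theorem exists_commutator_bound_sobolev (γ : ℝ) (l : ℕ) {s κ κ' ε : ℝ} {b : ℝ → ℝ}
    (hb : IsAngularFactor s b) (hκ' : 0 < κ') (hκ : κ' ≤ κ) (hκ1 : κ' < 1) (hs : 2 * s ≤ 1 + κ')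
    (hε : 0 < ε) : ∃ C : ℝ, 0 < C ∧
      (∀ f g h : V → ℂ, MemLpW 1 (l + κ + max γ 0) f → MemHW (κ + ε) (l + κ + max γ 0) g →
        MemLpW 2 0 h → ∃ L : ℂ, HasCommutatorPairing γ b l f g h L ∧
          ‖L‖ ≤ C * normLpW 1 (l + κ + max γ 0) f *
            normHW (κ + ε) (l + κ + max γ 0) g * normLpW 2 0 h) ∧
      (∀ f g h : V → ℂ, MemLpW 1 (l + κ + max γ 0) f → MemLpW 2 (l + κ + max γ 0) g →
        MemHW (κ + ε) l h → ∃ L : ℂ, HasCommutatorPairing γ b l f g h L ∧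
          ‖L‖ ≤ C * normLpW 1 (l + κ + max γ 0) f *
            normLpW 2 (l + κ + max γ 0) g * normHW (κ + ε) l h) := by
  -- The regularity `ε` pays for an order `m` above the order `κ'` of the kernel. It is kept below
  -- `1`, the largest order that increments detect.
  obtain ⟨m, hκm, hm1, hmε⟩ : ∃ m, κ' < m ∧ m < 1 ∧ m ≤ κ + ε := by
    refine ⟨min (κ' + ε) ((κ' + 1) / 2), lt_min (by linarith) (by linarith),
      (min_le_right _ _).trans_lt (by linarith), (min_le_left _ _).trans (by linarith)⟩
  have hm0 : 0 < m := hκ'.trans hκm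
  obtain ⟨C₁, hC₁, H₁⟩ := exists_pairing_increments_left γ l hb hκ' hκ hκm hm1 hs
  obtain ⟨C₂, hC₂, H₂⟩ := exists_pairing_increments_right γ l hb hκ' hκ hκm hm1 hs
  refine ⟨7 * C₁ + 7 * C₂ + 1, by positivity, fun f g h hf hg hh => ?_, fun f g h hf hg hh => ?_⟩
  · obtain ⟨f₀, hfm, hfe, hfN⟩ := hf.exists_measurable_one
    obtain ⟨g₀, hgm, hge, hgN, hgM⟩ := hg.exists_measurable hm0 hm1.le hmε
    obtain ⟨h₀, hhm, hhe, hhN⟩ := hh.exists_measurable_two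
    rw [weighted_zero] at hhN
    obtain ⟨L, hL, hLN⟩ := H₁ f₀ g₀ h₀ _ hfm hgm hhm (by rw [hfN]; finiteness)
      (by rw [hhN]; finiteness) hgN hgM (by finiteness)
    rw [hfN, hhN] at hLN
    refine ⟨L, hL.congr hfe hge hhe, ?_⟩
    have n1 := normLpW_nonneg 1 (l + κ + max γ 0) f
    have n2 := normHW_nonneg (κ + ε) (l + κ + max γ 0) g
    have n3 := normLpW_nonneg 2 0 h
    calc ‖L‖ ≤ _ := norm_le_of_enorm_le hC₁ n1 n3 (by positivity) hLN
      _ = 7 * C₁ * normLpW 1 (l + κ + max γ 0) f * normHW (κ + ε) (l + κ + max γ 0) g *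
          normLpW 2 0 h := by ring
      _ ≤ _ := by
          gcongr
          linarith
  · obtain ⟨f₀, hfm, hfe, hfN⟩ := hf.exists_measurable_one
    obtain ⟨g₀, hgm, hge, hgN⟩ := hg.exists_measurable_two
    obtain ⟨h₀, hhm, hhe, hhN, hhM⟩ := hh.exists_measurable hm0 hm1.le hmε
    obtain ⟨L, hL, hLN⟩ := H₂ f₀ g₀ h₀ _ hfm hgm hhm (by rw [hfN]; finiteness)
      (by rw [hgN]; finiteness) hhN hhM (by finiteness)
    rw [hfN, hgN] at hLN
    refine ⟨L, hL.congr hfe hge hhe, ?_⟩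
    have n1 := normLpW_nonneg 1 (l + κ + max γ 0) f
    have n2 := normLpW_nonneg 2 (l + κ + max γ 0) g
    have n3 := normHW_nonneg (κ + ε) l h
    calc ‖L‖ ≤ _ := norm_le_of_enorm_le hC₂ n1 n2 (by positivity) hLN
      _ = 7 * C₂ * normLpW 1 (l + κ + max γ 0) f * normLpW 2 (l + κ + max γ 0) g *
          normHW (κ + ε) l h := by ring
      _ ≤ _ := by
          gcongr
          linarith

end Boltzmann

end

theorem lemma2p2 (γ s : ℝ) (b : ℝ → ℝ) (hb : IsAngularFactor s b) (l : ℕ) :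
    (0 < s ∧ s < 1 / 2 →
      (∃ C : ℝ, 0 < C ∧ ∀ f g h : V → ℂ,
        MemLpW 1 (l + max γ 0) f → MemLpW 2 (l + max γ 0) g → MemLpW 2 0 h →
        ∃ L : ℂ, HasCommutatorPairing γ b l f g h L ∧
          ‖L‖ ≤ C * normLpW 1 (l + max γ 0) f * normLpW 2 (l + max γ 0) g * normLpW 2 0 h) ∧
      (3 / 2 + 2 * s < (l : ℝ) →
        ∃ C : ℝ, 0 < C ∧ ∀ f g h : V → ℂ,
          MemLpW 2 (l + max γ 0) f → MemLpW 2 (l + max γ 0) g → MemLpW 2 0 h →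
          ∃ L : ℂ, HasCommutatorPairing γ b l f g h L ∧
            ‖L‖ ≤ C * normLpW 2 (l + max γ 0) f * normLpW 2 (l + max γ 0) g * normLpW 2 0 h)) ∧
    (1 / 2 < s ∧ s < 1 → ∀ ε : ℝ, 0 < ε → ∃ C : ℝ, 0 < C ∧
      (∀ f g h : V → ℂ,
        MemLpW 1 (l + (2 * s - 1) + max γ 0) f →
        MemHW (2 * s - 1 + ε) (l + (2 * s - 1) + max γ 0) g → MemLpW 2 0 h →
        ∃ L : ℂ, HasCommutatorPairing γ b l f g h L ∧
          ‖L‖ ≤ C * normLpW 1 (l + (2 * s - 1) + max γ 0) f *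
            normHW (2 * s - 1 + ε) (l + (2 * s - 1) + max γ 0) g * normLpW 2 0 h) ∧
      (∀ f g h : V → ℂ,
        MemLpW 1 (l + (2 * s - 1) + max γ 0) f →
        MemLpW 2 (l + (2 * s - 1) + max γ 0) g → MemHW (2 * s - 1 + ε) l h →
        ∃ L : ℂ, HasCommutatorPairing γ b l f g h L ∧
          ‖L‖ ≤ C * normLpW 1 (l + (2 * s - 1) + max γ 0) f *
            normLpW 2 (l + (2 * s - 1) + max γ 0) g * normHW (2 * s - 1 + ε) l h)) ∧
    (s = 1 / 2 → ∀ κ : ℝ, 0 < κ → ∀ ε : ℝ, 0 < ε → ∃ C : ℝ, 0 < C ∧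
      (∀ f g h : V → ℂ,
        MemLpW 1 (l + κ + max γ 0) f →
        MemHW (κ + ε) (l + κ + max γ 0) g → MemLpW 2 0 h →
        ∃ L : ℂ, HasCommutatorPairing γ b l f g h L ∧
          ‖L‖ ≤ C * normLpW 1 (l + κ + max γ 0) f *
            normHW (κ + ε) (l + κ + max γ 0) g * normLpW 2 0 h) ∧
      (∀ f g h : V → ℂ,
        MemLpW 1 (l + κ + max γ 0) f →
        MemLpW 2 (l + κ + max γ 0) g → MemHW (κ + ε) l h →
        ∃ L : ℂ, HasCommutatorPairing γ b l f g h L ∧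
          ‖L‖ ≤ C * normLpW 1 (l + κ + max γ 0) f *
            normLpW 2 (l + κ + max γ 0) g * normHW (κ + ε) l h)) := by
  refine ⟨fun ⟨hs0, hs⟩ => ⟨exists_commutator_bound_l1 γ l hb hs,
    fun hl => exists_commutator_bound_l2 γ l hb hs0 hs hl⟩, fun ⟨hs0, hs⟩ ε hε => ?_,
    fun hs κ hκ ε hε => ?_⟩
  · exact exists_commutator_bound_sobolev γ l hb (κ := 2 * s - 1) (κ' := 2 * s - 1) (by linarith)
      le_rfl (by linarith) (by linarith) hε
  -- A singularity of order `2s = 1` is bounded by one of order `1 + κ'` for any `κ' > 0`; the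
  -- estimates need `κ' < 1`, also if `κ ≥ 1`.
  · exact exists_commutator_bound_sobolev γ l hb (κ' := min κ (1 / 2)) (lt_min hκ (by norm_num))
      (min_le_left _ _) ((min_le_right _ _).trans_lt (by norm_num))
      (by have := lt_min hκ (by norm_num : (0 : ℝ) < 1 / 2); linarith) hε
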